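/- Let $n\ge 1$, let $\mathbf x_1,\dots,\mathbf x_n\in\mathbb R^3$ be distinct points, put $S=\{\mathbf x_1,\dots,\mathbf x_n\}$, and let $\beta>0$, $\kappa\in\mathbb R$. For vector fields $\mathbf E,\mathbf B$ on $\mathbb R^3$ let $$s=\tfrac12(\mathbf E^2-\mathbf B^2)+\tfrac{\kappa^2}{2}(\mathbf E\cdot\mathbf B)^2,\qquad \mathcal H=\frac{\mathbf E^2+\kappa^2(\mathbf E\cdot\mathbf B)^2}{\sqrt{1-2\beta s}}-\frac1\beta\bigl(1-\sqrt{1-2\beta s}\bigr).$$ A static solution of the Born–Infeld equations with charge densities $\rho_e,\rho_m$ and current densities $\mathbf j_e,\mathbf j_m$ (distributions on $\mathbb R^3$) consists of locally integrable fields $\mathbf E,\mathbf B,\mathbf D,\mathbf H$ on $\mathbb R^3$, smooth on $\mathbb R^3\setminus S$, such that on $\mathbb R^3\setminus S$ one has $1-2\beta s>0$ and $$\mathbf D=\frac{\mathbf E+\kappa^2(\mathbf E\cdot\mathbf B)\mathbf B}{\sqrt{1-2\beta s}},\qquad \mathbf H=\frac{\mathbf B-\kappa^2(\mathbf E\cdot\mathbf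 B)\mathbf E}{\sqrt{1-2\beta s}},$$ and such that, in the sense of distributions on $\mathbb R^3$, $$\nabla\times\mathbf E=-\mathbf j_m,\quad \nabla\times\mathbf H=\mathbf j_e,\quad \nabla\cdot\mathbf D=\rho_e,\quad \nabla\cdot\mathbf B=\rho_m .$$ Its energy is finite if $\mathcal H$ is integrable on $\mathbb R^3$. For $q=(q_1,\dots,q_n)$ write $\mathbf C_q(\mathbf x)=\sum_{i=1}^n \dfrac{q_i(\mathbf x-\mathbf x_i)}{4\pi|\mathbf x-\mathbf x_i|^3}$. Below, $\nabla\cdot\mathbf E$, $\nabla\times\mathbf E$, etc. without further comment are the pointwise expressions on $\mathbb R^3\setminus S$. **Theorem 2.1.** (i) Let $q_1,\dots,q_n\in\mathbb R\setminus\{0\}$. Then $\mathbf D=\mathbf C_q$, $\mathbf E=\mathbf D/\sqrt{1+\beta\mathbf D^2}$, $\mathbf B=\mathbf H=\mathbf 0$ is a static solution with $\rho_e=\sum_i q_i\delta_{\mathbf x_i}$, $\rho_m=0$, $\mathbf j_e=\mathbf 0$, and $\mathbf j_m=-\nabla\times\mathbf E$, a locally integrable function. Its energy is finite, $\nabla\cdot\mathbf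 E$ is integrable on $\mathbb R^3$, and the total free electric charge is $\int_{\mathbb R^3}\nabla\cdot\mathbf E\,d\mathbf x=\sum_i q_i$. If $n\ge2$, then $\nabla\times\mathbf E\ne\mathbf 0$ at some point of $\mathbb R^3\setminus S$, and $\mathbf j_m\neq\mathbf 0$. (ii) Let $g_1,\dots,g_n\in\mathbb R\setminus\{0\}$. Then $\mathbf B=\mathbf C_g$, $\mathbf H=\mathbf B/\sqrt{1+\beta\mathbf B^2}$, $\mathbf E=\mathbf D=\mathbf 0$ is a static solution with $\rho_m=\sum_i g_i\delta_{\mathbf x_i}$, $\rho_e=0$, $\mathbf j_m=\mathbf 0$, and $\mathbf j_e=\nabla\times\mathbf H$, a locally integrable function. Its energy is finite, $\nabla\cdot\mathbf H$ is integrable on $\mathbb R^3$, and the total free magnetic charge is $\int_{\mathbb R^3}\nabla\cdot\mathbf H\,d\mathbf x=\sum_i g_i$. If $n\ge2$, then $\nabla\times\mathbf H\ne\mathbf 0$ at some point of $\mathbb R^3\setminus S$, and $\mathbf j_e\neq\mathbf 0$. (iii) Let $q_1,\dots,q_n,g_1,\dots,g_n\in\mathbb R\setminus\{0\}$, $\mathbf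 D=\mathbf C_q$, $\mathbf B=\mathbf C_g$, $\Delta=1+\beta\mathbf D^2+\kappa^2\mathbf B^2+\beta\kappa^2(\mathbf B\times\mathbf D)^2$, $\mathcal D=\sqrt{1+\beta\mathbf B^2}\,(1+\kappa^2\mathbf B^2)^{3/2}\sqrt{\Delta}$, and $$\mathbf E=\frac{\sqrt{1+\beta\mathbf B^2}\,\bigl((1+\kappa^2\mathbf B^2)\mathbf D-\kappa^2(\mathbf B\cdot\mathbf D)\mathbf B\bigr)}{\sqrt{1+\kappa^2\mathbf B^2}\,\sqrt{\Delta}},$$ $$\mathbf H=\frac{1+\beta\mathbf D^2+\kappa^2\bigl(2\mathbf B^2+2\beta(\mathbf B\times\mathbf D)^2+\beta(\mathbf B\cdot\mathbf D)^2\bigr)+\kappa^4\bigl((\mathbf B\cdot\mathbf D)^2+(1+\beta\mathbf D^2)(\mathbf B^2)^2\bigr)}{\mathcal D}\,\mathbf B-\frac{\kappa^2(1+\beta\mathbf B^2)(1+\kappa^2\mathbf B^2)(\mathbf B\cdot\mathbf D)}{\mathcal D}\,\mathbf D .$$ Then $(\mathbf E,\mathbf B,\mathbf D,\mathbf H)$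 is a static solution with $\rho_e=\sum_i q_i\delta_{\mathbf x_i}$, $\rho_m=\sum_i g_i\delta_{\mathbf x_i}$ and suitable $\mathbf j_e,\mathbf j_m$. Its energy is finite if and only if $\kappa\ne0$. If $\kappa\neq0$, the total free charges, with the integrals over $\mathbb R^3$ understood as the limits as $r\to0^+$, $R\to\infty$ of the integrals over $\{|\mathbf x|<R,\ |\mathbf x-\mathbf x_i|>r \text{ for all } i\}$, are $\int\nabla\cdot\mathbf E\,d\mathbf x=\sum_i q_i$ and $\int\nabla\cdot\mathbf H\,d\mathbf x=\sum_i g_i$. If $\kappa\ne0$ and $n\ge2$, then $\nabla\times\mathbf E$ and $\nabla\times\mathbf H$ are each nonzero at some point of $\mathbb R^3\setminus S$, and $\mathbf j_m\ne\mathbf 0$, $\mathbf j_e\neq\mathbf 0$. -/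

import Mathlib

open MeasureTheory Filter Topology
open scoped ContDiff Distributions LineDeriv

noncomputable section

namespace BornInfeld

/-- Euclidean three-space. -/
abbrev Space := EuclideanSpace ℝ (Fin 3)

/-- The standard basis vector in direction `j`. -/
def basisVec (j : Fin 3) : Space := EuclideanSpace.single j (1 : ℝ)

/-- The vector product of `ℝ³`. -/
def cross (a b : Space) : Space := WithLp.toLp 2 (crossProduct a.ofLp b.ofLp)

/-! ### Classical vector calculus -/

/-- The partial derivative `∂_j F^k` at `y`. -/
def partialDeriv (F : Space → Space) (j k : Fin 3) (y : Space) : ℝ :=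
  (fderiv ℝ F y (basisVec j)) k

/-- The pointwise divergence `∇ · F`. -/
def divergence (F : Space → Space) (y : Space) : ℝ :=
  ∑ k, partialDeriv F k k y

/-- The pointwise curl `∇ × F`. -/
def curl (F : Space → Space) (y : Space) : Space :=
  !₂[partialDeriv F 1 2 y - partialDeriv F 2 1 y,
     partialDeriv F 2 0 y - partialDeriv F 0 2 y,
     partialDeriv F 0 1 y - partialDeriv F 1 0 y]

/-! ### Distributional vector calculus on the whole space -/

/-- Real-valued distributions on `ℝ³`. -/
abbrev ScalarDist := 𝓓'((⊤ : TopologicalSpace.Opens Space), ℝ)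

/-- Vector-valued distributions on `ℝ³`, given by their three components. -/
abbrev VectorDist := Fin 3 → ScalarDist

/-- The vector distribution `φ ↦ ∫ φ F` defined by a (locally integrable) vector field `F`. -/
def toDist (F : Space → Space) : VectorDist := fun k =>
  (TestFunction.integralAgainstBilinCLM (ContinuousLinearMap.mul ℝ ℝ) volume
    (fun y => F y k) : 𝓓((⊤ : TopologicalSpace.Opens Space), ℝ) →L[ℝ] ℝ)

/-- The divergence of a vector distribution. -/
def distDiv (T : VectorDist) : ScalarDist :=
  ∑ k, ∂_{basisVec k} (T k)

/-- The curl of a vector distribution. -/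
def distCurl (T : VectorDist) : VectorDist :=
  ![∂_{basisVec 1} (T 2) - ∂_{basisVec 2} (T 1),
    ∂_{basisVec 2} (T 0) - ∂_{basisVec 0} (T 2),
    ∂_{basisVec 0} (T 1) - ∂_{basisVec 1} (T 0)]

/-- The point-charge density `∑ᵢ qᵢ δ(x - xᵢ)`. -/
def pointCharges {n : ℕ} (x : Fin n → Space) (q : Fin n → ℝ) : ScalarDist :=
  ∑ i, q i • Distribution.delta (x i)

/-! ### The Born–Infeld theory -/

/-- The invariant `s = (E² - B²)/2 + κ² (E · B)²/2`. -/
def invariant (κ : ℝ) (E B : Space) : ℝ :=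
  (‖E‖ ^ 2 - ‖B‖ ^ 2) / 2 + κ ^ 2 / 2 * (inner ℝ E B) ^ 2

/-- The Born–Infeld constitutive equations between the vectors `E, B, D, H`; the quantity under the
square root is required to be positive. -/
def Constitutive (β κ : ℝ) (E B D H : Space) : Prop :=
  0 < 1 - 2 * β * invariant κ E B ∧
  D = (1 / √(1 - 2 * β * invariant κ E B)) • (E + (κ ^ 2 * inner ℝ E B) • B) ∧
  H = (1 / √(1 - 2 * β * invariant κ E B)) • (B - (κ ^ 2 * inner ℝ E B) • E)

/-- The Hamiltonian energy density
`(E² + κ² (E · B)²)/√(1 - 2βs) - (1 - √(1 - 2βs))/β`. -/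
def energyDensity (β κ : ℝ) (E B : Space) : ℝ :=
  (‖E‖ ^ 2 + κ ^ 2 * (inner ℝ E B) ^ 2) / √(1 - 2 * β * invariant κ E B)
    - 1 / β * (1 - √(1 - 2 * β * invariant κ E B))

/-- `(E, B, D, H)` is a static solution of the Born–Infeld equations with electric and magnetic
charge densities `ρe`, `ρm` and current densities `je`, `jm`: the fields are smooth off the singular
set `S` and obey the constitutive equations there, they are locally integrable on `ℝ³`, and
`∇ × E = -jm`, `∇ × H = je`, `∇ · D = ρe`, `∇ · B = ρm` as distributions on all of `ℝ³`. -/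
structure IsStaticSolution (β κ : ℝ) (S : Set Space) (ρe ρm : ScalarDist) (je jm : VectorDist)
    (E B D H : Space → Space) : Prop where
  smooth_E : ContDiffOn ℝ ∞ E Sᶜ
  smooth_B : ContDiffOn ℝ ∞ B Sᶜ
  smooth_D : ContDiffOn ℝ ∞ D Sᶜ
  smooth_H : ContDiffOn ℝ ∞ H Sᶜ
  locInt_E : LocallyIntegrable E
  locInt_B : LocallyIntegrable B
  locInt_D : LocallyIntegrable D
  locInt_H : LocallyIntegrable H
  constitutive : ∀ y ∈ Sᶜ, Constitutive β κ (E y) (B y) (D y) (H y)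
  faraday : distCurl (toDist E) = -jm
  ampere : distCurl (toDist H) = je
  coulomb : distDiv (toDist D) = ρe
  gauss : distDiv (toDist B) = ρm

/-- The total energy `∫ 𝓗` is finite. -/
def FiniteEnergy (β κ : ℝ) (E B : Space → Space) : Prop :=
  Integrable (fun y => energyDensity β κ (E y) (B y))

/-- The total free charge induced by the field `F` is `Q`, with an absolutely convergent integral
`∫ ∇ · F` over `ℝ³`. -/
def HasFreeCharge (F : Space → Space) (Q : ℝ) : Prop :=
  Integrable (divergence F) ∧ ∫ y, divergence F y = Q

/-- A large ball with the closed balls of radius `r` around the points `xᵢ` removed. -/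
def truncatedSpace {n : ℕ} (x : Fin n → Space) (r R : ℝ) : Set Space :=
  {y | ‖y‖ < R ∧ ∀ i, r < ‖y - x i‖}

/-- The total free charge induced by the field `F` is `Q`, with `∫ ∇ · F` over `ℝ³` understood as
the limit, as `r → 0` and `R → ∞`, of the integrals over the truncated space. -/
def HasFreeChargeLim {n : ℕ} (x : Fin n → Space) (F : Space → Space) (Q : ℝ) : Prop :=
  (∀ r R : ℝ, 0 < r → IntegrableOn (divergence F) (truncatedSpace x r R)) ∧
  Tendsto (fun p : ℝ × ℝ => ∫ y in truncatedSpace x p.1 p.2, divergence F y)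
    (𝓝[>] (0 : ℝ) ×ˢ atTop) (𝓝 Q)

/-! ### The explicit fields -/

/-- The Coulomb superposition `∑ᵢ qᵢ (x - xᵢ) / (4π |x - xᵢ|³)`. -/
def coulombField {n : ℕ} (x : Fin n → Space) (q : Fin n → ℝ) (y : Space) : Space :=
  ∑ i, (q i / (4 * Real.pi * ‖y - x i‖ ^ 3)) • (y - x i)

/-- `v / √(1 + β v²)`. -/
def saturate (β : ℝ) (v : Space) : Space := (1 / √(1 + β * ‖v‖ ^ 2)) • v

/-- `1 + β D² + κ² B² + β κ² (B × D)²`. -/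
def dyonDet (β κ : ℝ) (D B : Space) : ℝ :=
  1 + β * ‖D‖ ^ 2 + κ ^ 2 * ‖B‖ ^ 2 + β * κ ^ 2 * ‖cross B D‖ ^ 2

/-- The electric field of the dyonic solution in terms of `D` and `B`. -/
def dyonE (β κ : ℝ) (D B : Space) : Space :=
  (√(1 + β * ‖B‖ ^ 2) / (√(1 + κ ^ 2 * ‖B‖ ^ 2) * √(dyonDet β κ D B))) •
    ((1 + κ ^ 2 * ‖B‖ ^ 2) • D - (κ ^ 2 * inner ℝ B D) • B)

/-- The common denominator in the magnetic intensity field of the dyonic solution. -/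
def dyonDenom (β κ : ℝ) (D B : Space) : ℝ :=
  √(1 + β * ‖B‖ ^ 2) * √(1 + κ ^ 2 * ‖B‖ ^ 2) ^ 3 * √(dyonDet β κ D B)

/-- The magnetic intensity field of the dyonic solution in terms of `D` and `B`. -/
def dyonH (β κ : ℝ) (D B : Space) : Space :=
  ((1 + β * ‖D‖ ^ 2
      + κ ^ 2 * (2 * ‖B‖ ^ 2 + 2 * β * ‖cross B D‖ ^ 2 + β * (inner ℝ B D) ^ 2)
      + κ ^ 4 * ((inner ℝ B D) ^ 2 + (1 + β * ‖D‖ ^ 2) * ‖B‖ ^ 4)) / dyonDenom β κ D B) • B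
  - (κ ^ 2 * (1 + β * ‖B‖ ^ 2) * (1 + κ ^ 2 * ‖B‖ ^ 2) * inner ℝ B D / dyonDenom β κ D B) • D

end BornInfeld

end

/-!
The energy density, the constitutive relations and the fluxes are explicit functions of the two
Coulomb fields, so everything except the statements `∇ × E ≠ 0`, `∇ × H ≠ 0` follows from the
asymptotics of the fields at the charges and at infinity.

*Static solutions, energy, free charge.* Near a charge `x i` a Coulomb field is its own singular
kernel plus a bounded field, and away from the charges it is divergence free with a symmetric
derivative. The fields `E` and `H` of (i) and (ii) are bounded with derivatives `O(|x - x i|⁻²)`, so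
that their distributional curls are the pointwise ones (`distCurl_toDist_eq_toDist_curl`). In (iii)
the leading singularities of `D` and `B` are parallel, which makes `B × D` smaller than its factors
(`cross_coulombField_isBigO`); the energy density is then `O(|x - x i|⁻²)` at a charge if `κ ≠ 0`,
but at least of the order `|x - x i|⁻⁴` if `κ = 0`. At infinity `E` and `H` agree with Coulomb
fields to leading order, and at the charges their radial components are too small to carry flux, so
the free charge is that of the Coulomb field (`hasFreeChargeLim_of_isBigO`; radial cutoffs replace
the divergence theorem on the perforated ball).

*Nonvanishing curl.* If `E` (or `H`) were irrotational, squaring away the square roots would give a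
polynomial identity between the values and first derivatives of `B` and of `V = D - l B`, where `l`
is the ratio of the charges at a fixed `x i`, so that `V` is regular there
(`electricObstruction_eq_zero`, `magneticObstruction_eq_zero`, `coreObstruction_eq_zero`). Real
asymptotics at `x i` cancel to high order, the leading singularity being radial. The identity is
therefore continued analytically to complex points of a plane through `x i`
(`eq_zero_on_complexPoint`), which may approach the null cone `(x - x i)² = 0` of the charge away
from its vertex. There the Coulomb kernel of `x i` is singular while its direction is the null
vector `N`, and the leading coefficient of the identity is a nonzero multiple of the cube of
`ξ (V · N)` at the point `ξ N` of the cone (`tendsto_electricObstruction`,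
`tendsto_magneticObstruction`). Hence `V · N` vanishes along the line `ξ ↦ ξ N` for a generic `N`,
and the successive derivatives in `ξ` form a Vandermonde system for the charges of `V`
(`eq_zero_of_coneMoment_eq_zero`); so `V = 0`. For proportional fields the identity reduces, up to
a factor that is nonzero near `x i`, to `∇(B²) ∧ B = 0`, which is also what an irrotational field in
(i) or (ii) satisfies. The same argument, in which the regular part of `B` at `x i` takes the place
of `V`, shows that `B` has no charge other than that at `x i`.
-/

noncomputable section

namespace BornInfeld

section

/-! ### The Coulomb kernel -/

theorem norm_cross_sq (a b : Space) :
    ‖cross a b‖ ^ 2 = ‖a‖ ^ 2 * ‖b‖ ^ 2 - (inner ℝ a b) ^ 2 := by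
  simp only [EuclideanSpace.norm_sq_eq, PiLp.inner_apply, Fin.sum_univ_three, cross, crossProduct,
    Real.norm_eq_abs, sq_abs]
  simp
  ring

/-- The kernel `z / |z|³` of the Coulomb field. -/
def coulombKernel (z : Space) : Space := (‖z‖⁻¹ ^ 3) • z

/-- The derivative of `coulombKernel`, away from the origin. -/
def coulombKernelDeriv (z : Space) : Space →L[ℝ] Space :=
  (‖z‖⁻¹ ^ 3) • ContinuousLinearMap.id ℝ Space
    - (3 * ‖z‖⁻¹ ^ 5) • (innerSL ℝ z).smulRight z

theorem coulombField_eq {n : ℕ} (x : Fin n → Space) (q : Fin n → ℝ) (y : Space) :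
    coulombField x q y = ∑ i, (q i / (4 * Real.pi)) • coulombKernel (y - x i) := by
  simp only [coulombField, coulombKernel, smul_smul]
  refine Finset.sum_congr rfl fun i _ => ?_
  congr 1
  rw [inv_pow, div_mul_eq_div_div]
  rfl

theorem contDiffAt_coulombKernel {z : Space} (hz : z ≠ 0) : ContDiffAt ℝ ω coulombKernel z := by
  have h : ContDiffAt ℝ ω (fun z : Space => ‖z‖) z := contDiffAt_norm ℝ hz
  exact ((h.inv (norm_ne_zero_iff.2 hz)).pow 3).smul contDiffAt_id

theorem hasFDerivAt_coulombKernel {z : Space} (hz : z ≠ 0) :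
    HasFDerivAt coulombKernel (coulombKernelDeriv z) z := by
  have hn : ‖z‖ ≠ 0 := norm_ne_zero_iff.2 hz
  have h1 : HasFDerivAt (fun z : Space => ‖z‖) (‖z‖⁻¹ • innerSL ℝ z) z := by
    have h2 := (hasStrictFDerivAt_norm_sq z).hasFDerivAt
    have h3 := h2.sqrt (by positivity)
    have h4 : (fun y : Space => √(‖y‖ ^ 2)) = fun y => ‖y‖ := by
      ext y; exact Real.sqrt_sq (norm_nonneg _)
    rw [h4, Real.sqrt_sq (norm_nonneg _)] at h3
    refine h3.congr_fderiv ?_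
    ext v
    simp only [smul_apply, innerSL_apply_apply, smul_eq_mul, nsmul_eq_mul]
    field_simp
    norm_num
  have h5 : HasDerivAt (fun t : ℝ => t⁻¹ ^ 3) (-3 * ‖z‖⁻¹ ^ 4) ‖z‖ := by
    refine ((hasDerivAt_inv hn).pow 3).congr_deriv ?_
    simp only [inv_pow, Nat.cast_ofNat]
    norm_num
    field_simp
  refine ((h5.comp_hasFDerivAt z h1).smul (hasFDerivAt_id z)).congr_fderiv ?_
  ext v k
  simp [coulombKernelDeriv]
  field_simp
  ring

theorem norm_coulombKernel_le (z : Space) : ‖coulombKernel z‖ ≤ ‖z‖⁻¹ ^ 2 := by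
  rcases eq_or_ne z 0 with rfl | hz
  · simp [coulombKernel]
  have hn : ‖z‖ ≠ 0 := norm_ne_zero_iff.2 hz
  rw [coulombKernel, norm_smul]
  simp only [norm_pow, norm_inv, norm_norm]
  apply le_of_eq
  field_simp

theorem norm_coulombKernelDeriv_le (z : Space) : ‖coulombKernelDeriv z‖ ≤ 4 * ‖z‖⁻¹ ^ 3 := by
  rcases eq_or_ne z 0 with rfl | hz
  · simp [coulombKernelDeriv, norm_smul]
  have hn : ‖z‖ ≠ 0 := norm_ne_zero_iff.2 hz
  refine (norm_sub_le _ _).trans ?_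
  have h1 : ‖(‖z‖⁻¹ ^ 3) • ContinuousLinearMap.id ℝ Space‖ ≤ ‖z‖⁻¹ ^ 3 := by
    rw [norm_smul]
    simp only [norm_pow, norm_inv, norm_norm]
    exact mul_le_of_le_one_right (by positivity) ContinuousLinearMap.norm_id_le
  have h2 : ‖(3 * ‖z‖⁻¹ ^ 5) • (innerSL ℝ z).smulRight z‖ ≤ 3 * ‖z‖⁻¹ ^ 3 := by
    rw [norm_smul, ContinuousLinearMap.norm_smulRight_apply, innerSL_apply_norm]
    simp only [norm_mul, norm_pow, norm_inv, norm_norm]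
    apply le_of_eq
    norm_num
    field_simp
  linarith

/-- The derivative of a Coulomb field, away from its charges. -/
def coulombDeriv {n : ℕ} (x : Fin n → Space) (q : Fin n → ℝ) (y : Space) : Space →L[ℝ] Space :=
  ∑ i, (q i / (4 * Real.pi)) • coulombKernelDeriv (y - x i)

variable {n : ℕ} {x : Fin n → Space} {q : Fin n → ℝ}

theorem hasFDerivAt_coulombField {y : Space} (hy : y ∈ (Set.range x)ᶜ) :
    HasFDerivAt (coulombField x q) (coulombDeriv x q y) y := by
  have h0 : coulombField x q = fun y => ∑ i, (q i / (4 * Real.pi)) • coulombKernel (y - x i) :=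
    funext fun y => coulombField_eq x q y
  rw [h0]
  refine HasFDerivAt.fun_sum fun i _ => HasFDerivAt.fun_const_smul ?_ _
  have hz : y - x i ≠ 0 := fun h => hy ⟨i, (sub_eq_zero.1 h).symm⟩
  have := (hasFDerivAt_coulombKernel hz).comp y ((hasFDerivAt_id y).sub_const (x i))
  simpa [Function.comp_def] using this

theorem contDiffAt_coulombField {y : Space} (hy : y ∈ (Set.range x)ᶜ) :
    ContDiffAt ℝ ω (coulombField x q) y := by
  have h0 : coulombField x q = fun y => ∑ i, (q i / (4 * Real.pi)) • coulombKernel (y - x i) :=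
    funext fun y => coulombField_eq x q y
  rw [h0]
  refine ContDiffAt.sum fun i _ => ContDiffAt.const_smul _ ?_
  have hz : y - x i ≠ 0 := fun h => hy ⟨i, (sub_eq_zero.1 h).symm⟩
  exact ContDiffAt.comp (f := fun y => y - x i) y (contDiffAt_coulombKernel hz)
    (contDiffAt_id.sub contDiffAt_const)

theorem isOpen_compl_range (x : Fin n → Space) : IsOpen (Set.range x)ᶜ :=
  (Set.finite_range x).isClosed.isOpen_compl

theorem contDiffOn_coulombField (x : Fin n → Space) (q : Fin n → ℝ) :
    ContDiffOn ℝ ∞ (coulombField x q) (Set.range x)ᶜ :=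
  fun _ hy => ((contDiffAt_coulombField hy).of_le le_top).contDiffWithinAt

theorem inner_coulombDeriv_comm (y h k : Space) :
    inner ℝ (coulombDeriv x q y h) k = inner ℝ (coulombDeriv x q y k) h := by
  simp only [coulombDeriv, sum_apply, sum_inner, smul_apply,
    inner_smul_left, coulombKernelDeriv, sub_apply, inner_sub_left,
    ContinuousLinearMap.id_apply, ContinuousLinearMap.smulRight_apply, innerSL_apply_apply]
  refine Finset.sum_congr rfl fun i _ => ?_
  rw [real_inner_comm h k]
  simp only [conj_trivial]
  ring

theorem inner_basisVec (v : Space) (k : Fin 3) : inner ℝ v (basisVec k) = v k := by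
  simp [basisVec, EuclideanSpace.inner_single_right]

theorem divergence_eq_of_hasFDerivAt {F : Space → Space} {F' : Space →L[ℝ] Space} {y : Space}
    (h : HasFDerivAt F F' y) : divergence F y = ∑ k, inner ℝ (F' (basisVec k)) (basisVec k) := by
  simp [divergence, partialDeriv, h.fderiv, inner_basisVec]

/-- The Coulomb field is divergence-free away from the charges. -/
theorem divergence_coulombField {y : Space} (hy : y ∈ (Set.range x)ᶜ) :
    divergence (coulombField x q) y = 0 := by
  rw [divergence_eq_of_hasFDerivAt (hasFDerivAt_coulombField hy)]
  simp only [coulombDeriv, sum_apply, sum_inner, smul_apply,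
    inner_smul_left]
  rw [Finset.sum_comm]
  refine Finset.sum_eq_zero fun i _ => ?_
  have hz : y - x i ≠ 0 := fun h => hy ⟨i, (sub_eq_zero.1 h).symm⟩
  rw [← Finset.mul_sum]
  refine mul_eq_zero_of_right _ ?_
  generalize y - x i = z at hz
  have hn : ‖z‖ ≠ 0 := norm_ne_zero_iff.2 hz
  have h1 : ‖z‖ ^ 2 = z 0 ^ 2 + z 1 ^ 2 + z 2 ^ 2 := by
    simp [EuclideanSpace.norm_sq_eq, Fin.sum_univ_three]
  simp only [coulombKernelDeriv, sub_apply, inner_sub_left,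
    smul_apply, ContinuousLinearMap.id_apply, inner_smul_left,
    ContinuousLinearMap.smulRight_apply, innerSL_apply_apply, inner_basisVec, Fin.sum_univ_three]
  simp [basisVec]
  field_simp
  nlinarith [h1]

/-! ### Behaviour at the charges and at infinity -/

theorem eventually_nhdsWithin_mem_compl (hx : Function.Injective x) (i : Fin n) :
    ∀ᶠ y in 𝓝[≠] (x i), y ∈ (Set.range x)ᶜ := by
  have h1 : ∀ j, ∀ᶠ y in 𝓝[≠] (x i), y ≠ x j := by
    intro j
    rcases eq_or_ne j i with rfl | hj
    · exact eventually_mem_nhdsWithin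
    · exact (eventually_ne_nhds (hx.ne hj.symm)).filter_mono nhdsWithin_le_nhds
  filter_upwards [eventually_all.2 h1] with y hy
  rintro ⟨j, rfl⟩
  exact hy j rfl

theorem tendsto_norm_sub_nhdsNE (c : Space) :
    Tendsto (fun y : Space => ‖y - c‖) (𝓝[≠] c) (𝓝[>] 0) := by
  rw [tendsto_nhdsWithin_iff]
  constructor
  · have : Tendsto (fun y : Space => ‖y - c‖) (𝓝 c) (𝓝 ‖c - c‖) :=
      (continuous_id.sub continuous_const).norm.tendsto c
    simp only [sub_self, norm_zero] at this
    exact this.mono_left nhdsWithin_le_nhds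
  · filter_upwards [eventually_mem_nhdsWithin] with y hy
    exact norm_pos_iff.2 (sub_ne_zero.2 hy)

/-- The Coulomb field is the field of the `i`-th charge up to a field that is bounded near
that charge. -/
theorem coulombField_sub_isBigO (hx : Function.Injective x) (i : Fin n) :
    (fun y => coulombField x q y - (q i / (4 * Real.pi)) • coulombKernel (y - x i))
      =O[𝓝[≠] (x i)] fun _ => (1 : ℝ) := by
  have h0 : (fun y => coulombField x q y - (q i / (4 * Real.pi)) • coulombKernel (y - x i))
      = fun y => ∑ j ∈ Finset.univ.erase i, (q j / (4 * Real.pi)) • coulombKernel (y - x j) := by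
    ext1 y
    rw [coulombField_eq, ← Finset.add_sum_erase _ _ (Finset.mem_univ i), add_sub_cancel_left]
  rw [h0]
  have : ContinuousAt (fun y => ∑ j ∈ Finset.univ.erase i,
      (q j / (4 * Real.pi)) • coulombKernel (y - x j)) (x i) := by
    refine tendsto_finsetSum _ fun j hj => ?_
    have hz : x i - x j ≠ 0 := sub_ne_zero.2 (hx.ne (Finset.ne_of_mem_erase hj).symm)
    have h1 : ContinuousAt (fun y => coulombKernel (y - x j)) (x i) :=
      ContinuousAt.comp (f := fun y => y - x j) (contDiffAt_coulombKernel hz).continuousAt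
        (continuousAt_id.sub continuousAt_const)
    exact h1.tendsto.const_smul _
  exact (this.tendsto.mono_left nhdsWithin_le_nhds).isBigO_one ℝ

theorem one_isBigO_inv_pow (c : Space) (k : ℕ) :
    (fun _ : Space => (1 : ℝ)) =O[𝓝[≠] c] fun y => ‖y - c‖⁻¹ ^ k := by
  have h1 := tendsto_norm_sub_nhdsNE c
  have h2 : ∀ᶠ y in 𝓝[≠] c, ‖y - c‖ ∈ Set.Ioo (0 : ℝ) 1 :=
    h1 (Ioo_mem_nhdsGT one_pos)
  refine Asymptotics.IsBigO.of_bound 1 ?_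
  filter_upwards [h2] with y hy
  have h3 : 1 ≤ ‖y - c‖⁻¹ := (one_le_inv₀ hy.1).2 hy.2.le
  have h4 : 1 ≤ ‖y - c‖⁻¹ ^ k := one_le_pow₀ h3
  simpa using h4

theorem coulombField_isBigO (hx : Function.Injective x) (i : Fin n) :
    (coulombField x q) =O[𝓝[≠] (x i)] fun y => ‖y - x i‖⁻¹ ^ 2 := by
  have h1 := (coulombField_sub_isBigO (q := q) hx i).trans (one_isBigO_inv_pow (x i) 2)
  have h2 : (fun y => (q i / (4 * Real.pi)) • coulombKernel (y - x i))
      =O[𝓝[≠] (x i)] fun y => ‖y - x i‖⁻¹ ^ 2 := by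
    refine Asymptotics.IsBigO.of_bound |q i / (4 * Real.pi)| (Eventually.of_forall fun y => ?_)
    rw [norm_smul, Real.norm_eq_abs]
    gcongr
    simpa using norm_coulombKernel_le (y - x i)
  simpa using h1.add h2

/-- Near a charge, the Coulomb field really has size `|y - xᵢ|⁻²`. -/
theorem inv_sq_isBigO_coulombField (hx : Function.Injective x) (i : Fin n) (hq : q i ≠ 0) :
    (fun y => ‖y - x i‖⁻¹ ^ 2) =O[𝓝[≠] (x i)] (coulombField x q) := by
  have ha : q i / (4 * Real.pi) ≠ 0 := div_ne_zero hq (by positivity)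
  obtain ⟨C, hC⟩ := (coulombField_sub_isBigO (q := q) hx i).bound
  set a := q i / (4 * Real.pi) with hadef
  have ha' : 0 < |a| := abs_pos.2 ha
  have h1 := tendsto_norm_sub_nhdsNE (x i)
  have h2 : Tendsto (fun y => |a| / 2 * ‖y - x i‖⁻¹ ^ 2) (𝓝[≠] (x i)) atTop := by
    refine Tendsto.const_mul_atTop (by positivity) ?_
    exact (tendsto_pow_atTop two_ne_zero).comp (tendsto_inv_nhdsGT_zero.comp h1)
  refine Asymptotics.IsBigO.of_bound (2 / |a|) ?_
  filter_upwards [hC, h2.eventually_ge_atTop C, h1 self_mem_nhdsWithin] with y hy hy2 hy3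
  have hr : 0 < ‖y - x i‖ := hy3
  have h4 : ‖a • coulombKernel (y - x i)‖ = |a| * ‖y - x i‖⁻¹ ^ 2 := by
    rw [norm_smul, coulombKernel, norm_smul, Real.norm_eq_abs]
    simp only [norm_pow, norm_inv, norm_norm]
    field_simp
  have h5 := norm_sub_norm_le (a • coulombKernel (y - x i)) (coulombField x q y)
  rw [norm_sub_rev, h4] at h5
  simp only [norm_one, mul_one] at hy
  simp only [norm_pow, norm_inv, norm_norm]
  have h6 : |a| / 2 * ‖y - x i‖⁻¹ ^ 2 ≤ ‖coulombField x q y‖ := by linarith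
  calc ‖y - x i‖⁻¹ ^ 2 = 2 / |a| * (|a| / 2 * ‖y - x i‖⁻¹ ^ 2) := by field_simp
    _ ≤ _ := by gcongr

theorem smul_coulombKernelDeriv_isBigO (a : ℝ) (c : Space) (l : Filter Space) :
    (fun y => a • coulombKernelDeriv (y - c)) =O[l] fun y => ‖y - c‖⁻¹ ^ 3 := by
  refine Asymptotics.IsBigO.of_bound (|a| * 4) (Eventually.of_forall fun y => ?_)
  rw [norm_smul, mul_assoc, Real.norm_eq_abs]
  gcongr
  simpa using norm_coulombKernelDeriv_le (y - c)

theorem coulombDeriv_isBigO (hx : Function.Injective x) (i : Fin n) :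
    (coulombDeriv x q) =O[𝓝[≠] (x i)] fun y => ‖y - x i‖⁻¹ ^ 3 := by
  refine Asymptotics.IsBigO.fun_sum fun j _ => ?_
  have h0 := smul_coulombKernelDeriv_isBigO (q j / (4 * Real.pi)) (x j) (𝓝[≠] (x i))
  refine h0.trans ?_
  rcases eq_or_ne j i with rfl | hj
  · exact Asymptotics.isBigO_refl _ _
  · have hz : x i - x j ≠ 0 := sub_ne_zero.2 (hx.ne hj.symm)
    have h2 : ContinuousAt (fun y => ‖y - x j‖) (x i) := by fun_prop
    have h1 : ContinuousAt (fun y => ‖y - x j‖⁻¹ ^ 3) (x i) :=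
      (h2.inv₀ (norm_ne_zero_iff.2 hz)).pow 3
    exact ((h1.tendsto.mono_left nhdsWithin_le_nhds).isBigO_one ℝ).trans
      (one_isBigO_inv_pow (x i) 3)

theorem inv_norm_sub_isBigO_cocompact (c : Space) :
    (fun y : Space => ‖y - c‖⁻¹) =O[cocompact Space] fun y => ‖y‖⁻¹ := by
  refine Asymptotics.IsBigO.of_bound 2 ?_
  filter_upwards [tendsto_norm_cocompact_atTop.eventually_ge_atTop (2 * ‖c‖ + 1)] with y hy
  have h1 : ‖y‖ / 2 ≤ ‖y - c‖ := by
    have := norm_sub_norm_le y c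
    linarith [norm_nonneg c]
  have h2 : 0 < ‖y‖ := by linarith [norm_nonneg c]
  simp only [norm_inv, norm_norm]
  calc ‖y - c‖⁻¹ ≤ (‖y‖ / 2)⁻¹ := by gcongr
    _ = 2 * ‖y‖⁻¹ := by field_simp

theorem coulombField_isBigO_cocompact (x : Fin n → Space) (q : Fin n → ℝ) :
    (coulombField x q) =O[cocompact Space] fun y => ‖y‖⁻¹ ^ 2 := by
  have h0 : coulombField x q = fun y => ∑ i, (q i / (4 * Real.pi)) • coulombKernel (y - x i) :=
    funext fun y => coulombField_eq x q y
  rw [h0]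
  refine Asymptotics.IsBigO.fun_sum fun j _ => (Asymptotics.IsBigO.const_smul_self _).trans ?_
  have h1 : (fun y => coulombKernel (y - x j)) =O[cocompact Space] fun y => ‖y - x j‖⁻¹ ^ 2 := by
    refine Asymptotics.IsBigO.of_bound 1 (Eventually.of_forall fun y => ?_)
    simpa using norm_coulombKernel_le (y - x j)
  exact h1.trans ((inv_norm_sub_isBigO_cocompact (x j)).pow 2)

theorem coulombDeriv_isBigO_cocompact (x : Fin n → Space) (q : Fin n → ℝ) :
    (coulombDeriv x q) =O[cocompact Space] fun y => ‖y‖⁻¹ ^ 3 := by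
  refine Asymptotics.IsBigO.fun_sum fun j _ => ?_
  have h1 := smul_coulombKernelDeriv_isBigO (q j / (4 * Real.pi)) (x j) (cocompact Space)
  exact h1.trans ((inv_norm_sub_isBigO_cocompact (x j)).pow 3)

theorem tendsto_inv_norm_cocompact : Tendsto (fun y : Space => ‖y‖⁻¹) (cocompact Space) (𝓝 0) :=
  tendsto_inv_atTop_zero.comp tendsto_norm_cocompact_atTop

theorem tendsto_coulombField_cocompact (x : Fin n → Space) (q : Fin n → ℝ) :
    Tendsto (coulombField x q) (cocompact Space) (𝓝 0) := by
  refine (coulombField_isBigO_cocompact x q).trans_tendsto ?_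
  simpa using tendsto_inv_norm_cocompact.pow 2

end

/-! ### Integrability of fields with point singularities -/

theorem preimage_sub_ball (c : Space) (r : ℝ) :
    (fun y : Space => y - c) ⁻¹' Metric.ball 0 r = Metric.ball c r := by
  ext y
  simp [dist_eq_norm]

theorem integrableOn_ball_inv_norm_sub_pow_two (c : Space) (r : ℝ) :
    IntegrableOn (fun y : Space => ‖y - c‖⁻¹ ^ 2) (Metric.ball c r) := by
  have h0 : IntegrableOn (fun y : Space => ‖y‖⁻¹ ^ 2) (Metric.ball 0 r) := by
    refine (integrableOn_fun_norm_addHaar (volume : Measure Space) (f := fun t => t⁻¹ ^ 2)).2 ?_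
    have h1 : IntegrableOn (fun _ : ℝ => (1 : ℝ)) (Set.Ioo 0 r) := by
      refine integrableOn_const (by simp)
    refine h1.congr_fun (fun t ht => ?_) measurableSet_Ioo
    have : t ≠ 0 := ht.1.ne'
    simp
    field_simp
  have h2 := ((measurePreserving_sub_right (volume : Measure Space) c).integrableOn_comp_preimage
    (measurableEmbedding_subRight c)).2 h0
  rwa [preimage_sub_ball] at h2

theorem not_integrableOn_ball_inv_norm_sub_pow_four (c : Space) {r : ℝ} (hr : 0 < r) :
    ¬ IntegrableOn (fun y : Space => ‖y - c‖⁻¹ ^ 4) (Metric.ball c r) := by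
  intro h
  have h0 : IntegrableOn (fun y : Space => ‖y‖⁻¹ ^ 4) (Metric.ball 0 r) := by
    refine ((measurePreserving_sub_right (volume : Measure Space) c).integrableOn_comp_preimage
      (measurableEmbedding_subRight c)).1 ?_
    rwa [preimage_sub_ball]
  have h1 := (integrableOn_fun_norm_addHaar (volume : Measure Space) (f := fun t => t⁻¹ ^ 4)).1 h0
  have h2 : IntegrableOn (fun t : ℝ => t ^ (-2 : ℝ)) (Set.Ioo 0 r) := by
    refine h1.congr_fun (fun t ht => ?_) measurableSet_Ioo
    have h3 : t ≠ 0 := ht.1.ne'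
    have h4 : t ^ (-2 : ℝ) = (t ^ 2)⁻¹ := by
      rw [Real.rpow_neg ht.1.le]
      norm_cast
    rw [h4]
    simp
    field_simp
  have := (intervalIntegral.integrableOn_Ioo_rpow_iff hr).1 h2
  norm_num at this

theorem aestronglyMeasurable_of_continuousOn {n : ℕ} {x : Fin n → Space} {V : Type*}
    [NormedAddCommGroup V] {f : Space → V}
    (hf : ContinuousOn f (Set.range x)ᶜ) : AEStronglyMeasurable f := by
  have h1 := hf.aestronglyMeasurable_of_isSeparable (μ := (volume : Measure Space))
    (isOpen_compl_range x).measurableSet (TopologicalSpace.IsSeparable.of_separableSpace _)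
  rwa [Measure.restrict_eq_self_of_ae_mem] at h1
  exact compl_mem_ae_iff.2 ((Set.finite_range x).measure_zero _)

theorem locallyIntegrable_of_isBigO {n : ℕ} {x : Fin n → Space} {V : Type*}
    [NormedAddCommGroup V] {f : Space → V}
    (hf : ContinuousOn f (Set.range x)ᶜ)
    (h : ∀ i, f =O[𝓝[≠] (x i)] fun y => ‖y - x i‖⁻¹ ^ 2) : LocallyIntegrable f := by
  have hm : AEStronglyMeasurable f := aestronglyMeasurable_of_continuousOn hf
  intro y
  by_cases hy : y ∈ (Set.range x)ᶜ
  · have h1 := (hf.locallyIntegrableOn (μ := (volume : Measure Space))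
      (isOpen_compl_range x).measurableSet) y hy
    rwa [(isOpen_compl_range x).nhdsWithin_eq hy] at h1
  · rw [Set.notMem_compl_iff] at hy
    obtain ⟨i, rfl⟩ := hy
    have h2 : IntegrableAtFilter (fun y : Space => ‖y - x i‖⁻¹ ^ 2) (𝓝[≠] (x i)) :=
      ⟨Metric.ball (x i) 1, nhdsWithin_le_nhds (Metric.ball_mem_nhds _ one_pos),
        integrableOn_ball_inv_norm_sub_pow_two _ _⟩
    have := (measurableSet_singleton (x i)).compl.nhdsWithin_isMeasurablyGenerated (x i)
    have h3 := (h i).integrableAtFilter hm.stronglyMeasurableAtFilter h2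
    rw [← nhdsNE_sup_pure]
    refine IntegrableAtFilter.sup_iff.2 ⟨h3, {x i}, by simp, ?_⟩
    rw [IntegrableOn, Measure.restrict_singleton]
    simp

theorem integrableAtFilter_cocompact_inv_norm_pow_four :
    IntegrableAtFilter (fun y : Space => ‖y‖⁻¹ ^ 4) (cocompact Space) := by
  have h1 : Integrable (fun y : Space => (1 + ‖y‖) ^ (-4 : ℝ)) :=
    integrable_one_add_norm (by simp; norm_num)
  have h2 : (fun y : Space => ‖y‖⁻¹ ^ 4) =O[cocompact Space] fun y => (1 + ‖y‖) ^ (-4 : ℝ) := by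
    refine Asymptotics.IsBigO.of_bound 16 ?_
    filter_upwards [tendsto_norm_cocompact_atTop.eventually_ge_atTop (1 : ℝ)] with y hy
    have h3 : 0 < ‖y‖ := by linarith
    have h4 : (1 + ‖y‖) ^ (-4 : ℝ) = ((1 + ‖y‖) ^ 4)⁻¹ := by
      rw [Real.rpow_neg (by positivity)]
      norm_cast
    rw [h4]
    simp only [norm_pow, norm_inv, norm_norm]
    rw [Real.norm_of_nonneg (by positivity : (0 : ℝ) ≤ 1 + ‖y‖)]
    have h5 : (1 + ‖y‖) ^ 4 ≤ (2 * ‖y‖) ^ 4 := by gcongr; linarith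
    rw [inv_pow, ← div_eq_mul_inv, le_div_iff₀ (by positivity), inv_mul_le_iff₀ (by positivity)]
    linarith [mul_pow 2 ‖y‖ 4]
  refine h2.integrableAtFilter ?_ (h1.integrableAtFilter _)
  exact (by fun_prop : Measurable fun y : Space => ‖y‖⁻¹ ^ 4).aestronglyMeasurable.stronglyMeasurableAtFilter

theorem integrable_of_isBigO {n : ℕ} {x : Fin n → Space} {V : Type*}
    [NormedAddCommGroup V] {f : Space → V}
    (hf : ContinuousOn f (Set.range x)ᶜ)
    (h : ∀ i, f =O[𝓝[≠] (x i)] fun y => ‖y - x i‖⁻¹ ^ 2)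
    (h' : f =O[cocompact Space] fun y => ‖y‖⁻¹ ^ 4) : Integrable f :=
  (locallyIntegrable_of_isBigO hf h).integrable_of_isBigO_cocompact h'
    integrableAtFilter_cocompact_inv_norm_pow_four

theorem integrable_mul_of_continuousOn {U : Set Space} (hU : IsOpen U) {g h : Space → ℝ}
    (hg : ContinuousOn g U) (hh : Continuous h) (hc : HasCompactSupport h) (hs : tsupport h ⊆ U) :
    Integrable (fun y => h y * g y) := by
  have h1 : Continuous (fun y => h y * g y) := by
    refine continuous_of_tsupport fun y hy => ?_
    have hy' : y ∈ U := hs ((tsupport_mul_subset_left (f := h) (g := g)) hy)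
    exact hh.continuousAt.mul (hg.continuousAt (hU.mem_nhds hy'))
  exact h1.integrable_of_hasCompactSupport hc.mul_right

/-! ### Integration by parts -/

theorem fderiv_apply_eq_sum (ψ : Space → ℝ) (y v : Space) :
    fderiv ℝ ψ y v = ∑ k, v k * fderiv ℝ ψ y (basisVec k) := by
  have h : v = ∑ k, v k • basisVec k := by
    ext j
    fin_cases j <;> simp [Fin.sum_univ_three, basisVec]
  conv_lhs => rw [h]
  simp [map_sum]

theorem partialDeriv_eq_fderiv {F : Space → Space} {y : Space} (h : DifferentiableAt ℝ F y)
    (j k : Fin 3) : partialDeriv F j k y = fderiv ℝ (fun y => F y k) y (basisVec j) := by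
  have h1 := ((EuclideanSpace.proj k : Space →L[ℝ] ℝ).hasFDerivAt.comp y h.hasFDerivAt).fderiv
  have h2 : (⇑(EuclideanSpace.proj k : Space →L[ℝ] ℝ) ∘ F) = fun y => F y k := rfl
  rw [h2] at h1
  rw [h1]
  rfl

theorem continuousOn_partialDeriv {F : Space → Space} {U : Set Space} (hU : IsOpen U)
    (hF : ContDiffOn ℝ 1 F U) (j k : Fin 3) : ContinuousOn (partialDeriv F j k) U := by
  have h1 : ContinuousOn (fun y => fderiv ℝ F y) U := hF.continuousOn_fderiv_of_isOpen hU le_rfl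
  have h2 : ContinuousOn (fun y => fderiv ℝ F y (basisVec j)) U := h1.clm_apply continuousOn_const
  exact (EuclideanSpace.proj k : Space →L[ℝ] ℝ).continuous.comp_continuousOn h2

theorem continuousOn_divergence {F : Space → Space} {U : Set Space} (hU : IsOpen U)
    (hF : ContDiffOn ℝ 1 F U) : ContinuousOn (divergence F) U :=
  continuousOn_finsetSum _ fun k _ => continuousOn_partialDeriv hU hF k k

theorem integral_mul_partialDeriv {F : Space → Space} {U : Set Space} (hU : IsOpen U)
    (hF : ContDiffOn ℝ 1 F U) {ψ : Space → ℝ} (hψ : ContDiff ℝ 1 ψ) (hc : HasCompactSupport ψ)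
    (hs : tsupport ψ ⊆ U) (j k : Fin 3) :
    ∫ y, F y k * fderiv ℝ ψ y (basisVec j) = -∫ y, ψ y * partialDeriv F j k y := by
  have hd : ∀ y ∈ U, DifferentiableAt ℝ F y := fun y hy =>
    ((hF y hy).contDiffAt (hU.mem_nhds hy)).differentiableAt (by norm_num)
  have hFk : ContinuousOn (fun y => F y k) U :=
    (EuclideanSpace.proj k : Space →L[ℝ] ℝ).continuous.comp_continuousOn hF.continuousOn
  have h1 : Integrable fun y => ψ y * partialDeriv F j k y :=
    integrable_mul_of_continuousOn hU (continuousOn_partialDeriv hU hF j k) hψ.continuous hc hs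
  have hψ' : Continuous fun y => fderiv ℝ ψ y (basisVec j) :=
    (hψ.continuous_fderiv (by norm_num)).clm_apply continuous_const
  have hsub : tsupport (fun y => fderiv ℝ ψ y (basisVec j)) ⊆ tsupport ψ :=
    (closure_mono fun y hy => by
      contrapose! hy
      have : fderiv ℝ ψ y = 0 := by simpa using hy
      simp [this]).trans (tsupport_fderiv_subset ℝ)
  have h2 : Integrable fun y => fderiv ℝ ψ y (basisVec j) * F y k :=
    integrable_mul_of_continuousOn hU hFk hψ' (hc.mono' (subset_closure.trans hsub)) (hsub.trans hs)
  have h3 : Integrable fun y => ψ y * F y k :=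
    integrable_mul_of_continuousOn hU hFk hψ.continuous hc hs
  have heq : ∀ y, fderiv ℝ (fun y => F y k) y (basisVec j) * ψ y = ψ y * partialDeriv F j k y := by
    intro y
    by_cases hy : y ∈ U
    · rw [partialDeriv_eq_fderiv (hd y hy), mul_comm]
    · have : ψ y = 0 := by
        by_contra h
        exact hy (hs (subset_closure h))
      simp [this]
  have h4 := integral_mul_fderiv_eq_neg_fderiv_mul_of_integrable (μ := (volume : Measure Space))
    (f := fun y => F y k) (g := ψ) (v := basisVec j) (by simpa only [heq] using h1)
    (by simpa only [mul_comm] using h2) (by simpa only [mul_comm] using h3)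
    (fun y hy => (EuclideanSpace.proj k : Space →L[ℝ] ℝ).differentiableAt.comp y (hd y (hs hy)))
    (fun y _ => hψ.differentiable (by norm_num) y)
  rw [h4]
  simp only [heq]

theorem integrable_fderiv_apply {F : Space → Space} {U : Set Space} (hU : IsOpen U)
    (hF : ContinuousOn F U) {ψ : Space → ℝ} (hψ : ContDiff ℝ 1 ψ) (hc : HasCompactSupport ψ)
    (hs : tsupport (fderiv ℝ ψ) ⊆ U) : Integrable fun y => fderiv ℝ ψ y (F y) := by
  have h1 : Continuous fun y => fderiv ℝ ψ y (F y) := by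
    refine continuous_of_tsupport fun y hy => ?_
    have hy' : y ∈ U := by
      refine hs (closure_mono (fun z hz => ?_) hy)
      contrapose! hz
      have : fderiv ℝ ψ z = 0 := by simpa using hz
      simp [this]
    exact (hψ.continuous_fderiv (by norm_num)).continuousAt.clm_apply
      (hF.continuousAt (hU.mem_nhds hy'))
  refine h1.integrable_of_hasCompactSupport (hc.mono' fun y hy => ?_)
  refine tsupport_fderiv_subset ℝ (subset_closure ?_)
  contrapose! hy
  have : fderiv ℝ ψ y = 0 := by simpa using hy
  simp [this]

theorem integral_fderiv_apply {F : Space → Space} {U : Set Space} (hU : IsOpen U)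
    (hF : ContDiffOn ℝ 1 F U) {ψ : Space → ℝ} (hψ : ContDiff ℝ 1 ψ) (hc : HasCompactSupport ψ)
    (hs : tsupport ψ ⊆ U) : ∫ y, fderiv ℝ ψ y (F y) = -∫ y, ψ y * divergence F y := by
  have hFk : ∀ k, ContinuousOn (fun y => F y k) U := fun k =>
    (EuclideanSpace.proj k : Space →L[ℝ] ℝ).continuous.comp_continuousOn hF.continuousOn
  have hψ' : ∀ k, Continuous fun y => fderiv ℝ ψ y (basisVec k) := fun k =>
    (hψ.continuous_fderiv (by norm_num)).clm_apply continuous_const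
  have hsub : ∀ k, tsupport (fun y => fderiv ℝ ψ y (basisVec k)) ⊆ tsupport ψ := fun k =>
    (closure_mono fun y hy => by
      contrapose! hy
      have : fderiv ℝ ψ y = 0 := by simpa using hy
      simp [this]).trans (tsupport_fderiv_subset ℝ)
  have h1 : ∀ k, Integrable fun y => F y k * fderiv ℝ ψ y (basisVec k) := fun k => by
    simpa only [mul_comm] using integrable_mul_of_continuousOn hU (hFk k) (hψ' k)
      (hc.mono' (subset_closure.trans (hsub k))) ((hsub k).trans hs)
  have h2 : ∀ k, Integrable fun y => ψ y * partialDeriv F k k y := fun k =>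
    integrable_mul_of_continuousOn hU (continuousOn_partialDeriv hU hF k k) hψ.continuous hc hs
  simp only [divergence, Finset.mul_sum]
  rw [integral_finsetSum _ fun k _ => h2 k, ← Finset.sum_neg_distrib]
  simp_rw [fun y => fderiv_apply_eq_sum ψ y (F y)]
  rw [integral_finsetSum _ fun k _ => h1 k]
  exact Finset.sum_congr rfl fun k _ => integral_mul_partialDeriv hU hF hψ hc hs k k

/-! ### Vector distributions -/

theorem toDist_apply {F : Space → Space} (hF : LocallyIntegrable F) (k : Fin 3)
    (φ : 𝓓((⊤ : TopologicalSpace.Opens Space), ℝ)) :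
    toDist F k φ = ∫ y, φ y * F y k := by
  have h1 : LocallyIntegrable (fun y => F y k) := by
    intro y
    obtain ⟨s, hs, h⟩ := hF y
    exact ⟨s, hs, (EuclideanSpace.proj k : Space →L[ℝ] ℝ).integrable_comp h⟩
  refine (TestFunction.integralAgainstBilinCLM_eq_integral (h1.locallyIntegrableOn _)).trans ?_
  rfl

theorem lineDeriv_apply (T : ScalarDist) (v : Space)
    (φ : 𝓓((⊤ : TopologicalSpace.Opens Space), ℝ)) :
    (∂_{v} T) φ = -T (∂_{v} φ) := by
  rw [Distribution.lineDerivOp_apply_apply, map_neg]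

theorem testFunction_lineDeriv_apply (φ : 𝓓((⊤ : TopologicalSpace.Opens Space), ℝ)) (v y : Space) :
    (∂_{v} φ) y = fderiv ℝ φ y v := by
  rw [TestFunction.lineDerivOp_eq_lineDerivCLM ℝ, TestFunction.lineDerivCLM_apply_of_le (by simp)]
  exact ((φ.contDiff.differentiable (by simp)) y).lineDeriv_eq_fderiv

theorem lineDeriv_toDist_apply {F : Space → Space} (hF : LocallyIntegrable F) (v : Space) (k : Fin 3)
    (φ : 𝓓((⊤ : TopologicalSpace.Opens Space), ℝ)) :
    (∂_{v} (toDist F k)) φ = -∫ y, F y k * fderiv ℝ φ y v := by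
  rw [lineDeriv_apply, toDist_apply hF]
  simp only [testFunction_lineDeriv_apply, mul_comm]

theorem distDiv_apply (T : VectorDist) (φ : 𝓓((⊤ : TopologicalSpace.Opens Space), ℝ)) :
    distDiv T φ = ∑ k, (∂_{basisVec k} (T k)) φ := by
  simp only [distDiv, Fin.sum_univ_three]
  rfl

theorem pointCharges_apply {n : ℕ} (x : Fin n → Space) (q : Fin n → ℝ)
    (φ : 𝓓((⊤ : TopologicalSpace.Opens Space), ℝ)) :
    pointCharges x q φ = ∑ i, q i * φ (x i) := by
  rw [pointCharges]
  have : ∀ s : Finset (Fin n), (∑ i ∈ s, q i • (Distribution.delta (x i) : ScalarDist)) φ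
      = ∑ i ∈ s, q i * φ (x i) := by
    intro s
    induction s using Finset.induction_on with
    | empty => simp
    | insert i s hi ih =>
      rw [Finset.sum_insert hi, Finset.sum_insert hi, ← ih]
      have h : (Distribution.delta (x i) : ScalarDist) φ = φ (x i) := by
        rw [Distribution.delta_apply]
      rw [← h]
      rfl
  exact this _

theorem toDist_zero : toDist 0 = 0 := by
  ext k φ
  rw [toDist_apply (F := 0) (locallyIntegrable_const 0)]
  simp

theorem distCurl_zero : distCurl 0 = 0 := by
  ext k φ
  fin_cases k <;> simp [distCurl]

theorem distDiv_zero : distDiv 0 = 0 := by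
  ext φ
  simp [distDiv_apply]

/-- A field whose pointwise curl is nonzero somewhere has a nonzero distributional curl. -/
theorem distCurl_toDist_ne_zero {F : Space → Space} {U : Set Space} (hU : IsOpen U)
    (hF : ContDiffOn ℝ 1 F U) (hl : LocallyIntegrable F) {y : Space} (hy : y ∈ U)
    (h : curl F y ≠ 0) : distCurl (toDist F) ≠ 0 := by
  intro h0
  apply h
  -- Each component of the curl is tested against bumps concentrated near `y`.
  have key : ∀ i j : Fin 3, (∂_{basisVec i} (toDist F j) - ∂_{basisVec j} (toDist F i) = 0) →
      partialDeriv F i j y - partialDeriv F j i y = 0 := by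
    intro i j hij
    by_contra hne
    set f : Space → ℝ := fun y => partialDeriv F i j y - partialDeriv F j i y with hf
    have hfc : ContinuousOn f U :=
      (continuousOn_partialDeriv hU hF i j).sub (continuousOn_partialDeriv hU hF j i)
    have hfy : ContinuousAt f y := hfc.continuousAt (hU.mem_nhds hy)
    have hpos : ∀ᶠ z in 𝓝 y, z ∈ U ∧ 0 < f y * f z := by
      refine Eventually.and (hU.mem_nhds hy) ?_
      have : Tendsto (fun z => f y * f z) (𝓝 y) (𝓝 (f y * f y)) := hfy.tendsto.const_mul _
      exact this.eventually (lt_mem_nhds (mul_self_pos.2 hne))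
    obtain ⟨r, hr, hball⟩ := Metric.eventually_nhds_iff_ball.1 hpos
    let b : ContDiffBump y := ⟨r / 4, r / 2, by positivity, by linarith⟩
    have hsupp : tsupport b ⊆ Metric.ball y r := by
      rw [b.tsupport_eq]
      exact Metric.closedBall_subset_ball (by change r / 2 < r; linarith)
    let φ : 𝓓((⊤ : TopologicalSpace.Opens Space), ℝ) :=
      ⟨b, b.contDiff, b.hasCompactSupport, fun _ _ => trivial⟩
    have hφ : ⇑φ = b := rfl
    have hUs : tsupport b ⊆ U := fun z hz => (hball z (hsupp hz)).1
    have h1 : (∂_{basisVec i} (toDist F j) - ∂_{basisVec j} (toDist F i)) φ = 0 := by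
      rw [hij]; rfl
    have h2 : (∂_{basisVec i} (toDist F j)) φ - (∂_{basisVec j} (toDist F i)) φ = 0 := h1
    rw [lineDeriv_toDist_apply hl, lineDeriv_toDist_apply hl, hφ,
      integral_mul_partialDeriv hU hF b.contDiff b.hasCompactSupport hUs,
      integral_mul_partialDeriv hU hF b.contDiff b.hasCompactSupport hUs, neg_neg, neg_neg,
      ← integral_sub (integrable_mul_of_continuousOn hU (continuousOn_partialDeriv hU hF i j)
        b.continuous b.hasCompactSupport hUs)
        (integrable_mul_of_continuousOn hU (continuousOn_partialDeriv hU hF j i)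
        b.continuous b.hasCompactSupport hUs)] at h2
    have h3 : ∫ z, b z * (f y * f z) = 0 := by
      calc ∫ z, b z * (f y * f z) = ∫ z, f y * (b z * partialDeriv F i j z
              - b z * partialDeriv F j i z) := by
            congr 1; ext z; simp only [hf]; ring
        _ = 0 := by rw [integral_const_mul, h2, mul_zero]
    have hint : Integrable fun z => b z * (f y * f z) :=
      integrable_mul_of_continuousOn hU (continuousOn_const.mul hfc)
        b.continuous b.hasCompactSupport hUs
    have hcont : Continuous fun z => b z * (f y * f z) := by
      refine continuous_of_tsupport fun z hz => ?_
      have hz' : z ∈ U := hUs (tsupport_mul_subset_left (f := b) (g := fun z => f y * f z) hz)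
      exact b.continuous.continuousAt.mul
        (continuousAt_const.mul (hfc.continuousAt (hU.mem_nhds hz')))
    have hnn : 0 ≤ fun z => b z * (f y * f z) := by
      intro z
      by_cases hz : z ∈ tsupport b
      · exact mul_nonneg b.nonneg (hball z (hsupp hz)).2.le
      · simp [image_eq_zero_of_notMem_tsupport hz]
    have h4 : 0 < ∫ z, b z * (f y * f z) := by
      refine hcont.integral_pos_of_hasCompactSupport_nonneg_nonzero
        b.hasCompactSupport.mul_right hnn (x := y) ?_
      have : b y = 1 := b.one_of_mem_closedBall (Metric.mem_closedBall_self b.rIn_pos.le)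
      rw [this, one_mul]
      exact mul_self_ne_zero.2 hne
    linarith
  have k0 := key 1 2 (congrFun h0 0)
  have k1 := key 2 0 (congrFun h0 1)
  have k2 := key 0 1 (congrFun h0 2)
  ext k
  fin_cases k <;> simp [curl, k0, k1, k2]

/-! ### The charge density of a Coulomb field -/

theorem integrable_fderiv_coulombKernel {ψ : Space → ℝ} (hψ : ContDiff ℝ 1 ψ)
    (hc : HasCompactSupport ψ) : Integrable fun y => fderiv ℝ ψ y (coulombKernel y) := by
  set g : Space → ℝ := fun y => fderiv ℝ ψ y (coulombKernel y) with hg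
  have hcont : ContinuousOn g (Set.range fun _ : Fin 1 => (0 : Space))ᶜ := by
    intro y hy
    have hy' : y ≠ 0 := fun h => hy ⟨0, h.symm⟩
    exact ((hψ.continuous_fderiv (by norm_num)).continuousAt.clm_apply
      (contDiffAt_coulombKernel hy').continuousAt).continuousWithinAt
  refine integrable_of_isBigO hcont (fun i => ?_) ?_
  · obtain ⟨C, hC⟩ := hc.fderiv (𝕜 := ℝ) |>.exists_bound_of_continuous
      (hψ.continuous_fderiv (by norm_num))
    refine Asymptotics.IsBigO.of_bound C (Eventually.of_forall fun y => ?_)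
    refine ((fderiv ℝ ψ y).le_opNorm _).trans ?_
    have := norm_coulombKernel_le y
    have h0 : 0 ≤ C := (norm_nonneg _).trans (hC y)
    simp only [sub_zero, norm_pow, norm_inv, norm_norm]
    gcongr
    exact hC y
  · have : g =ᶠ[cocompact Space] 0 := by
      have h1 := (hc.fderiv (𝕜 := ℝ)).isCompact.compl_mem_cocompact
      filter_upwards [h1] with y hy
      simp [hg, image_eq_zero_of_notMem_tsupport hy]
    exact this.trans_isBigO (Asymptotics.isBigO_zero _ _)

/-- In polar coordinates around its charge, the pairing of the Coulomb kernel with a gradient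
integrates the radial derivative along every ray. -/
theorem integral_fderiv_coulombKernel {ψ : Space → ℝ} (hψ : ContDiff ℝ 1 ψ)
    (hc : HasCompactSupport ψ) :
    ∫ y, fderiv ℝ ψ y (coulombKernel y) = -(4 * Real.pi * ψ 0) := by
  set g : Space → ℝ := fun y => fderiv ℝ ψ y (coulombKernel y) with hg
  have hgi : Integrable g := integrable_fderiv_coulombKernel hψ hc
  have hmp := (volume : Measure Space).measurePreserving_homeomorphUnitSphereProd
  have hdim : Module.finrank ℝ Space - 1 = 2 := by simp
  rw [hdim] at hmp
  let G : Metric.sphere (0 : Space) 1 × Set.Ioi (0 : ℝ) → ℝ := fun p => g (p.2.1 • p.1.1)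
  have hG : ∀ y : ({(0 : Space)}ᶜ : Set Space), G (homeomorphUnitSphereProd Space y) = g y := by
    intro y
    have hy : ‖(y : Space)‖ ≠ 0 := norm_ne_zero_iff.2 y.2
    simp only [G, homeomorphUnitSphereProd_apply_snd_coe, homeomorphUnitSphereProd_apply_fst_coe,
      smul_smul]
    rw [mul_inv_cancel₀ hy, one_smul]
  have h1 : ∫ y, g y = ∫ p, G p ∂((volume : Measure Space).toSphere.prod (.volumeIoiPow 2)) := by
    rw [← hmp.integral_comp (Homeomorph.measurableEmbedding _) G]
    simp only [hG]
    rw [integral_subtype_comap (measurableSet_singleton _).compl, restrict_compl_singleton]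
  have h2 : Integrable G ((volume : Measure Space).toSphere.prod (.volumeIoiPow 2)) := by
    rw [← hmp.integrable_comp_emb (Homeomorph.measurableEmbedding _)]
    have : G ∘ (homeomorphUnitSphereProd Space) = g ∘ Subtype.val := funext hG
    rw [this, ← integrableOn_iff_comap_subtypeVal (measurableSet_singleton _).compl]
    exact hgi.integrableOn
  rw [h1, integral_prod _ h2]
  have h3 : ∀ w : Metric.sphere (0 : Space) 1,
      ∫ r : Set.Ioi (0 : ℝ), G (w, r) ∂(.volumeIoiPow 2) = -ψ 0 := by
    intro w
    have hw : ‖(w : Space)‖ = 1 := by simp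
    rw [Measure.volumeIoiPow]
    simp only [ENNReal.ofReal]
    rw [integral_withDensity_eq_integral_smul (by fun_prop),
      integral_subtype_comap measurableSet_Ioi
        (fun a : ℝ => Real.toNNReal (a ^ 2) • g (a • (w : Space)))]
    have hγ : ContDiff ℝ 1 fun a : ℝ => ψ (a • (w : Space)) :=
      hψ.comp (contDiff_id.smul contDiff_const)
    have hγc : HasCompactSupport fun a : ℝ => ψ (a • (w : Space)) := by
      refine hc.comp_isClosedEmbedding
        (isClosedEmbedding_smul_left (c := (w : Space)) (norm_ne_zero_iff.1 (by simp)))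
    have h4 := hγc.integral_Ioi_deriv_eq hγ 0
    simp only [zero_smul] at h4
    rw [← h4]
    refine setIntegral_congr_fun measurableSet_Ioi fun a ha => ?_
    have ha' : 0 < a := ha
    have h5 : HasDerivAt (fun a : ℝ => ψ (a • (w : Space))) (fderiv ℝ ψ (a • (w : Space)) w) a := by
      have := (hψ.differentiable (by norm_num) (a • (w : Space))).hasFDerivAt.comp_hasDerivAt a
        ((hasDerivAt_id a).smul_const (w : Space))
      simpa [Function.comp_def] using this
    rw [h5.deriv, hg]
    simp only [coulombKernel, norm_smul, hw, mul_one, Real.norm_of_nonneg ha'.le, map_smul,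
      smul_eq_mul, NNReal.smul_def, Real.coe_toNNReal _ (sq_nonneg a)]
    field_simp
  simp only [h3]
  rw [integral_const, Measure.toSphere_real_apply_univ, Measure.real,
    EuclideanSpace.volume_ball_fin_three]
  simp only [one_pow, ENNReal.ofReal_one, one_mul, finrank_euclideanSpace, Fintype.card_fin,
    smul_eq_mul, Nat.cast_ofNat, mul_neg, neg_inj]
  rw [ENNReal.toReal_ofReal (by positivity)]
  ring

theorem integral_fderiv_coulombField {n : ℕ} (x : Fin n → Space)
    (q : Fin n → ℝ) {ψ : Space → ℝ} (hψ : ContDiff ℝ 1 ψ) (hc : HasCompactSupport ψ) :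
    ∫ y, fderiv ℝ ψ y (coulombField x q y) = -∑ i, q i * ψ (x i) := by
  have hψi : ∀ i, ContDiff ℝ 1 fun z => ψ (z + x i) := fun i =>
    hψ.comp (contDiff_id.add contDiff_const)
  have hci : ∀ i, HasCompactSupport fun z => ψ (z + x i) := fun i =>
    hc.comp_homeomorph (Homeomorph.addRight (x i))
  have hfd : ∀ i z, fderiv ℝ (fun z => ψ (z + x i)) z = fderiv ℝ ψ (z + x i) := fun i z =>
    fderiv_comp_add_right (x i)
  have h1 : ∀ i, Integrable fun y => fderiv ℝ ψ y (coulombKernel (y - x i)) := by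
    intro i
    have := (integrable_fderiv_coulombKernel (hψi i) (hci i)).comp_sub_right (x i)
    simpa [hfd] using this
  have h2 : ∀ i, ∫ y, fderiv ℝ ψ y (coulombKernel (y - x i)) = -(4 * Real.pi * ψ (x i)) := by
    intro i
    have h3 := integral_fderiv_coulombKernel (hψi i) (hci i)
    rw [← integral_sub_right_eq_self _ (x i)] at h3
    simpa [hfd] using h3
  simp_rw [coulombField_eq, map_sum, map_smul, smul_eq_mul]
  rw [integral_finsetSum _ fun i _ => (h1 i).const_mul _, ← Finset.sum_neg_distrib]
  refine Finset.sum_congr rfl fun i _ => ?_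
  rw [integral_const_mul, h2]
  field_simp

theorem locallyIntegrable_coulombField {n : ℕ} {x : Fin n → Space} (hx : Function.Injective x)
    (q : Fin n → ℝ) : LocallyIntegrable (coulombField x q) :=
  locallyIntegrable_of_isBigO (contDiffOn_coulombField x q).continuousOn
    fun i => coulombField_isBigO hx i

/-- The divergence of a Coulomb field is its charge density. -/
theorem distDiv_coulombField {n : ℕ} {x : Fin n → Space} (hx : Function.Injective x)
    (q : Fin n → ℝ) : distDiv (toDist (coulombField x q)) = pointCharges x q := by
  have hl := locallyIntegrable_coulombField hx q
  ext φ
  rw [distDiv_apply, pointCharges_apply]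
  simp only [lineDeriv_toDist_apply hl]
  have h1 := integral_fderiv_coulombField x q (φ.contDiff.of_le (by simp)) φ.hasCompactSupport
  rw [Finset.sum_neg_distrib, ← integral_finsetSum, neg_eq_iff_eq_neg, ← h1]
  · simp_rw [fun y => fderiv_apply_eq_sum φ y (coulombField x q y)]
  · intro k _
    have h2 : LocallyIntegrable (fun y => coulombField x q y k) := by
      intro y
      obtain ⟨s, hs, h⟩ := hl y
      exact ⟨s, hs, (EuclideanSpace.proj k : Space →L[ℝ] ℝ).integrable_comp h⟩
    have h3 := h2.integrable_smul_left_of_hasCompactSupport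
      (g := fun y => fderiv ℝ φ y (basisVec k))
      ((φ.contDiff.continuous_fderiv (by simp)).clm_apply continuous_const)
      ((φ.hasCompactSupport.fderiv (𝕜 := ℝ)).mono fun y hy => by
        contrapose! hy
        have : fderiv ℝ φ y = 0 := by simpa using hy
        simp [this])
    simpa [mul_comm] using h3

section

/-! ### Radial cutoffs and fluxes through thin shells -/

/-- A smooth radial cutoff around `c`: it is `1` on the closed ball of radius `a` and vanishes
outside the ball of radius `b`. It is a function of `|y - c|²`, so that it is smooth at `c` too. -/
def cutoff (c : Space) (a b : ℝ) (y : Space) : ℝ :=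
  Real.smoothTransition ((b ^ 2 - ‖y - c‖ ^ 2) / (b ^ 2 - a ^ 2))

variable {c : Space} {a b : ℝ}

theorem contDiff_cutoff {k : ℕ∞} : ContDiff ℝ k (cutoff c a b) := by
  refine Real.smoothTransition.contDiff.comp ?_
  exact (contDiff_const.sub (((contDiff_id.sub contDiff_const).norm_sq ℝ))).div_const _

theorem cutoff_eq_one (ha : 0 ≤ a) (hab : a < b) {y : Space} (hy : ‖y - c‖ ≤ a) :
    cutoff c a b y = 1 := by
  refine Real.smoothTransition.one_of_one_le ?_
  have h1 : a ^ 2 < b ^ 2 := by gcongr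
  have h2 : ‖y - c‖ ^ 2 ≤ a ^ 2 := by gcongr
  rw [le_div_iff₀ (by linarith)]
  linarith

theorem cutoff_eq_zero (ha : 0 ≤ a) (hab : a < b) {y : Space} (hy : b ≤ ‖y - c‖) :
    cutoff c a b y = 0 := by
  refine Real.smoothTransition.zero_of_nonpos ?_
  have h1 : a ^ 2 < b ^ 2 := by gcongr
  have h2 : b ^ 2 ≤ ‖y - c‖ ^ 2 := by
    have : 0 ≤ b := ha.trans hab.le
    gcongr
  exact div_nonpos_of_nonpos_of_nonneg (by linarith) (by linarith)

theorem abs_cutoff_le_one (y : Space) : |cutoff c a b y| ≤ 1 := by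
  rw [cutoff, abs_of_nonneg (Real.smoothTransition.nonneg _)]
  exact Real.smoothTransition.le_one _

theorem hasCompactSupport_cutoff (ha : 0 ≤ a) (hab : a < b) : HasCompactSupport (cutoff c a b) :=
  HasCompactSupport.intro (isCompact_closedBall c b) fun y hy =>
    cutoff_eq_zero ha hab (by
      rw [Metric.mem_closedBall, dist_eq_norm, not_le] at hy
      exact hy.le)

theorem fderiv_cutoff_apply (y v : Space) :
    fderiv ℝ (cutoff c a b) y v =
      deriv Real.smoothTransition ((b ^ 2 - ‖y - c‖ ^ 2) / (b ^ 2 - a ^ 2)) *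
        (-(2 * inner ℝ (y - c) v) / (b ^ 2 - a ^ 2)) := by
  have h1 : HasFDerivAt (fun y : Space => ‖y - c‖ ^ 2) (2 • innerSL ℝ (y - c)) y := by
    have := (hasStrictFDerivAt_norm_sq (y - c)).hasFDerivAt.comp y
      ((hasFDerivAt_id y).sub_const c)
    simpa [Function.comp_def] using this
  have h2 : HasFDerivAt (fun y : Space => (b ^ 2 - ‖y - c‖ ^ 2) / (b ^ 2 - a ^ 2))
      ((b ^ 2 - a ^ 2)⁻¹ • (-(2 • innerSL ℝ (y - c)) : Space →L[ℝ] ℝ)) y := by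
    have := (h1.const_sub (b ^ 2)).const_smul ((b ^ 2 - a ^ 2)⁻¹)
    refine this.congr_of_eventuallyEq (Eventually.of_forall fun z => ?_)
    simp [div_eq_inv_mul]
  have h3 : DifferentiableAt ℝ Real.smoothTransition
      ((b ^ 2 - ‖y - c‖ ^ 2) / (b ^ 2 - a ^ 2)) :=
    (Real.smoothTransition.contDiff (n := 1)).differentiable (by norm_num) _
  have h4 := h3.hasDerivAt.comp_hasFDerivAt y h2
  have h5 : Real.smoothTransition ∘ (fun y : Space => (b ^ 2 - ‖y - c‖ ^ 2) / (b ^ 2 - a ^ 2))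
    = cutoff c a b := rfl
  rw [h5] at h4
  rw [h4.fderiv]
  simp only [smul_apply, neg_apply, innerSL_apply_apply, smul_eq_mul, nsmul_eq_mul]
  push_cast
  ring

theorem fderiv_cutoff_eq_zero (ha : 0 ≤ a) (hab : a < b) {y : Space}
    (hy : ‖y - c‖ < a ∨ b < ‖y - c‖) : fderiv ℝ (cutoff c a b) y = 0 := by
  have hc : Continuous fun z : Space => ‖z - c‖ := by fun_prop
  rcases hy with hy | hy
  · have : cutoff c a b =ᶠ[𝓝 y] fun _ => 1 := by
      filter_upwards [(isOpen_lt hc continuous_const).mem_nhds hy] with z hz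
      exact cutoff_eq_one ha hab (le_of_lt hz)
    rw [this.fderiv_eq]
    simp
  · have : cutoff c a b =ᶠ[𝓝 y] fun _ => 0 := by
      filter_upwards [(isOpen_lt continuous_const hc).mem_nhds hy] with z hz
      exact cutoff_eq_zero ha hab (le_of_lt hz)
    rw [this.fderiv_eq]
    simp

theorem tsupport_fderiv_cutoff_subset (ha : 0 ≤ a) (hab : a < b) :
    tsupport (fderiv ℝ (cutoff c a b)) ⊆ {y | a ≤ ‖y - c‖ ∧ ‖y - c‖ ≤ b} := by
  have hc : Continuous fun z : Space => ‖z - c‖ := by fun_prop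
  refine closure_minimal (fun y hy => ?_)
    ((isClosed_le continuous_const hc).inter (isClosed_le hc continuous_const))
  by_contra h
  apply hy
  simp only [Set.mem_ofPred_eq, not_and_or, not_le] at h
  exact fderiv_cutoff_eq_zero ha hab h

theorem exists_abs_deriv_smoothTransition_le :
    ∃ C : ℝ, 0 ≤ C ∧ ∀ t, |deriv Real.smoothTransition t| ≤ C := by
  have h1 : HasCompactSupport (deriv Real.smoothTransition) := by
    refine HasCompactSupport.intro (isCompact_Icc (a := (0 : ℝ)) (b := 1)) fun t ht => ?_
    rw [Set.mem_Icc, not_and_or, not_le, not_le] at ht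
    rcases ht with ht | ht
    · have : Real.smoothTransition =ᶠ[𝓝 t] fun _ => 0 := by
        filter_upwards [gt_mem_nhds ht] with s hs
        exact Real.smoothTransition.zero_of_nonpos hs.le
      rw [this.deriv_eq]
      simp
    · have : Real.smoothTransition =ᶠ[𝓝 t] fun _ => 1 := by
        filter_upwards [lt_mem_nhds ht] with s hs
        exact Real.smoothTransition.one_of_one_le hs.le
      rw [this.deriv_eq]
      simp
  obtain ⟨C, hC⟩ := h1.exists_bound_of_continuous
    ((Real.smoothTransition.contDiff (n := 1)).continuous_deriv le_rfl)
  exact ⟨C, (norm_nonneg _).trans (hC 0), hC⟩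

/-- The flux of a field through a shell is controlled by its radial component, uniformly in the
thickness of the shell. -/
theorem exists_abs_integral_fderiv_cutoff_le :
    ∃ C : ℝ, 0 ≤ C ∧ ∀ (c : Space) (a b M : ℝ) (F : Space → Space), 0 ≤ a → a < b →
      (∀ y, a ≤ ‖y - c‖ → ‖y - c‖ ≤ b → |inner ℝ (y - c) (F y)| ≤ M) →
      |∫ y, fderiv ℝ (cutoff c a b) y (F y)| ≤ C * M * b := by
  obtain ⟨C, hC0, hC⟩ := exists_abs_deriv_smoothTransition_le
  refine ⟨C * (16 * Real.pi / 3), by positivity, fun c a b M F ha hab hF => ?_⟩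
  have hb : 0 < b := ha.trans_lt hab
  have hM : 0 ≤ M := by
    have h1 : ‖(c + EuclideanSpace.single 0 b : Space) - c‖ = b := by
      simp [hb.le]
    exact (abs_nonneg _).trans (hF _ (by rw [h1]; exact hab.le) h1.le)
  have hab2 : 0 < b ^ 2 - a ^ 2 := by
    have : a ^ 2 < b ^ 2 := by gcongr
    linarith
  set s : Set Space := Metric.closedBall c b \ Metric.ball c a with hs
  have h1 : ∫ y, fderiv ℝ (cutoff c a b) y (F y) = ∫ y in s, fderiv ℝ (cutoff c a b) y (F y) := by
    refine (setIntegral_eq_integral_of_forall_compl_eq_zero fun y hy => ?_).symm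
    have h2 : ‖y - c‖ < a ∨ b < ‖y - c‖ := by
      simp only [hs, Set.mem_sdiff, Metric.mem_closedBall, Metric.mem_ball, dist_eq_norm,
        not_and_or, not_le, not_not] at hy
      tauto
    rw [fderiv_cutoff_eq_zero ha hab h2]
    simp
  have h3 : ∀ y ∈ s, ‖fderiv ℝ (cutoff c a b) y (F y)‖ ≤ C * (2 * M / (b ^ 2 - a ^ 2)) := by
    intro y hy
    simp only [hs, Set.mem_sdiff, Metric.mem_closedBall, Metric.mem_ball, dist_eq_norm,
      not_lt] at hy
    rw [fderiv_cutoff_apply, Real.norm_eq_abs, abs_mul]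
    refine mul_le_mul (hC _) ?_ (abs_nonneg _) hC0
    rw [abs_div, abs_neg, abs_mul, abs_of_pos hab2, abs_two]
    gcongr
    exact hF y hy.2 hy.1
  have h4 : (volume : Measure Space).real s = 4 * Real.pi / 3 * (b ^ 3 - a ^ 3) := by
    rw [hs, measureReal_sdiff (Metric.ball_subset_closedBall.trans
      (Metric.closedBall_subset_closedBall hab.le)) measurableSet_ball
      measure_closedBall_lt_top.ne, Measure.real, Measure.real,
      EuclideanSpace.volume_closedBall_fin_three, EuclideanSpace.volume_ball_fin_three]
    simp only [ENNReal.toReal_mul, ENNReal.toReal_pow, ENNReal.toReal_ofReal ha,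
      ENNReal.toReal_ofReal hb.le]
    rw [ENNReal.toReal_ofReal (by positivity)]
    ring
  have h5 := norm_setIntegral_le_of_norm_le_const (μ := (volume : Measure Space)) (s := s)
    ((measure_mono Set.sdiff_subset).trans_lt measure_closedBall_lt_top) h3
  rw [← h1, h4, Real.norm_eq_abs] at h5
  refine h5.trans ?_
  -- The gradient of the cutoff is of order `1 / (b ^ 2 - a ^ 2)` and the shell has volume
  -- proportional to `b ^ 3 - a ^ 3`, so the thickness of the shell cancels.
  have h6 : (b ^ 3 - a ^ 3) / (b ^ 2 - a ^ 2) ≤ 2 * b := by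
    rw [div_le_iff₀ hab2]
    nlinarith [mul_nonneg ha hb.le, mul_pos hb hb, mul_nonneg (sub_nonneg.2 hab.le) hb.le,
      mul_nonneg (mul_nonneg (sub_nonneg.2 hab.le) hb.le) hb.le,
      mul_nonneg (mul_nonneg (sub_nonneg.2 hab.le) hb.le) ha,
      mul_nonneg (mul_nonneg (sub_nonneg.2 hab.le) (sub_nonneg.2 hab.le)) ha]
  calc C * (2 * M / (b ^ 2 - a ^ 2)) * (4 * Real.pi / 3 * (b ^ 3 - a ^ 3))
      = C * (8 * Real.pi / 3) * M * ((b ^ 3 - a ^ 3) / (b ^ 2 - a ^ 2)) := by ring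
    _ ≤ C * (8 * Real.pi / 3) * M * (2 * b) := by gcongr
    _ = _ := by ring

end

section

variable {n : ℕ} {x : Fin n → Space} {q : Fin n → ℝ}

/-! ### Total free charge -/

theorem integrableOn_divergence_truncatedSpace {F : Space → Space}
    (hF : ContDiffOn ℝ 1 F (Set.range x)ᶜ) {r : ℝ} (hr : 0 < r) (R : ℝ) :
    IntegrableOn (divergence F) (truncatedSpace x r R) := by
  set K : Set Space := Metric.closedBall 0 R ∩ ⋂ i, {y | r ≤ ‖y - x i‖} with hK
  have hc : IsCompact K := (isCompact_closedBall 0 R).inter_right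
    (isClosed_iInter fun i => isClosed_le continuous_const (by fun_prop))
  have hKS : K ⊆ (Set.range x)ᶜ := by
    rintro y hy ⟨i, rfl⟩
    have h1 := Set.mem_iInter.1 hy.2 i
    simp only [Set.mem_ofPred_eq, sub_self, norm_zero] at h1
    linarith
  refine (((continuousOn_divergence (isOpen_compl_range x) hF).mono hKS).integrableOn_compact
    hc).mono_set fun y hy => ⟨?_, Set.mem_iInter.2 fun i => (hy.2 i).le⟩
  rw [mem_closedBall_zero_iff]
  exact hy.1.le

/-- The charge inside a truncated space differs from `∑ qᵢ` by at most the flux of `F` through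
small spheres around the charges and the flux of `F - C_q` through a large sphere. -/
theorem exists_abs_integral_truncatedSpace_sub_le :
    ∃ C : ℝ, 0 ≤ C ∧ ∀ (n : ℕ) (x : Fin n → Space) (q : Fin n → ℝ) (F : Space → Space)
      (r R M ε : ℝ), ContDiffOn ℝ 1 F (Set.range x)ᶜ → 0 < r → 0 ≤ M → 0 ≤ ε →
      (∀ i j, i ≠ j → 3 * r ≤ ‖x i - x j‖) → (∀ i, ‖x i‖ + 2 * r ≤ R / 2) → 0 < R →
      (∀ i y, y ≠ x i → ‖y - x i‖ ≤ 2 * r → |inner ℝ (y - x i) (F y)| ≤ M * ‖y - x i‖) →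
      (∀ y, R / 2 ≤ ‖y‖ → ‖F y - coulombField x q y‖ ≤ ε * ‖y‖⁻¹ ^ 2) →
      |(∫ y in truncatedSpace x r R, divergence F y) - ∑ i, q i| ≤
        C * (2 * ε) + n * (C * (M * (2 * r)) * (2 * r)) := by
  obtain ⟨C, hC0, hC⟩ := exists_abs_integral_fderiv_cutoff_le
  refine ⟨C, hC0, fun n x q F r R M ε hF hr hM hε hsep hbig hR hin hout => ?_⟩
  have hU := isOpen_compl_range x
  -- The functions `ψ k` below increase to the indicator function of the truncated space: the shells
  -- `a k < ‖y‖ < R` and `r < ‖y - x i‖ < b k` where they vary shrink to spheres.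
  let a : ℕ → ℝ := fun k => R * (1 - 1 / ((k : ℝ) + 2))
  let b : ℕ → ℝ := fun k => r * (1 + 1 / ((k : ℝ) + 1))
  have ha1 : ∀ k, R / 2 ≤ a k := fun k => by
    have : 1 / ((k : ℝ) + 2) ≤ 1 / 2 := by
      apply one_div_le_one_div_of_le <;> linarith [(Nat.cast_nonneg k : (0 : ℝ) ≤ k)]
    simp only [a]
    nlinarith
  have ha2 : ∀ k, a k < R := fun k => by
    have : 0 < 1 / ((k : ℝ) + 2) := by positivity
    simp only [a]
    nlinarith
  have hb1 : ∀ k, r < b k := fun k => by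
    have : 0 < 1 / ((k : ℝ) + 1) := by positivity
    simp only [b]
    nlinarith
  have hb2 : ∀ k, b k ≤ 2 * r := fun k => by
    have : 1 / ((k : ℝ) + 1) ≤ 1 := by
      rw [div_le_one (by positivity)]
      linarith [(Nat.cast_nonneg k : (0 : ℝ) ≤ k)]
    simp only [b]
    nlinarith
  have ha0 : ∀ k, 0 ≤ a k := fun k => by linarith [ha1 k]
  have hat : Tendsto a atTop (𝓝 R) := by
    have h1 : Tendsto (fun k : ℕ => 1 / ((k : ℝ) + 2)) atTop (𝓝 0) := by
      have := tendsto_const_div_atTop_nhds_zero_nat (1 : ℝ)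
      simpa using (tendsto_add_atTop_iff_nat (f := fun k : ℕ => 1 / (k : ℝ)) 2).2 this
    simpa [a] using (h1.const_sub 1).const_mul R
  have hbt : Tendsto b atTop (𝓝 r) := by
    have h1 := tendsto_one_div_add_atTop_nhds_zero_nat (𝕜 := ℝ)
    simpa [b] using (h1.const_add 1).const_mul r
  let ψ : ℕ → Space → ℝ := fun k y => cutoff 0 (a k) R y - ∑ i, cutoff (x i) r (b k) y
  have hψs : ∀ k, ContDiff ℝ 1 (ψ k) := fun k =>
    (contDiff_cutoff (k := 1)).sub (ContDiff.sum fun i _ => contDiff_cutoff (k := 1))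
  -- near a charge the inner cutoffs cancel the outer one
  have hball : ∀ k i y, ‖y - x i‖ ≤ r → ψ k y = 0 := by
    intro k i y hy
    have h1 : cutoff 0 (a k) R y = 1 := by
      refine cutoff_eq_one (ha0 k) (ha2 k) ?_
      have := norm_add_le (y - x i) (x i)
      rw [sub_add_cancel] at this
      rw [sub_zero]
      linarith [hbig i, ha1 k]
    have h2 : ∑ j, cutoff (x j) r (b k) y = 1 := by
      rw [Finset.sum_eq_single i]
      · exact cutoff_eq_one hr.le (hb1 k) hy
      · intro j _ hj
        refine cutoff_eq_zero hr.le (hb1 k) ?_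
        have h3 := norm_sub_le (y - x j) (y - x i)
        rw [sub_sub_sub_cancel_left] at h3
        linarith [hsep i j hj.symm, hb2 k]
      · simp
    simp only [ψ, h1, h2, sub_self]
  have hfar : ∀ k y, R ≤ ‖y‖ → ψ k y = 0 := by
    intro k y hy
    have h1 : cutoff 0 (a k) R y = 0 := cutoff_eq_zero (ha0 k) (ha2 k) (by rwa [sub_zero])
    have h2 : ∑ j, cutoff (x j) r (b k) y = 0 := by
      refine Finset.sum_eq_zero fun j _ => cutoff_eq_zero hr.le (hb1 k) ?_
      linarith [norm_sub_norm_le y (x j), hbig j, hb2 k]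
    simp only [ψ, h1, h2, sub_self]
  have hψc : ∀ k, HasCompactSupport (ψ k) := fun k =>
    HasCompactSupport.intro (isCompact_closedBall 0 R) fun y hy => hfar k y (by
      rw [mem_closedBall_zero_iff, not_le] at hy
      exact hy.le)
  have hψU : ∀ k, tsupport (ψ k) ⊆ (Set.range x)ᶜ := by
    rintro k _ hy ⟨i, rfl⟩
    rw [← Set.notMem_compl_iff] at hy
    apply hy
    rw [Set.mem_compl_iff, notMem_tsupport_iff_eventuallyEq]
    filter_upwards [Metric.ball_mem_nhds (x i) hr] with y hy
    rw [Metric.mem_ball, dist_eq_norm] at hy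
    exact hball k i y hy.le
  have hsuppa : ∀ k, tsupport (fderiv ℝ (cutoff 0 (a k) R)) ⊆ (Set.range x)ᶜ := by
    rintro k _ hy ⟨i, rfl⟩
    have := (tsupport_fderiv_cutoff_subset (ha0 k) (ha2 k) hy).1
    rw [sub_zero] at this
    linarith [hbig i, ha1 k]
  have hsuppb : ∀ k i, tsupport (fderiv ℝ (cutoff (x i) r (b k))) ⊆ (Set.range x)ᶜ := by
    rintro k i _ hy ⟨j, rfl⟩
    have := tsupport_fderiv_cutoff_subset hr.le (hb1 k) hy
    rcases eq_or_ne j i with rfl | hj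
    · have h1 := this.1
      simp only [sub_self, norm_zero] at h1
      linarith
    · linarith [this.2, hsep j i hj, hb2 k]
  have hbound : ∀ k, |(∫ y, ψ k y * divergence F y) - ∑ i, q i| ≤
      C * (2 * ε) + n * (C * (M * (2 * r)) * (2 * r)) := by
    intro k
    have hD := (contDiffOn_coulombField x q).continuousOn
    have hca := hasCompactSupport_cutoff (c := 0) (ha0 k) (ha2 k)
    have hi1 := integrable_fderiv_apply hU hF.continuousOn (contDiff_cutoff (k := 1)) hca (hsuppa k)
    have hi2 := integrable_fderiv_apply hU hD (contDiff_cutoff (k := 1)) hca (hsuppa k)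
    have hi3 : ∀ i, Integrable fun y => fderiv ℝ (cutoff (x i) r (b k)) y (F y) := fun i =>
      integrable_fderiv_apply hU hF.continuousOn (contDiff_cutoff (k := 1))
        (hasCompactSupport_cutoff hr.le (hb1 k)) (hsuppb k i)
    have hd : ∀ (c : Space) (s t : ℝ) (y : Space), DifferentiableAt ℝ (cutoff c s t) y :=
      fun c s t y => (contDiff_cutoff (k := 1)).differentiable (by norm_num) y
    have h1 : ∀ y, fderiv ℝ (ψ k) y (F y) = fderiv ℝ (cutoff 0 (a k) R) y (F y)
        - ∑ i, fderiv ℝ (cutoff (x i) r (b k)) y (F y) := by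
      intro y
      have h2 : HasFDerivAt (ψ k) (fderiv ℝ (cutoff 0 (a k) R) y
        - ∑ i, fderiv ℝ (cutoff (x i) r (b k)) y) y :=
        (hd _ _ _ y).hasFDerivAt.sub (HasFDerivAt.fun_sum fun i _ => (hd _ _ _ y).hasFDerivAt)
      rw [h2.fderiv]
      simp
    have h2 := integral_fderiv_apply hU hF (hψs k) (hψc k) (hψU k)
    simp_rw [h1] at h2
    rw [integral_sub hi1 (integrable_finsetSum _ fun i _ => hi3 i),
      integral_finsetSum _ fun i _ => hi3 i] at h2
    have h3 := integral_fderiv_coulombField x q (contDiff_cutoff (c := 0) (a := a k) (b := R)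
      (k := 1)) hca
    have h4 : ∑ i, q i * cutoff 0 (a k) R (x i) = ∑ i, q i := by
      refine Finset.sum_congr rfl fun i _ => ?_
      rw [cutoff_eq_one (ha0 k) (ha2 k), mul_one]
      rw [sub_zero]
      linarith [hbig i, ha1 k]
    rw [h4] at h3
    -- The outer flux of `F` is that of the Coulomb field, which is the total charge, plus the small
    -- flux of the difference.
    have h5 : ∫ y, fderiv ℝ (cutoff 0 (a k) R) y (F y) =
        (∫ y, fderiv ℝ (cutoff 0 (a k) R) y (F y - coulombField x q y)) - ∑ i, q i := by
      simp_rw [map_sub]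
      rw [integral_sub hi1 hi2, h3]
      ring
    have h6 : |∫ y, fderiv ℝ (cutoff 0 (a k) R) y (F y - coulombField x q y)| ≤ C * (2 * ε) := by
      have h7 := hC 0 (a k) R (2 * ε / R) (fun y => F y - coulombField x q y) (ha0 k) (ha2 k)
        fun y hy1 hy2 => by
          rw [sub_zero] at hy1 hy2 ⊢
          have hy3 : R / 2 ≤ ‖y‖ := (ha1 k).trans hy1
          have hy0 : 0 < ‖y‖ := by linarith
          calc |inner ℝ y (F y - coulombField x q y)|
              ≤ ‖y‖ * ‖F y - coulombField x q y‖ := abs_real_inner_le_norm _ _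
            _ ≤ ‖y‖ * (ε * ‖y‖⁻¹ ^ 2) := by gcongr; exact hout y hy3
            _ = ε / ‖y‖ := by field_simp
            _ ≤ ε / (R / 2) := by gcongr
            _ = 2 * ε / R := by field_simp
      calc _ ≤ _ := h7
        _ = _ := by field_simp
    have h8 : ∀ i, |∫ y, fderiv ℝ (cutoff (x i) r (b k)) y (F y)| ≤
        C * (M * (2 * r)) * (2 * r) := by
      intro i
      refine (hC (x i) r (b k) (M * (2 * r)) F hr.le (hb1 k) fun y hy1 hy2 => ?_).trans ?_
      · have hne : y ≠ x i := by
          rintro rfl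
          simp only [sub_self, norm_zero] at hy1
          linarith
        refine (hin i y hne (hy2.trans (hb2 k))).trans ?_
        have := hy2.trans (hb2 k)
        gcongr
      · have := hb2 k
        gcongr
    have h9 : |∑ i, ∫ y, fderiv ℝ (cutoff (x i) r (b k)) y (F y)| ≤
        n * (C * (M * (2 * r)) * (2 * r)) := by
      refine (Finset.abs_sum_le_sum_abs _ _).trans ?_
      refine (Finset.sum_le_sum fun i _ => h8 i).trans ?_
      simp
    have h10 : (∫ y, ψ k y * divergence F y) - ∑ i, q i =
        (∑ i, ∫ y, fderiv ℝ (cutoff (x i) r (b k)) y (F y))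
        - ∫ y, fderiv ℝ (cutoff 0 (a k) R) y (F y - coulombField x q y) := by
      rw [h5] at h2
      linarith
    rw [h10]
    refine (abs_sub _ _).trans ?_
    linarith
  have hlim : Tendsto (fun k => ∫ y, ψ k y * divergence F y) atTop
      (𝓝 (∫ y in truncatedSpace x r R, divergence F y)) := by
    have hmeas : MeasurableSet (truncatedSpace x r R) := by
      have : truncatedSpace x r R = {y | ‖y‖ < R} ∩ ⋂ i, {y | r < ‖y - x i‖} := by
        ext y
        simp [truncatedSpace]
      rw [this]
      exact (measurableSet_lt (by fun_prop) measurable_const).inter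
        (MeasurableSet.iInter fun i => measurableSet_lt measurable_const (by fun_prop))
    rw [← integral_indicator hmeas]
    have hi := (integrableOn_divergence_truncatedSpace hF hr R).integrable_indicator hmeas
    refine tendsto_integral_of_dominated_convergence
      (fun y => (n + 1) * ‖(truncatedSpace x r R).indicator (divergence F) y‖) (fun k => ?_)
      (hi.norm.const_mul _) (fun k => Eventually.of_forall fun y => ?_)
      (Eventually.of_forall fun y => ?_)
    · exact (hψs k).continuous.aestronglyMeasurable.mul
        (aestronglyMeasurable_of_continuousOn (continuousOn_divergence hU hF))
    · by_cases hy : y ∈ truncatedSpace x r R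
      · rw [Set.indicator_of_mem hy, norm_mul]
        gcongr
        refine (norm_sub_le _ _).trans ?_
        have h1 : ‖cutoff 0 (a k) R y‖ ≤ 1 := abs_cutoff_le_one y
        have h2 : ‖∑ i, cutoff (x i) r (b k) y‖ ≤ n := by
          refine (norm_sum_le _ _).trans ?_
          refine (Finset.sum_le_sum fun i _ => (abs_cutoff_le_one y : ‖cutoff (x i) r (b k) y‖ ≤ 1)).trans ?_
          simp
        linarith
      · have : ψ k y = 0 := by
          simp only [truncatedSpace, Set.mem_ofPred_eq, not_and_or, not_lt, not_forall] at hy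
          rcases hy with hy | ⟨i, hy⟩
          · exact hfar k y hy
          · exact hball k i y hy
        rw [this, zero_mul, norm_zero]
        positivity
    · by_cases hy : y ∈ truncatedSpace x r R
      · rw [Set.indicator_of_mem hy]
        refine tendsto_const_nhds.congr' ?_
        have h1 : ∀ᶠ k in atTop, ‖y‖ < a k := hat.eventually (lt_mem_nhds hy.1)
        have h2 : ∀ᶠ k in atTop, ∀ i, b k < ‖y - x i‖ :=
          eventually_all.2 fun i => hbt.eventually (gt_mem_nhds (hy.2 i))
        filter_upwards [h1, h2] with k hk1 hk2
        have h3 : cutoff 0 (a k) R y = 1 :=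
          cutoff_eq_one (ha0 k) (ha2 k) (by rw [sub_zero]; exact hk1.le)
        have h4 : ∑ i, cutoff (x i) r (b k) y = 0 :=
          Finset.sum_eq_zero fun i _ => cutoff_eq_zero hr.le (hb1 k) (hk2 i).le
        simp only [ψ, h3, h4, sub_zero, one_mul]
      · rw [Set.indicator_of_notMem hy]
        have : ∀ k, ψ k y = 0 := by
          intro k
          simp only [truncatedSpace, Set.mem_ofPred_eq, not_and_or, not_lt, not_forall] at hy
          rcases hy with hy | ⟨i, hy⟩
          · exact hfar k y hy
          · exact hball k i y hy
        simp [this]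
  exact le_of_tendsto ((hlim.sub_const _).abs) (Eventually.of_forall hbound)

/-- A field that agrees with `C_q` to leading order at infinity and whose radial components at the
charges are too small to carry flux has free charge `∑ qᵢ`. -/
theorem hasFreeChargeLim_of_isBigO (hx : Function.Injective x) {F : Space → Space}
    (hF : ContDiffOn ℝ 1 F (Set.range x)ᶜ)
    (hin : ∀ i, (fun y => inner ℝ (y - x i) (F y)) =O[𝓝[≠] (x i)] fun y => ‖y - x i‖)
    (hout : (fun y => F y - coulombField x q y) =o[cocompact Space] fun y => ‖y‖⁻¹ ^ 2) :
    HasFreeChargeLim x F (∑ i, q i) := by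
  obtain ⟨C, hC0, hC⟩ := exists_abs_integral_truncatedSpace_sub_le
  refine ⟨fun r R hr => integrableOn_divergence_truncatedSpace hF hr R, ?_⟩
  choose M' hM' using fun i => (hin i).bound
  obtain ⟨M, hM0, hM⟩ : ∃ M : ℝ, 0 ≤ M ∧ ∀ i, M' i ≤ M :=
    ⟨∑ i, |M' i|, Finset.sum_nonneg fun i _ => abs_nonneg _, fun i => (le_abs_self _).trans
      (Finset.single_le_sum (f := fun i => |M' i|) (fun i _ => abs_nonneg _) (Finset.mem_univ i))⟩
  -- all requirements on the small radius hold eventually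
  have hsmall : ∀ᶠ r : ℝ in 𝓝[>] 0, 0 < r ∧ r ≤ 1 ∧ (∀ i j, i ≠ j → 3 * r ≤ ‖x i - x j‖) ∧
      (∀ i y, y ≠ x i → ‖y - x i‖ ≤ 2 * r → |inner ℝ (y - x i) (F y)| ≤ M * ‖y - x i‖) := by
    have h1 : ∀ i, ∃ δ > 0, ∀ y, y ≠ x i → ‖y - x i‖ < δ →
        |inner ℝ (y - x i) (F y)| ≤ M * ‖y - x i‖ := by
      intro i
      obtain ⟨δ, hδ, h⟩ := Metric.mem_nhdsWithin_iff.1 (hM' i)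
      refine ⟨δ, hδ, fun y hy hyd => ?_⟩
      have h2 : ‖inner ℝ (y - x i) (F y)‖ ≤ M' i * ‖‖y - x i‖‖ :=
        h ⟨by rwa [Metric.mem_ball, dist_eq_norm], hy⟩
      rw [norm_norm] at h2
      exact h2.trans (by gcongr; exact hM i)
    choose δ hδ hδ' using h1
    have e1 : ∀ᶠ r : ℝ in 𝓝[>] 0, r ≤ 1 := by
      filter_upwards [Ioo_mem_nhdsGT (one_pos (α := ℝ))] with r hr using hr.2.le
    have e2 : ∀ᶠ r : ℝ in 𝓝[>] 0, ∀ i j, i ≠ j → 3 * r ≤ ‖x i - x j‖ := by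
      refine eventually_all.2 fun i => eventually_all.2 fun j => ?_
      by_cases hij : i = j
      · simp [hij]
      have hpos : 0 < ‖x i - x j‖ / 3 := by
        have := norm_pos_iff.2 (sub_ne_zero.2 (hx.ne hij))
        positivity
      filter_upwards [Ioo_mem_nhdsGT hpos] with r hr _
      linarith [hr.2]
    have e3 : ∀ᶠ r : ℝ in 𝓝[>] 0, ∀ i, 2 * r < δ i := by
      refine eventually_all.2 fun i => ?_
      filter_upwards [Ioo_mem_nhdsGT (half_pos (hδ i))] with r hr
      linarith [hr.2]
    filter_upwards [e1, e2, e3, self_mem_nhdsWithin] with r h1 h2 h3 h4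
    exact ⟨h4, h1, h2, fun i y hy hyr => hδ' i y hy (hyr.trans_lt (h3 i))⟩
  rw [Metric.tendsto_nhds]
  intro η hη
  set ε : ℝ := η / (4 * (C + 1)) with hε
  have hε0 : 0 < ε := by positivity
  have hlarge : ∀ᶠ R : ℝ in atTop, 0 < R ∧ (∀ i, ‖x i‖ + 2 ≤ R / 2) ∧
      (∀ y, R / 2 ≤ ‖y‖ → ‖F y - coulombField x q y‖ ≤ ε * ‖y‖⁻¹ ^ 2) := by
    have h1 := hout.bound hε0
    obtain ⟨ρ, hρ⟩ := (hasBasis_cocompact.eventually_iff.1 h1).imp fun K hK => hK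
    obtain ⟨B, hB⟩ := hρ.1.isBounded.exists_norm_le
    have e2 : ∀ᶠ R : ℝ in atTop, ∀ i, ‖x i‖ + 2 ≤ R / 2 := by
      refine eventually_all.2 fun i => ?_
      filter_upwards [eventually_ge_atTop (2 * (‖x i‖ + 2))] with R hR
      linarith
    filter_upwards [eventually_gt_atTop 0, e2, eventually_gt_atTop (2 * B)] with R h3 h4 h5
    refine ⟨h3, h4, fun y hy => ?_⟩
    have h6 : y ∈ ρᶜ := fun h => by linarith [hB y h]
    simpa using hρ.2 h6
  have hsmall2 : ∀ᶠ r : ℝ in 𝓝[>] 0, n * (C * (M * (2 * r)) * (2 * r)) < η / 2 := by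
    have h1 : Tendsto (fun r : ℝ => n * (C * (M * (2 * r)) * (2 * r))) (𝓝 0) (𝓝 0) := by
      have : Continuous fun r : ℝ => n * (C * (M * (2 * r)) * (2 * r)) := by fun_prop
      simpa using this.tendsto 0
    exact (h1.mono_left nhdsWithin_le_nhds).eventually (gt_mem_nhds (half_pos hη))
  filter_upwards [(hsmall.and hsmall2).prod_mk hlarge] with p hp
  obtain ⟨⟨⟨h1, h2, h3, h4⟩, h5⟩, h6, h7, h8⟩ := hp
  rw [Real.dist_eq]
  refine (hC n x q F p.1 p.2 M ε hF h1 hM0 hε0.le h3 (fun i => by linarith [h7 i]) h6 h4 h8).trans_lt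
    ?_
  have h9 : C * (2 * ε) ≤ η / 2 := by
    rw [hε, show C * (2 * (η / (4 * (C + 1)))) = (C / (C + 1)) * (η / 2) by field_simp; ring]
    refine mul_le_of_le_one_left (by positivity) ?_
    rw [div_le_one (by positivity)]
    linarith
  linarith

theorem HasFreeChargeLim.hasFreeCharge {F : Space → Space} {Q : ℝ} (h : HasFreeChargeLim x F Q)
    (hi : Integrable (divergence F)) : HasFreeCharge F Q := by
  refine ⟨hi, ?_⟩
  set r : ℕ → ℝ := fun k => 1 / ((k : ℝ) + 1) with hr
  have hr0 : Tendsto r atTop (𝓝[>] 0) := by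
    refine tendsto_nhdsWithin_iff.2 ⟨tendsto_one_div_add_atTop_nhds_zero_nat, ?_⟩
    exact Eventually.of_forall fun k => by simp only [hr, Set.mem_Ioi]; positivity
  have h1 := h.2.comp (hr0.prodMk (tendsto_natCast_atTop_atTop (R := ℝ)))
  have hmeas : ∀ k : ℕ, MeasurableSet (truncatedSpace x (r k) k) := fun k => by
    have : truncatedSpace x (r k) k = {y | ‖y‖ < k} ∩ ⋂ i, {y | r k < ‖y - x i‖} := by
      ext y
      simp [truncatedSpace]
    rw [this]
    exact (measurableSet_lt (by fun_prop) measurable_const).inter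
      (MeasurableSet.iInter fun i => measurableSet_lt measurable_const (by fun_prop))
  have h2 : Tendsto (fun k : ℕ => ∫ y in truncatedSpace x (r k) k, divergence F y) atTop
      (𝓝 (∫ y, divergence F y)) := by
    simp_rw [← integral_indicator (hmeas _)]
    refine tendsto_integral_of_dominated_convergence (fun y => ‖divergence F y‖)
      (fun k => hi.aestronglyMeasurable.indicator (hmeas k)) hi.norm
      (fun k => Eventually.of_forall fun y => norm_indicator_le_norm_self _ _) ?_
    have hae : ∀ᵐ y : Space, y ∈ (Set.range x)ᶜ :=
      compl_mem_ae_iff.2 ((Set.finite_range x).measure_zero _)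
    filter_upwards [hae] with y hy
    refine tendsto_const_nhds.congr' ?_
    have e1 : ∀ᶠ k : ℕ in atTop, ‖y‖ < k :=
      (tendsto_natCast_atTop_atTop (R := ℝ)).eventually_gt_atTop _
    have e2 : ∀ᶠ k : ℕ in atTop, ∀ i, r k < ‖y - x i‖ := by
      refine eventually_all.2 fun i => ?_
      have : 0 < ‖y - x i‖ := norm_pos_iff.2 (sub_ne_zero.2 fun h => hy ⟨i, h.symm⟩)
      exact (hr0.mono_right nhdsWithin_le_nhds).eventually (gt_mem_nhds this)
    filter_upwards [e1, e2] with k h1 h2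
    rw [Set.indicator_of_mem (show y ∈ truncatedSpace x (r k) k from ⟨h1, h2⟩)]
  exact tendsto_nhds_unique h2 h1

end

/-! ### Distributional derivatives of bounded fields with point singularities -/

section

variable {n : ℕ} {x : Fin n → Space}

theorem coulombField_zero (x : Fin n → Space) (y : Space) : coulombField x 0 y = 0 := by
  simp [coulombField]

theorem partialDeriv_isBigO {F : Space → Space} {l : Filter Space} {g : Space → ℝ}
    (h : (fun y => fderiv ℝ F y) =O[l] g) (j k : Fin 3) : partialDeriv F j k =O[l] g := by
  refine Asymptotics.IsBigO.trans ?_ h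
  refine Asymptotics.IsBigO.of_bound ‖basisVec j‖ (Eventually.of_forall fun y => ?_)
  rw [mul_comm]
  exact (PiLp.norm_apply_le _ k).trans ((fderiv ℝ F y).le_opNorm _)

theorem locallyIntegrable_partialDeriv {F : Space → Space}
    (hF : ContDiffOn ℝ 1 F (Set.range x)ᶜ)
    (hd : ∀ i, (fun y => fderiv ℝ F y) =O[𝓝[≠] (x i)] fun y => ‖y - x i‖⁻¹ ^ 2) (j k : Fin 3) :
    LocallyIntegrable (partialDeriv F j k) :=
  locallyIntegrable_of_isBigO (continuousOn_partialDeriv (isOpen_compl_range x) hF j k)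
    fun i => partialDeriv_isBigO (hd i) j k

/-- Bounded point singularities do not contribute to an integration by parts. -/
theorem integral_mul_fderiv_of_isBigO (hx : Function.Injective x) {F : Space → Space}
    (hF : ContDiffOn ℝ 1 F (Set.range x)ᶜ)
    (hb : ∀ i, F =O[𝓝[≠] (x i)] fun _ => (1 : ℝ))
    (hd : ∀ i, (fun y => fderiv ℝ F y) =O[𝓝[≠] (x i)] fun y => ‖y - x i‖⁻¹ ^ 2)
    (hl : LocallyIntegrable F) {φ : Space → ℝ} (hφ : ContDiff ℝ 1 φ) (hc : HasCompactSupport φ)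
    (j k : Fin 3) :
    ∫ y, F y k * fderiv ℝ φ y (basisVec j) = -∫ y, φ y * partialDeriv F j k y := by
  -- The field `φ F_k e_j` has no charge at the singularities, so its divergence integrates to zero.
  set G : Space → Space := fun y => (φ y * F y k) • basisVec j with hG
  have hFk : ContDiffOn ℝ 1 (fun y => F y k) (Set.range x)ᶜ :=
    (EuclideanSpace.proj k : Space →L[ℝ] ℝ).contDiff.comp_contDiffOn hF
  have hG1 : ContDiffOn ℝ 1 G (Set.range x)ᶜ :=
    (hφ.contDiffOn.mul hFk).smul contDiffOn_const
  have hdiv : ∀ y ∈ (Set.range x)ᶜ, divergence G y =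
      F y k * fderiv ℝ φ y (basisVec j) + φ y * partialDeriv F j k y := by
    intro y hy
    have hy' := (isOpen_compl_range x).mem_nhds hy
    have hFd : DifferentiableAt ℝ F y :=
      ((hF y hy).contDiffAt hy').differentiableAt (by norm_num)
    have hFkd : DifferentiableAt ℝ (fun y => F y k) y :=
      ((hFk y hy).contDiffAt hy').differentiableAt (by norm_num)
    have hφd : DifferentiableAt ℝ φ y := hφ.differentiable (by norm_num) y
    have h1 : HasFDerivAt G _ y :=
      (hφd.hasFDerivAt.mul hFkd.hasFDerivAt).smul_const (basisVec j)
    rw [divergence_eq_of_hasFDerivAt h1, partialDeriv_eq_fderiv hFd]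
    have h2 : ∀ (c : ℝ) (m : Fin 3),
        inner ℝ (c • basisVec j) (basisVec m) = if m = j then c else 0 := by
      intro c m
      rw [inner_basisVec]
      simp [basisVec]
    simp only [ContinuousLinearMap.smulRight_apply, h2]
    simp
    ring
  have hi1 : Integrable fun y => F y k * fderiv ℝ φ y (basisVec j) := by
    have h1 : LocallyIntegrable (fun y => F y k) := by
      intro y
      obtain ⟨s, hs, h⟩ := hl y
      exact ⟨s, hs, (EuclideanSpace.proj k : Space →L[ℝ] ℝ).integrable_comp h⟩
    have h2 := h1.integrable_smul_left_of_hasCompactSupport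
      (g := fun y => fderiv ℝ φ y (basisVec j))
      ((hφ.continuous_fderiv (by norm_num)).clm_apply continuous_const)
      (hc.fderiv_apply (𝕜 := ℝ) (basisVec j))
    exact h2.congr (Eventually.of_forall fun y => by simp [mul_comm])
  have hi2 : Integrable fun y => φ y * partialDeriv F j k y := by
    have h2 := (locallyIntegrable_partialDeriv hF hd j k).integrable_smul_left_of_hasCompactSupport
      hφ.continuous hc
    exact h2.congr (Eventually.of_forall fun y => by simp)
  have hae : divergence G =ᵐ[volume] fun y =>
      F y k * fderiv ℝ φ y (basisVec j) + φ y * partialDeriv F j k y := by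
    have : (Set.range x)ᶜ ∈ ae (volume : Measure Space) :=
      compl_mem_ae_iff.2 ((Set.finite_range x).measure_zero _)
    filter_upwards [this] with y hy using hdiv y hy
  have hlim : HasFreeChargeLim x G (∑ i : Fin n, (0 : Fin n → ℝ) i) := by
    refine hasFreeChargeLim_of_isBigO hx hG1 (fun i => ?_) ?_
    · have h1 : (fun y => φ y * F y k) =O[𝓝[≠] (x i)] fun _ => (1 : ℝ) := by
        have h2 : φ =O[𝓝[≠] (x i)] fun _ => (1 : ℝ) :=
          (hφ.continuous.continuousAt.mono_left nhdsWithin_le_nhds).isBigO_one ℝ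
        have h3 : (fun y => F y k) =O[𝓝[≠] (x i)] fun _ => (1 : ℝ) :=
          (Asymptotics.isBigO_of_le _ fun y => PiLp.norm_apply_le _ k).trans (hb i)
        simpa using h2.mul h3
      have h2 : (fun y => inner ℝ (y - x i) (basisVec j)) =O[𝓝[≠] (x i)] fun y => ‖y - x i‖ := by
        refine Asymptotics.IsBigO.of_bound ‖basisVec j‖ (Eventually.of_forall fun y => ?_)
        rw [mul_comm]
        simpa using norm_inner_le_norm (𝕜 := ℝ) (y - x i) (basisVec j)
      simpa [hG, inner_smul_right] using h1.mul h2
    · have h1 : (fun y => G y - coulombField x 0 y) =ᶠ[cocompact Space] fun _ => 0 := by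
        have : (tsupport φ)ᶜ ∈ cocompact Space := hc.isCompact.compl_mem_cocompact
        filter_upwards [this] with y hy
        simp [hG, coulombField_zero, image_eq_zero_of_notMem_tsupport hy]
      exact h1.trans_isLittleO (Asymptotics.isLittleO_zero _ _)
  have h0 := (hlim.hasFreeCharge ((hi1.add hi2).congr hae.symm)).2
  rw [integral_congr_ae hae, integral_add hi1 hi2] at h0
  simp at h0
  linarith

theorem curl_eq_sum (F : Space → Space) : curl F = fun y =>
    (partialDeriv F 1 2 y - partialDeriv F 2 1 y) • basisVec 0
    + (partialDeriv F 2 0 y - partialDeriv F 0 2 y) • basisVec 1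
    + (partialDeriv F 0 1 y - partialDeriv F 1 0 y) • basisVec 2 := by
  ext y k
  fin_cases k <;> simp [curl, basisVec]

theorem locallyIntegrable_curl {F : Space → Space}
    (hF : ContDiffOn ℝ 1 F (Set.range x)ᶜ)
    (hd : ∀ i, (fun y => fderiv ℝ F y) =O[𝓝[≠] (x i)] fun y => ‖y - x i‖⁻¹ ^ 2) :
    LocallyIntegrable (curl F) := by
  have h := fun j k => locallyIntegrable_partialDeriv hF hd j k
  have hs : ∀ (f : Space → ℝ) (m : Fin 3), LocallyIntegrable f →
      LocallyIntegrable fun y => f y • basisVec m := by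
    intro f m hf y
    obtain ⟨s, hs, h⟩ := hf y
    exact ⟨s, hs, h.smul_const _⟩
  rw [curl_eq_sum]
  exact ((hs _ 0 ((h 1 2).sub (h 2 1))).add (hs _ 1 ((h 2 0).sub (h 0 2)))).add
    (hs _ 2 ((h 0 1).sub (h 1 0)))

/-- The distributional curl of a field with bounded point singularities is its pointwise curl, if
the first derivatives are at most of the order of the inverse square of the distance. -/
theorem distCurl_toDist_eq_toDist_curl (hx : Function.Injective x) {F : Space → Space}
    (hF : ContDiffOn ℝ 1 F (Set.range x)ᶜ)
    (hb : ∀ i, F =O[𝓝[≠] (x i)] fun _ => (1 : ℝ))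
    (hd : ∀ i, (fun y => fderiv ℝ F y) =O[𝓝[≠] (x i)] fun y => ‖y - x i‖⁻¹ ^ 2)
    (hl : LocallyIntegrable F) : distCurl (toDist F) = toDist (curl F) := by
  have key : ∀ (j k : Fin 3) (φ : 𝓓((⊤ : TopologicalSpace.Opens Space), ℝ)),
      (∂_{basisVec j} (toDist F k)) φ = ∫ y, φ y * partialDeriv F j k y := by
    intro j k φ
    rw [lineDeriv_toDist_apply hl, integral_mul_fderiv_of_isBigO hx hF hb hd hl
      (φ.contDiff.of_le (by simp)) φ.hasCompactSupport, neg_neg]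
  have hi : ∀ (j k : Fin 3) (φ : 𝓓((⊤ : TopologicalSpace.Opens Space), ℝ)),
      Integrable fun y => φ y * partialDeriv F j k y := by
    intro j k φ
    have h2 := (locallyIntegrable_partialDeriv hF hd j k).integrable_smul_left_of_hasCompactSupport
      φ.contDiff.continuous φ.hasCompactSupport
    exact h2.congr (Eventually.of_forall fun y => by simp)
  ext k φ
  rw [toDist_apply (locallyIntegrable_curl hF hd)]
  have h2 : ∀ (a b c d : Fin 3), (∂_{basisVec a} (toDist F b) - ∂_{basisVec c} (toDist F d)) φ
      = ∫ y, φ y * (partialDeriv F a b y - partialDeriv F c d y) := by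
    intro a b c d
    have h3 : (∂_{basisVec a} (toDist F b) - ∂_{basisVec c} (toDist F d)) φ
      = (∂_{basisVec a} (toDist F b)) φ - (∂_{basisVec c} (toDist F d)) φ := rfl
    rw [h3, key, key, ← integral_sub (hi a b φ) (hi c d φ)]
    simp only [mul_sub]
  fin_cases k
  · exact h2 1 2 2 1
  · exact h2 2 0 0 2
  · exact h2 0 1 1 0

end

/-! ### Purely electric and purely magnetic fields -/

section

variable {n : ℕ} {x : Fin n → Space} {β κ : ℝ}

theorem one_add_mul_norm_sq_pos (hβ : 0 < β) (v : Space) : 0 < 1 + β * ‖v‖ ^ 2 := by positivity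

theorem norm_saturate_sq (hβ : 0 < β) (v : Space) :
    ‖saturate β v‖ ^ 2 = ‖v‖ ^ 2 / (1 + β * ‖v‖ ^ 2) := by
  have h := one_add_mul_norm_sq_pos hβ v
  rw [saturate, norm_smul, mul_pow, Real.norm_eq_abs, sq_abs, div_pow, Real.sq_sqrt h.le]
  ring

theorem norm_saturate_le (hβ : 0 < β) (v : Space) : ‖saturate β v‖ ≤ 1 / √β := by
  have h := one_add_mul_norm_sq_pos hβ v
  refine abs_le_of_sq_le_sq' ?_ (by positivity) |>.2
  rw [norm_saturate_sq hβ, div_pow, Real.sq_sqrt hβ.le, one_pow, div_le_div_iff₀ h hβ]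
  linarith

theorem one_sub_invariant_saturate (hβ : 0 < β) (v : Space) :
    1 - 2 * β * invariant κ (saturate β v) 0 = 1 / (1 + β * ‖v‖ ^ 2) := by
  have h := one_add_mul_norm_sq_pos hβ v
  rw [invariant, norm_saturate_sq hβ]
  simp
  field_simp
  ring

theorem one_sub_invariant_zero_left (v : Space) :
    1 - 2 * β * invariant κ 0 v = 1 + β * ‖v‖ ^ 2 := by
  simp [invariant]
  ring

theorem constitutive_saturate (hβ : 0 < β) (v : Space) :
    Constitutive β κ (saturate β v) 0 v 0 := by
  have h := one_add_mul_norm_sq_pos hβ v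
  have h' : √(1 + β * ‖v‖ ^ 2) ≠ 0 := (Real.sqrt_pos.2 h).ne'
  refine ⟨?_, ?_, by simp⟩
  · rw [one_sub_invariant_saturate hβ]; positivity
  · rw [one_sub_invariant_saturate hβ, saturate]
    simp [smul_smul, h']

theorem constitutive_zero_left (hβ : 0 < β) (v : Space) :
    Constitutive β κ 0 v 0 (saturate β v) := by
  refine ⟨?_, by simp, ?_⟩
  · rw [one_sub_invariant_zero_left]; exact one_add_mul_norm_sq_pos hβ v
  · rw [one_sub_invariant_zero_left, saturate]
    simp

theorem energyDensity_saturate (hβ : 0 < β) (v : Space) :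
    energyDensity β κ (saturate β v) 0 = (√(1 + β * ‖v‖ ^ 2) - 1) / β := by
  have h := one_add_mul_norm_sq_pos hβ v
  rw [energyDensity, one_sub_invariant_saturate hβ, norm_saturate_sq hβ, Real.sqrt_div (by simp)]
  have h1 : ‖v‖ ^ 2 = (√(1 + β * ‖v‖ ^ 2) ^ 2 - 1) / β := by
    rw [Real.sq_sqrt h.le]; field_simp; ring
  have h2 : 0 < √(1 + β * ‖v‖ ^ 2) := Real.sqrt_pos.2 h
  have h3 := Real.sq_sqrt h.le
  set w := √(1 + β * ‖v‖ ^ 2)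
  rw [← h3, h1]
  simp
  field_simp
  ring

theorem energyDensity_zero_left (v : Space) :
    energyDensity β κ 0 v = (√(1 + β * ‖v‖ ^ 2) - 1) / β := by
  rw [energyDensity, one_sub_invariant_zero_left]
  simp
  ring

theorem contDiff_saturate (hβ : 0 < β) : ContDiff ℝ ∞ (saturate β) := by
  have h : ContDiff ℝ ∞ fun v : Space => √(1 + β * ‖v‖ ^ 2) :=
    ContDiff.sqrt (contDiff_const.add (contDiff_const.mul (contDiff_norm_sq ℝ)))
      fun v => (one_add_mul_norm_sq_pos hβ v).ne'
  exact (contDiff_const.div h fun v =>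
    (Real.sqrt_pos.2 (one_add_mul_norm_sq_pos hβ v)).ne').smul contDiff_id

theorem hasFDerivAt_saturate (hβ : 0 < β) (v : Space) :
    HasFDerivAt (saturate β) ((1 / √(1 + β * ‖v‖ ^ 2)) • ContinuousLinearMap.id ℝ Space
      - (β * (1 / √(1 + β * ‖v‖ ^ 2)) ^ 3) • (innerSL ℝ v).smulRight v) v := by
  have h := one_add_mul_norm_sq_pos hβ v
  have h1 := (((hasStrictFDerivAt_norm_sq v).hasFDerivAt.const_mul β).const_add 1).sqrt h.ne'
  have h2 : 0 < √(1 + β * ‖v‖ ^ 2) := Real.sqrt_pos.2 h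
  have h3 := (hasDerivAt_inv h2.ne').comp_hasFDerivAt v h1
  have h4 : saturate β = fun v : Space => (√(1 + β * ‖v‖ ^ 2))⁻¹ • v := by
    ext1 v; rw [saturate, one_div]
  rw [h4]
  refine (h3.smul (hasFDerivAt_id v)).congr_fderiv ?_
  ext w k
  simp
  field_simp
  ring

theorem contDiffOn_saturate_coulombField (hβ : 0 < β) (q : Fin n → ℝ) :
    ContDiffOn ℝ ∞ (fun y => saturate β (coulombField x q y)) (Set.range x)ᶜ :=
  (contDiff_saturate hβ).comp_contDiffOn (contDiffOn_coulombField x q)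

theorem norm_fderiv_saturate_le (hβ : 0 < β) {F : Space → Space} {F' : Space →L[ℝ] Space}
    {y : Space} (h : HasFDerivAt F F' y) :
    ‖fderiv ℝ (fun y => saturate β (F y)) y‖ ≤ 2 * (1 / √(1 + β * ‖F y‖ ^ 2)) * ‖F'‖ := by
  have hp := one_add_mul_norm_sq_pos hβ (F y)
  have h1 : HasFDerivAt (fun y => saturate β (F y)) _ y := (hasFDerivAt_saturate hβ (F y)).comp y h
  have h2 : 0 < √(1 + β * ‖F y‖ ^ 2) := Real.sqrt_pos.2 hp
  have h3 := Real.sq_sqrt hp.le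
  rw [h1.fderiv]
  set a := 1 / √(1 + β * ‖F y‖ ^ 2) with ha
  have ha0 : 0 < a := by positivity
  refine (ContinuousLinearMap.opNorm_comp_le _ _).trans ?_
  refine mul_le_mul_of_nonneg_right ?_ (norm_nonneg _)
  refine (norm_sub_le _ _).trans ?_
  rw [norm_smul, norm_smul, ContinuousLinearMap.norm_smulRight_apply, innerSL_apply_norm,
    Real.norm_of_nonneg ha0.le, Real.norm_of_nonneg (by positivity)]
  have h4 : β * a ^ 3 * (‖F y‖ * ‖F y‖) ≤ a := by
    have h5 : a ^ 2 * (1 + β * ‖F y‖ ^ 2) = 1 := by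
      rw [ha, div_pow, h3]; field_simp
    have h6 : a * (a ^ 2 * (1 + β * ‖F y‖ ^ 2)) = a := by rw [h5, mul_one]
    nlinarith [pow_pos ha0 3]
  have h7 : a * ‖ContinuousLinearMap.id ℝ Space‖ ≤ a * 1 :=
    mul_le_mul_of_nonneg_left ContinuousLinearMap.norm_id_le ha0.le
  linarith

theorem inv_sqrt_isBigO (hβ : 0 < β) (hx : Function.Injective x) {q : Fin n → ℝ} {i : Fin n}
    (hq : q i ≠ 0) : (fun y => 1 / √(1 + β * ‖coulombField x q y‖ ^ 2)) =O[𝓝[≠] (x i)]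
      fun y => ‖y - x i‖ ^ 2 := by
  obtain ⟨c, hc, h⟩ := (inv_sq_isBigO_coulombField hx i hq).exists_pos
  refine Asymptotics.IsBigO.of_bound (c / √β) ?_
  filter_upwards [h.bound, self_mem_nhdsWithin] with y hy hyi
  have hr : 0 < ‖y - x i‖ := norm_pos_iff.2 (sub_ne_zero.2 hyi)
  have hβ' : 0 < √β := Real.sqrt_pos.2 hβ
  rw [Real.norm_of_nonneg (by positivity)] at hy
  have hD : 0 < ‖coulombField x q y‖ := by
    by_contra h0
    have : ‖coulombField x q y‖ = 0 := le_antisymm (not_lt.1 h0) (norm_nonneg _)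
    rw [this, mul_zero] at hy
    exact absurd hy (not_le.2 (by positivity))
  have h1 : √β * ‖coulombField x q y‖ ≤ √(1 + β * ‖coulombField x q y‖ ^ 2) := by
    refine Real.le_sqrt_of_sq_le ?_
    rw [mul_pow, Real.sq_sqrt hβ.le]
    linarith
  rw [Real.norm_of_nonneg (by positivity), Real.norm_of_nonneg (by positivity)]
  calc 1 / √(1 + β * ‖coulombField x q y‖ ^ 2) ≤ 1 / (√β * ‖coulombField x q y‖) := by gcongr
    _ ≤ c / √β * ‖y - x i‖ ^ 2 := by
      rw [inv_pow, inv_le_iff_one_le_mul₀ (by positivity)] at hy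
      rw [div_le_iff₀ (by positivity)]
      field_simp
      linarith

theorem fderiv_saturate_isBigO (hβ : 0 < β) (hx : Function.Injective x) {q : Fin n → ℝ} (i : Fin n)
    (hq : q i ≠ 0) :
    (fun y => fderiv ℝ (fun y => saturate β (coulombField x q y)) y) =O[𝓝[≠] (x i)]
      fun y => ‖y - x i‖⁻¹ ^ 2 := by
  have h1 := (inv_sqrt_isBigO hβ hx hq).mul (coulombDeriv_isBigO (q := q) hx i).norm_left
  have h2 : (fun y => fderiv ℝ (fun y => saturate β (coulombField x q y)) y) =O[𝓝[≠] (x i)]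
      fun y => 1 / √(1 + β * ‖coulombField x q y‖ ^ 2) * ‖coulombDeriv x q y‖ := by
    refine Asymptotics.IsBigO.of_bound 2 ?_
    filter_upwards [eventually_nhdsWithin_mem_compl hx i] with y hy
    rw [Real.norm_of_nonneg (by positivity), ← mul_assoc]
    exact norm_fderiv_saturate_le hβ (hasFDerivAt_coulombField hy)
  refine (h2.trans h1).trans ?_
  have h3 : (fun y => ‖y - x i‖ ^ 2 * ‖y - x i‖⁻¹ ^ 3) =ᶠ[𝓝[≠] (x i)] fun y => ‖y - x i‖⁻¹ ^ 1 := by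
    filter_upwards [self_mem_nhdsWithin] with y hy
    have hr : ‖y - x i‖ ≠ 0 := norm_ne_zero_iff.2 (sub_ne_zero.2 hy)
    field_simp
  refine h3.trans_isBigO ?_
  have h4 := (Asymptotics.isBigO_refl (fun y => ‖y - x i‖⁻¹) (𝓝[≠] (x i))).mul
    (one_isBigO_inv_pow (x i) 1)
  simpa [pow_two] using h4

theorem norm_saturate_isBigO_one (hβ : 0 < β) (F : Space → Space) (l : Filter Space) :
    (fun y => saturate β (F y)) =O[l] fun _ => (1 : ℝ) :=
  Asymptotics.IsBigO.of_bound (1 / √β) (Eventually.of_forall fun y => by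
    simpa using norm_saturate_le hβ (F y))

theorem sqrt_one_add_sub_one_isBigO (hβ : 0 < β) {F : Space → Space} {l : Filter Space} :
    (fun y => (√(1 + β * ‖F y‖ ^ 2) - 1) / β) =O[l] F := by
  refine Asymptotics.IsBigO.of_bound (√β / β) (Eventually.of_forall fun y => ?_)
  have h1 : 1 ≤ √(1 + β * ‖F y‖ ^ 2) := Real.one_le_sqrt.2 (by nlinarith [sq_nonneg ‖F y‖])
  rw [Real.norm_of_nonneg (div_nonneg (by linarith) hβ.le), div_mul_eq_mul_div]
  refine div_le_div_of_nonneg_right ?_ hβ.le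
  rw [sub_le_iff_le_add]
  refine Real.sqrt_le_iff.2 ⟨by positivity, ?_⟩
  have := Real.sq_sqrt hβ.le
  nlinarith [mul_nonneg (Real.sqrt_nonneg β) (norm_nonneg (F y))]

theorem sqrt_one_add_sub_one_isBigO_sq (hβ : 0 < β) {F : Space → Space} {l : Filter Space} :
    (fun y => (√(1 + β * ‖F y‖ ^ 2) - 1) / β) =O[l] fun y => ‖F y‖ ^ 2 := by
  refine Asymptotics.IsBigO.of_bound 1 (Eventually.of_forall fun y => ?_)
  have h1 : 1 ≤ √(1 + β * ‖F y‖ ^ 2) := Real.one_le_sqrt.2 (by nlinarith [sq_nonneg ‖F y‖])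
  rw [Real.norm_of_nonneg (div_nonneg (by linarith) hβ.le), Real.norm_of_nonneg (by positivity),
    one_mul, div_le_iff₀ hβ, sub_le_iff_le_add]
  refine Real.sqrt_le_iff.2 ⟨by positivity, ?_⟩
  nlinarith [sq_nonneg (‖F y‖ ^ 2 * β), mul_nonneg (sq_nonneg ‖F y‖) hβ.le]

theorem integrable_sqrt_one_add_coulombField (hβ : 0 < β) (hx : Function.Injective x)
    (q : Fin n → ℝ) : Integrable fun y => (√(1 + β * ‖coulombField x q y‖ ^ 2) - 1) / β := by
  refine integrable_of_isBigO (x := x) ?_ (fun i => ?_) ?_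
  · have := (contDiffOn_coulombField x q).continuousOn
    fun_prop
  · exact (sqrt_one_add_sub_one_isBigO hβ).trans (coulombField_isBigO hx i)
  · refine (sqrt_one_add_sub_one_isBigO_sq hβ).trans ?_
    have := (coulombField_isBigO_cocompact x q).norm_left.pow 2
    simpa [← pow_mul] using this

theorem inner_map_eq_sum (L : Space →L[ℝ] Space) (v w : Space) :
    inner ℝ w (L v) = ∑ k, inner ℝ w (L (basisVec k)) * v k := by
  have h : v = ∑ k, v k • basisVec k := by
    ext j
    fin_cases j <;> simp [Fin.sum_univ_three, basisVec]
  conv_lhs => rw [h]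
  simp [map_sum, inner_sum, inner_smul_right, mul_comm]

theorem divergence_saturate_coulombField (hβ : 0 < β) {q : Fin n → ℝ} {y : Space}
    (hy : y ∈ (Set.range x)ᶜ) :
    divergence (fun y => saturate β (coulombField x q y)) y =
      -(β * (1 / √(1 + β * ‖coulombField x q y‖ ^ 2)) ^ 3 *
        inner ℝ (coulombField x q y) (coulombDeriv x q y (coulombField x q y))) := by
  have h1 : HasFDerivAt (fun y => saturate β (coulombField x q y)) _ y :=
    (hasFDerivAt_saturate hβ _).comp y (hasFDerivAt_coulombField hy)
  have h2 := divergence_coulombField (q := q) hy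
  rw [divergence_eq_of_hasFDerivAt (hasFDerivAt_coulombField hy)] at h2
  rw [divergence_eq_of_hasFDerivAt h1]
  set D := coulombField x q y
  set a := 1 / √(1 + β * ‖D‖ ^ 2)
  have h3 : ∑ k, inner ℝ D (coulombDeriv x q y (basisVec k)) * D k
      = inner ℝ D (coulombDeriv x q y D) := by
    rw [inner_map_eq_sum]
  simp only [inner_basisVec] at h2
  simp only [ContinuousLinearMap.comp_apply, sub_apply, smul_apply,
    ContinuousLinearMap.smulRight_apply, innerSL_apply_apply, inner_sub_left, inner_smul_left,
    ContinuousLinearMap.id_apply, Finset.sum_sub_distrib, ← Finset.mul_sum, inner_basisVec]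
  simp [h2, ← h3]

/-- The saturated field is bounded near the charges and agrees with the Coulomb field to leading
order at infinity; its divergence is integrable at infinity because the Coulomb field is
divergence free and the correction to it is of third order in the field. -/
theorem hasFreeCharge_saturate (hβ : 0 < β) (hx : Function.Injective x) {q : Fin n → ℝ}
    (hq : ∀ i, q i ≠ 0) :
    HasFreeCharge (fun y => saturate β (coulombField x q y)) (∑ i, q i) := by
  have hC := contDiffOn_saturate_coulombField (x := x) hβ q
  refine (hasFreeChargeLim_of_isBigO hx (hC.of_le (by simp)) (fun i => ?_) ?_).hasFreeCharge ?_
  · refine Asymptotics.IsBigO.of_bound (1 / √β) (Eventually.of_forall fun y => ?_)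
    rw [norm_norm, mul_comm]
    refine (norm_inner_le_norm _ _).trans ?_
    gcongr
    exact norm_saturate_le hβ _
  · have h1 : Tendsto (fun y => 1 / √(1 + β * ‖coulombField x q y‖ ^ 2) - 1) (cocompact Space)
        (𝓝 0) := by
      have h2 := tendsto_coulombField_cocompact x q
      have h3 : Continuous fun v : Space => 1 / √(1 + β * ‖v‖ ^ 2) - 1 := by
        refine (continuous_const.div (by fun_prop) fun v => ?_).sub continuous_const
        exact (Real.sqrt_pos.2 (one_add_mul_norm_sq_pos hβ v)).ne'
      simpa [Function.comp_def] using (h3.tendsto 0).comp h2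
    have h4 := ((Asymptotics.isLittleO_one_iff ℝ).2 h1).smul_isBigO
      (coulombField_isBigO_cocompact x q)
    simpa [saturate, sub_smul] using h4
  · refine integrable_of_isBigO (x := x) (continuousOn_divergence (isOpen_compl_range x)
      (hC.of_le (by simp))) (fun i => ?_) ?_
    · exact Asymptotics.IsBigO.fun_sum fun k _ =>
        partialDeriv_isBigO (fderiv_saturate_isBigO hβ hx i (hq i)) k k
    · have h1 : divergence (fun y => saturate β (coulombField x q y)) =O[cocompact Space]
          fun y => ‖coulombField x q y‖ ^ 2 * ‖coulombDeriv x q y‖ := by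
        refine Asymptotics.IsBigO.of_bound β ?_
        have : (Set.range x)ᶜ ∈ cocompact Space := (Set.finite_range x).isCompact.compl_mem_cocompact
        filter_upwards [this] with y hy
        rw [divergence_saturate_coulombField hβ hy, norm_neg, norm_mul,
          Real.norm_of_nonneg (r := β * _ ^ 3) (by positivity),
          Real.norm_of_nonneg (r := ‖_‖ ^ 2 * _) (by positivity), mul_assoc]
        refine mul_le_mul_of_nonneg_left ?_ hβ.le
        have h2 : (1 / √(1 + β * ‖coulombField x q y‖ ^ 2)) ^ 3 ≤ 1 := by
          refine pow_le_one₀ (by positivity) ?_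
          rw [div_le_one (Real.sqrt_pos.2 (one_add_mul_norm_sq_pos hβ _))]
          exact Real.one_le_sqrt.2 (by nlinarith [sq_nonneg ‖coulombField x q y‖])
        have h3 : ‖inner ℝ (coulombField x q y) (coulombDeriv x q y (coulombField x q y))‖
            ≤ ‖coulombField x q y‖ ^ 2 * ‖coulombDeriv x q y‖ := by
          refine (norm_inner_le_norm _ _).trans ?_
          rw [pow_two, mul_assoc, mul_comm ‖coulombField x q y‖ ‖coulombDeriv x q y‖]
          gcongr
          exact ContinuousLinearMap.le_opNorm _ _
        exact (mul_le_of_le_one_left (norm_nonneg _) h2).trans h3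
      refine h1.trans ?_
      have h2 := ((coulombField_isBigO_cocompact x q).norm_left.pow 2).mul
        (coulombDeriv_isBigO_cocompact x q).norm_left
      refine h2.trans ?_
      have h3 := ((tendsto_inv_norm_cocompact.pow 3).isBigO_one ℝ).mul
        (Asymptotics.isBigO_refl (fun y : Space => ‖y‖⁻¹ ^ 4) (cocompact Space))
      simpa [← pow_mul, mul_comm] using h3

theorem locallyIntegrable_saturate (hβ : 0 < β) (q : Fin n → ℝ) :
    LocallyIntegrable fun y => saturate β (coulombField x q y) :=
  locallyIntegrable_of_isBigO (contDiffOn_saturate_coulombField hβ q).continuousOn fun i =>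
    (norm_saturate_isBigO_one hβ _ _).trans (one_isBigO_inv_pow (x i) 2)

theorem distCurl_saturate (hβ : 0 < β) (hx : Function.Injective x) {q : Fin n → ℝ}
    (hq : ∀ i, q i ≠ 0) :
    distCurl (toDist fun y => saturate β (coulombField x q y))
      = toDist (curl fun y => saturate β (coulombField x q y)) :=
  distCurl_toDist_eq_toDist_curl hx ((contDiffOn_saturate_coulombField hβ q).of_le (by simp))
    (fun _ => norm_saturate_isBigO_one hβ _ _) (fun i => fderiv_saturate_isBigO hβ hx i (hq i))
    (locallyIntegrable_saturate hβ q)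

theorem locallyIntegrable_curl_saturate (hβ : 0 < β) (hx : Function.Injective x) {q : Fin n → ℝ}
    (hq : ∀ i, q i ≠ 0) : LocallyIntegrable (curl fun y => saturate β (coulombField x q y)) :=
  locallyIntegrable_curl ((contDiffOn_saturate_coulombField hβ q).of_le (by simp))
    fun i => fderiv_saturate_isBigO hβ hx i (hq i)

theorem toDist_neg {F : Space → Space} (hF : LocallyIntegrable F) :
    toDist (fun y => -F y) = -toDist F := by
  ext k φ
  have h : (-toDist F) k φ = -(toDist F k φ) := rfl
  have hF' : LocallyIntegrable fun y => -F y := hF.neg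
  rw [h, toDist_apply hF, toDist_apply hF', ← integral_neg]
  simp

theorem isStaticSolution_electric (hβ : 0 < β) (hx : Function.Injective x) {q : Fin n → ℝ}
    (hq : ∀ i, q i ≠ 0) :
    IsStaticSolution β κ (Set.range x) (pointCharges x q) 0 0
      (toDist fun y => -curl (fun y => saturate β (coulombField x q y)) y)
      (fun y => saturate β (coulombField x q y)) 0 (coulombField x q) 0 where
  smooth_E := contDiffOn_saturate_coulombField hβ q
  smooth_B := contDiffOn_const
  smooth_D := contDiffOn_coulombField x q
  smooth_H := contDiffOn_const
  locInt_E := locallyIntegrable_saturate hβ q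
  locInt_B := locallyIntegrable_const 0
  locInt_D := locallyIntegrable_coulombField hx q
  locInt_H := locallyIntegrable_const 0
  constitutive := fun y _ => constitutive_saturate hβ _
  faraday := by
    rw [toDist_neg (locallyIntegrable_curl_saturate hβ hx hq), neg_neg, distCurl_saturate hβ hx hq]
  ampere := by rw [toDist_zero, distCurl_zero]
  coulomb := distDiv_coulombField hx q
  gauss := by rw [toDist_zero, distDiv_zero]

theorem isStaticSolution_magnetic (hβ : 0 < β) (hx : Function.Injective x) {g : Fin n → ℝ}
    (hg : ∀ i, g i ≠ 0) :
    IsStaticSolution β κ (Set.range x) 0 (pointCharges x g)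
      (toDist (curl fun y => saturate β (coulombField x g y))) 0 0 (coulombField x g) 0
      (fun y => saturate β (coulombField x g y)) where
  smooth_E := contDiffOn_const
  smooth_B := contDiffOn_coulombField x g
  smooth_D := contDiffOn_const
  smooth_H := contDiffOn_saturate_coulombField hβ g
  locInt_E := locallyIntegrable_const 0
  locInt_B := locallyIntegrable_coulombField hx g
  locInt_D := locallyIntegrable_const 0
  locInt_H := locallyIntegrable_saturate hβ g
  constitutive := fun y _ => constitutive_zero_left hβ _
  faraday := by rw [toDist_zero, distCurl_zero, neg_zero]
  ampere := distCurl_saturate hβ hx hg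
  coulomb := by rw [toDist_zero, distDiv_zero]
  gauss := distDiv_coulombField hx g

theorem finiteEnergy_electric (hβ : 0 < β) (hx : Function.Injective x) (q : Fin n → ℝ) :
    FiniteEnergy β κ (fun y => saturate β (coulombField x q y)) 0 := by
  have := integrable_sqrt_one_add_coulombField hβ hx q
  simpa only [FiniteEnergy, Pi.zero_apply, energyDensity_saturate hβ] using this

theorem finiteEnergy_magnetic (hβ : 0 < β) (hx : Function.Injective x) (q : Fin n → ℝ) :
    FiniteEnergy β κ 0 (coulombField x q) := by
  have := integrable_sqrt_one_add_coulombField hβ hx q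
  simpa only [FiniteEnergy, Pi.zero_apply, energyDensity_zero_left] using this

end

/-! ### Algebra of the dyonic constitutive relations -/

section

variable {β κ : ℝ}

theorem one_add_sq_mul_norm_sq_pos (κ : ℝ) (v : Space) : 0 < 1 + κ ^ 2 * ‖v‖ ^ 2 := by positivity

theorem dyonDet_eq (β κ : ℝ) (D B : Space) : dyonDet β κ D B = 1 + κ ^ 2 * ‖B‖ ^ 2
    + β * (‖D‖ ^ 2 + κ ^ 2 * (‖B‖ ^ 2 * ‖D‖ ^ 2 - (inner ℝ B D) ^ 2)) := by
  rw [dyonDet, norm_cross_sq]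
  ring

theorem dyonDet_pos (hβ : 0 < β) (κ : ℝ) (D B : Space) : 0 < dyonDet β κ D B := by
  rw [dyonDet]; positivity

/-- The scalar factor of `dyonE`. -/
def dyonCoeff (β κ : ℝ) (D B : Space) : ℝ :=
  √(1 + β * ‖B‖ ^ 2) / (√(1 + κ ^ 2 * ‖B‖ ^ 2) * √(dyonDet β κ D B))

theorem dyonE_eq (β κ : ℝ) (D B : Space) : dyonE β κ D B = dyonCoeff β κ D B •
    ((1 + κ ^ 2 * ‖B‖ ^ 2) • D - (κ ^ 2 * inner ℝ B D) • B) := rfl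

theorem dyonCoeff_pos (hβ : 0 < β) (κ : ℝ) (D B : Space) : 0 < dyonCoeff β κ D B := by
  have h1 := Real.sqrt_pos.2 (one_add_mul_norm_sq_pos hβ B)
  have h2 := Real.sqrt_pos.2 (one_add_sq_mul_norm_sq_pos κ B)
  have h3 := Real.sqrt_pos.2 (dyonDet_pos hβ κ D B)
  rw [dyonCoeff]
  positivity

theorem dyonCoeff_sq (hβ : 0 < β) (κ : ℝ) (D B : Space) : dyonCoeff β κ D B ^ 2 =
    (1 + β * ‖B‖ ^ 2) / ((1 + κ ^ 2 * ‖B‖ ^ 2) * dyonDet β κ D B) := by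
  rw [dyonCoeff, div_pow, mul_pow, Real.sq_sqrt (one_add_mul_norm_sq_pos hβ B).le,
    Real.sq_sqrt (one_add_sq_mul_norm_sq_pos κ B).le, Real.sq_sqrt (dyonDet_pos hβ κ D B).le]

theorem inner_dyonE_self_right (β κ : ℝ) (D B : Space) :
    inner ℝ (dyonE β κ D B) B = dyonCoeff β κ D B * inner ℝ B D := by
  rw [dyonE_eq, inner_smul_left, inner_sub_left, inner_smul_left, inner_smul_left,
    real_inner_comm B D, real_inner_self_eq_norm_sq]
  simp
  left
  ring

/-- The electric part of the invariant, `E² + κ² (E · B)²`, in terms of `D` and `B`. -/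
theorem norm_dyonE_sq_add (hβ : 0 < β) (κ : ℝ) (D B : Space) :
    ‖dyonE β κ D B‖ ^ 2 + κ ^ 2 * (inner ℝ (dyonE β κ D B) B) ^ 2 =
      (1 + β * ‖B‖ ^ 2) * (‖D‖ ^ 2 + κ ^ 2 * ‖cross B D‖ ^ 2) / dyonDet β κ D B := by
  have hu := one_add_sq_mul_norm_sq_pos κ B
  have hd := dyonDet_pos hβ κ D B
  have h : ‖(1 + κ ^ 2 * ‖B‖ ^ 2) • D - (κ ^ 2 * inner ℝ B D) • B‖ ^ 2 =
      (1 + κ ^ 2 * ‖B‖ ^ 2) ^ 2 * ‖D‖ ^ 2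
        - 2 * (1 + κ ^ 2 * ‖B‖ ^ 2) * κ ^ 2 * (inner ℝ B D) ^ 2
        + κ ^ 4 * (inner ℝ B D) ^ 2 * ‖B‖ ^ 2 := by
    rw [norm_sub_sq_real, norm_smul, norm_smul, inner_smul_left, inner_smul_right, mul_pow,
      mul_pow, Real.norm_eq_abs, Real.norm_eq_abs, sq_abs, sq_abs, real_inner_comm B D]
    simp
    ring
  rw [inner_dyonE_self_right, dyonE_eq, norm_smul, mul_pow, mul_pow, Real.norm_eq_abs, sq_abs,
    dyonCoeff_sq hβ, h, norm_cross_sq]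
  field_simp
  ring

theorem one_sub_invariant_dyonE (hβ : 0 < β) (κ : ℝ) (D B : Space) :
    1 - 2 * β * invariant κ (dyonE β κ D B) B =
      (1 + β * ‖B‖ ^ 2) * (1 + κ ^ 2 * ‖B‖ ^ 2) / dyonDet β κ D B := by
  have hd := dyonDet_pos hβ κ D B
  have h1 := norm_dyonE_sq_add hβ κ D B
  have h2 : 1 - 2 * β * invariant κ (dyonE β κ D B) B = 1 + β * ‖B‖ ^ 2 -
      β * (‖dyonE β κ D B‖ ^ 2 + κ ^ 2 * (inner ℝ (dyonE β κ D B) B) ^ 2) := by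
    rw [invariant]; ring
  rw [h2, h1, eq_div_iff hd.ne', sub_mul, ← mul_div_assoc, div_mul_cancel₀ _ hd.ne', dyonDet]
  ring

theorem sqrt_one_sub_invariant_dyonE (hβ : 0 < β) (κ : ℝ) (D B : Space) :
    √(1 - 2 * β * invariant κ (dyonE β κ D B) B) =
      √(1 + β * ‖B‖ ^ 2) * √(1 + κ ^ 2 * ‖B‖ ^ 2) / √(dyonDet β κ D B) := by
  have h1 := one_add_mul_norm_sq_pos hβ B
  have h2 := one_add_sq_mul_norm_sq_pos κ B
  rw [one_sub_invariant_dyonE hβ, Real.sqrt_div (by positivity), Real.sqrt_mul h1.le]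

/-- The field `H` in terms of `B` and `E`, a form easier to differentiate and estimate than the
definition. -/
theorem dyonH_eq (hβ : 0 < β) (κ : ℝ) (D B : Space) : dyonH β κ D B =
    (√(dyonDet β κ D B) / (√(1 + β * ‖B‖ ^ 2) * √(1 + κ ^ 2 * ‖B‖ ^ 2))) • B
      - (κ ^ 2 * inner ℝ B D / (1 + κ ^ 2 * ‖B‖ ^ 2)) • dyonE β κ D B := by
  have h1 := one_add_mul_norm_sq_pos hβ B
  have h2 := one_add_sq_mul_norm_sq_pos κ B
  have h3 := dyonDet_pos hβ κ D B
  have h4 := dyonDet_eq β κ D B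
  rw [dyonH, dyonE, dyonDenom, norm_cross_sq]
  set Δ := dyonDet β κ D B
  have e1 := Real.sq_sqrt h1.le
  have e2 := Real.sq_sqrt h2.le
  have e3 := Real.sq_sqrt h3.le
  have p1 := Real.sqrt_pos.2 h1
  have p2 := Real.sqrt_pos.2 h2
  have p3 := Real.sqrt_pos.2 h3
  set a := √(1 + β * ‖B‖ ^ 2)
  set b := √(1 + κ ^ 2 * ‖B‖ ^ 2)
  set e := √Δ
  rw [← e2, smul_sub, smul_sub, smul_smul, smul_smul, smul_smul, smul_smul]
  have hB : (1 + β * ‖D‖ ^ 2 + κ ^ 2 * (2 * ‖B‖ ^ 2 + 2 * β * (‖B‖ ^ 2 * ‖D‖ ^ 2 -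
      (inner ℝ B D) ^ 2) + β * (inner ℝ B D) ^ 2) + κ ^ 4 * ((inner ℝ B D) ^ 2 +
      (1 + β * ‖D‖ ^ 2) * ‖B‖ ^ 4)) / (a * b ^ 3 * e) =
      e / (a * b) + κ ^ 2 * inner ℝ B D / b ^ 2 * (a / (b * e) * (κ ^ 2 * inner ℝ B D)) := by
    field_simp
    rw [e1, e2, e3, h4]
    ring
  have hD : κ ^ 2 * (1 + β * ‖B‖ ^ 2) * b ^ 2 * inner ℝ B D / (a * b ^ 3 * e) =
      κ ^ 2 * inner ℝ B D / b ^ 2 * (a / (b * e) * b ^ 2) := by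
    field_simp
    rw [e1]
    ring
  rw [hB, hD]
  module

theorem constitutive_dyon (hβ : 0 < β) (κ : ℝ) (D B : Space) :
    Constitutive β κ (dyonE β κ D B) B D (dyonH β κ D B) := by
  have h1 := one_add_mul_norm_sq_pos hβ B
  have h2 := one_add_sq_mul_norm_sq_pos κ B
  have h3 := dyonDet_pos hβ κ D B
  have p1 := Real.sqrt_pos.2 h1
  have p2 := Real.sqrt_pos.2 h2
  have p3 := Real.sqrt_pos.2 h3
  have e2 := Real.sq_sqrt h2.le
  refine ⟨?_, ?_, ?_⟩
  · rw [one_sub_invariant_dyonE hβ]; positivity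
  · rw [sqrt_one_sub_invariant_dyonE hβ, inner_dyonE_self_right, dyonE_eq, dyonCoeff]
    set a := √(1 + β * ‖B‖ ^ 2)
    set b := √(1 + κ ^ 2 * ‖B‖ ^ 2)
    set e := √(dyonDet β κ D B)
    have h5 : (1 / (a * b / e)) • ((a / (b * e)) • ((1 + κ ^ 2 * ‖B‖ ^ 2) • D -
        (κ ^ 2 * inner ℝ B D) • B) + (κ ^ 2 * (a / (b * e) * inner ℝ B D)) • B)
        = ((1 / (a * b / e)) * (a / (b * e)) * (1 + κ ^ 2 * ‖B‖ ^ 2)) • D := by module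
    have h6 : (1 / (a * b / e)) * (a / (b * e)) * (1 + κ ^ 2 * ‖B‖ ^ 2) = 1 := by
      rw [← e2]; field_simp
    rw [h5, h6, one_smul]
  · rw [sqrt_one_sub_invariant_dyonE hβ, inner_dyonE_self_right, dyonH_eq hβ, dyonCoeff, smul_sub,
      smul_smul, one_div_div]
    congr 2
    set a := √(1 + β * ‖B‖ ^ 2)
    set b := √(1 + κ ^ 2 * ‖B‖ ^ 2)
    rw [div_eq_iff h2.ne', ← e2]
    field_simp

theorem energyDensity_dyon (hβ : 0 < β) (κ : ℝ) (D B : Space) :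
    energyDensity β κ (dyonE β κ D B) B = (√(1 + β * ‖B‖ ^ 2) *
      √(dyonDet β κ D B / (1 + κ ^ 2 * ‖B‖ ^ 2)) - 1) / β := by
  have h1 := one_add_mul_norm_sq_pos hβ B
  have h2 := one_add_sq_mul_norm_sq_pos κ B
  have h3 := dyonDet_pos hβ κ D B
  have p1 := Real.sqrt_pos.2 h1
  have p2 := Real.sqrt_pos.2 h2
  have p3 := Real.sqrt_pos.2 h3
  have e1 := Real.sq_sqrt h1.le
  have e2 := Real.sq_sqrt h2.le
  have e3 := Real.sq_sqrt h3.le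
  have h4 : ‖D‖ ^ 2 + κ ^ 2 * ‖cross B D‖ ^ 2 =
      (√(dyonDet β κ D B) ^ 2 - √(1 + κ ^ 2 * ‖B‖ ^ 2) ^ 2) / β := by
    rw [e2, e3, dyonDet]; field_simp; ring
  rw [energyDensity, norm_dyonE_sq_add hβ, sqrt_one_sub_invariant_dyonE hβ, h4, Real.sqrt_div h3.le]
  rw [← e1, ← e3, Real.sqrt_sq p3.le, Real.sqrt_sq p1.le]
  set a := √(1 + β * ‖B‖ ^ 2)
  set b := √(1 + κ ^ 2 * ‖B‖ ^ 2)
  set e := √(dyonDet β κ D B)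
  field_simp
  ring

theorem contDiff_norm_sq_add {f : Space × Space → Space} (hf : ContDiff ℝ ∞ f) (c : ℝ) :
    ContDiff ℝ ∞ fun z => 1 + c * ‖f z‖ ^ 2 :=
  contDiff_const.add (contDiff_const.mul (hf.norm_sq ℝ))

theorem contDiff_dyonDet (β κ : ℝ) :
    ContDiff ℝ ∞ fun z : Space × Space => dyonDet β κ z.1 z.2 := by
  simp only [dyonDet_eq]
  have h1 := (contDiff_fst (𝕜 := ℝ) (E := Space) (F := Space) (n := ∞)).norm_sq ℝ
  have h2 := (contDiff_snd (𝕜 := ℝ) (E := Space) (F := Space) (n := ∞)).norm_sq ℝ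
  have h3 : ContDiff ℝ ∞ fun z : Space × Space => inner ℝ z.2 z.1 :=
    contDiff_snd.inner ℝ contDiff_fst
  fun_prop

theorem contDiff_dyonCoeff (hβ : 0 < β) (κ : ℝ) :
    ContDiff ℝ ∞ fun z : Space × Space => dyonCoeff β κ z.1 z.2 := by
  unfold dyonCoeff
  refine ContDiff.div ((contDiff_norm_sq_add contDiff_snd β).sqrt fun z =>
    (one_add_mul_norm_sq_pos hβ _).ne') (((contDiff_norm_sq_add contDiff_snd _).sqrt fun z =>
    (one_add_sq_mul_norm_sq_pos κ _).ne').mul ((contDiff_dyonDet β κ).sqrt fun z =>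
    (dyonDet_pos hβ κ _ _).ne')) fun z => ?_
  have p2 := Real.sqrt_pos.2 (one_add_sq_mul_norm_sq_pos κ z.2)
  have p3 := Real.sqrt_pos.2 (dyonDet_pos hβ κ z.1 z.2)
  positivity

theorem contDiff_dyonE (hβ : 0 < β) (κ : ℝ) :
    ContDiff ℝ ∞ fun z : Space × Space => dyonE β κ z.1 z.2 := by
  simp only [dyonE_eq]
  have h3 : ContDiff ℝ ∞ fun z : Space × Space => inner ℝ z.2 z.1 :=
    contDiff_snd.inner ℝ contDiff_fst
  exact (contDiff_dyonCoeff hβ κ).smul (((contDiff_norm_sq_add contDiff_snd _).smul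
    contDiff_fst).sub ((contDiff_const.mul h3).smul contDiff_snd))

/-- The factor of `B` in the representation of `dyonH` in terms of `B` and `dyonE`. -/
def dyonFactor (β κ : ℝ) (D B : Space) : ℝ :=
  √(dyonDet β κ D B) / (√(1 + β * ‖B‖ ^ 2) * √(1 + κ ^ 2 * ‖B‖ ^ 2))

theorem contDiff_dyonFactor (hβ : 0 < β) (κ : ℝ) :
    ContDiff ℝ ∞ fun z : Space × Space => dyonFactor β κ z.1 z.2 := by
  unfold dyonFactor
  refine ((contDiff_dyonDet β κ).sqrt fun z => (dyonDet_pos hβ κ _ _).ne').div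
    (((contDiff_norm_sq_add contDiff_snd β).sqrt fun z => (one_add_mul_norm_sq_pos hβ _).ne').mul
    ((contDiff_norm_sq_add contDiff_snd _).sqrt fun z => (one_add_sq_mul_norm_sq_pos κ _).ne'))
    fun z => ?_
  have p1 := Real.sqrt_pos.2 (one_add_mul_norm_sq_pos hβ z.2)
  have p2 := Real.sqrt_pos.2 (one_add_sq_mul_norm_sq_pos κ z.2)
  positivity

theorem contDiff_inner_div (κ : ℝ) : ContDiff ℝ ∞ fun z : Space × Space =>
    κ ^ 2 * inner ℝ z.2 z.1 / (1 + κ ^ 2 * ‖z.2‖ ^ 2) := by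
  have h3 : ContDiff ℝ ∞ fun z : Space × Space => inner ℝ z.2 z.1 :=
    contDiff_snd.inner ℝ contDiff_fst
  exact (contDiff_const.mul h3).div (contDiff_norm_sq_add contDiff_snd _)
    fun z => (one_add_sq_mul_norm_sq_pos κ _).ne'

theorem contDiff_dyonH (hβ : 0 < β) (κ : ℝ) :
    ContDiff ℝ ∞ fun z : Space × Space => dyonH β κ z.1 z.2 := by
  simp only [dyonH_eq hβ]
  exact ((contDiff_dyonFactor hβ κ).smul contDiff_snd).sub
    ((contDiff_inner_div κ).smul (contDiff_dyonE hβ κ))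

theorem inner_cross_cross (a b c d : Space) : inner ℝ (cross a b) (cross c d) =
    inner ℝ a c * inner ℝ b d - inner ℝ a d * inner ℝ b c := by
  simp only [PiLp.inner_apply, Fin.sum_univ_three, cross, crossProduct]
  simp
  ring

/-- The field strength `E` grows at most like `B`, however large `D` is. -/
theorem norm_dyonE_le (hβ : 0 < β) (κ : ℝ) (D B : Space) :
    ‖dyonE β κ D B‖ ≤ 1 / √β + ‖B‖ := by
  have h1 := norm_dyonE_sq_add hβ κ D B
  have h3 := dyonDet_pos hβ κ D B
  have e := Real.sq_sqrt hβ.le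
  have p := Real.sqrt_pos.2 hβ
  have h2 : ‖dyonE β κ D B‖ ^ 2 ≤ (1 + β * ‖B‖ ^ 2) / β := by
    refine (le_add_of_nonneg_right (b := κ ^ 2 * (inner ℝ (dyonE β κ D B) B) ^ 2)
      (by positivity)).trans ?_
    rw [h1, div_le_div_iff₀ h3 hβ, mul_assoc]
    refine mul_le_mul_of_nonneg_left ?_ (by positivity)
    rw [dyonDet]
    nlinarith [mul_nonneg (sq_nonneg κ) (sq_nonneg ‖B‖)]
  refine (abs_le_of_sq_le_sq' (h2.trans ?_) (by positivity)).2
  rw [div_le_iff₀ hβ]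
  set t := √β
  have : (1 / t + ‖B‖) ^ 2 * t ^ 2 = (1 + t * ‖B‖) ^ 2 := by field_simp
  rw [← e, this]
  nlinarith [mul_nonneg p.le (norm_nonneg B)]

theorem dyonDet_le (hβ : 0 < β) (κ : ℝ) (D B : Space) :
    dyonDet β κ D B ≤ (1 + κ ^ 2 * ‖B‖ ^ 2) * (1 + β * ‖D‖ ^ 2) := by
  rw [dyonDet_eq]
  nlinarith [mul_nonneg (mul_nonneg hβ.le (sq_nonneg κ)) (sq_nonneg (inner ℝ B D : ℝ))]

theorem dyonFactor_mul_norm_le (hβ : 0 < β) (κ : ℝ) (D B : Space) :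
    dyonFactor β κ D B * ‖B‖ ≤ 1 / √β + ‖D‖ := by
  have h1 := one_add_mul_norm_sq_pos hβ B
  have h2 := one_add_sq_mul_norm_sq_pos κ B
  have h3 := dyonDet_pos hβ κ D B
  have p1 := Real.sqrt_pos.2 h1
  have p2 := Real.sqrt_pos.2 h2
  have e := Real.sq_sqrt hβ.le
  have p := Real.sqrt_pos.2 hβ
  have h4 : √(dyonDet β κ D B) ≤ √(1 + κ ^ 2 * ‖B‖ ^ 2) * (1 + √β * ‖D‖) := by
    refine Real.sqrt_le_iff.2 ⟨by positivity, (dyonDet_le hβ κ D B).trans ?_⟩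
    rw [mul_pow, Real.sq_sqrt h2.le]
    refine mul_le_mul_of_nonneg_left ?_ h2.le
    nlinarith [mul_nonneg p.le (norm_nonneg D)]
  have h5 : √β * ‖B‖ ≤ √(1 + β * ‖B‖ ^ 2) := by
    refine Real.le_sqrt_of_sq_le ?_
    rw [mul_pow, e]
    linarith
  have h6 : 1 / √β + ‖D‖ = (1 + √β * ‖D‖) / √β := by field_simp
  rw [dyonFactor, h6, div_mul_eq_mul_div, div_le_div_iff₀ (by positivity) p]
  calc √(dyonDet β κ D B) * ‖B‖ * √β = √(dyonDet β κ D B) * (√β * ‖B‖) := by ring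
    _ ≤ (√(1 + κ ^ 2 * ‖B‖ ^ 2) * (1 + √β * ‖D‖)) * √(1 + β * ‖B‖ ^ 2) := by gcongr
    _ = _ := by ring

theorem abs_inner_div_le (κ : ℝ) {C : ℝ} {D B : Space} (h : ‖D‖ ≤ C * ‖B‖) :
    |κ ^ 2 * inner ℝ B D / (1 + κ ^ 2 * ‖B‖ ^ 2)| ≤ |C| := by
  have h2 := one_add_sq_mul_norm_sq_pos κ B
  rw [abs_div, abs_of_pos h2, div_le_iff₀ h2, abs_mul, abs_of_nonneg (sq_nonneg κ)]
  have h3 := abs_real_inner_le_norm B D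
  have h4 : ‖B‖ * ‖D‖ ≤ ‖B‖ * (|C| * ‖B‖) := by
    gcongr
    exact h.trans (by gcongr; exact le_abs_self C)
  nlinarith [mul_le_mul_of_nonneg_left (h3.trans h4) (sq_nonneg κ), abs_nonneg C]

end

/-! ### Asymptotics of the dyonic fields -/

section

variable {n : ℕ} {x : Fin n → Space} {β κ : ℝ} {q g : Fin n → ℝ}

theorem norm_cross_le (a b : Space) : ‖cross a b‖ ≤ ‖a‖ * ‖b‖ := by
  refine (abs_le_of_sq_le_sq' ?_ (by positivity)).2
  rw [norm_cross_sq, mul_pow]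
  linarith [sq_nonneg (inner ℝ a b : ℝ)]

theorem cross_isBigO {l : Filter Space} {F G : Space → Space} {f g : Space → ℝ}
    (hF : F =O[l] f) (hG : G =O[l] g) :
    (fun y => cross (F y) (G y)) =O[l] fun y => f y * g y := by
  refine Asymptotics.IsBigO.trans ?_ (hF.norm_left.mul hG.norm_left)
  exact Asymptotics.IsBigO.of_bound 1 (Eventually.of_forall fun y => by
    simpa using norm_cross_le (F y) (G y))

theorem inner_isBigO {l : Filter Space} {F G : Space → Space} {f g : Space → ℝ}
    (hF : F =O[l] f) (hG : G =O[l] g) :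
    (fun y => inner ℝ (F y) (G y)) =O[l] fun y => f y * g y := by
  refine Asymptotics.IsBigO.trans ?_ (hF.norm_left.mul hG.norm_left)
  exact Asymptotics.IsBigO.of_bound 1 (Eventually.of_forall fun y => by
    simpa using abs_real_inner_le_norm (F y) (G y))

theorem pow_mul_inv_pow_eventuallyEq (c : Space) (k m : ℕ) :
    (fun y => ‖y - c‖ ^ k * ‖y - c‖⁻¹ ^ (k + m)) =ᶠ[𝓝[≠] c] fun y => ‖y - c‖⁻¹ ^ m := by
  filter_upwards [self_mem_nhdsWithin] with y hy
  have hr : ‖y - c‖ ≠ 0 := norm_ne_zero_iff.2 (sub_ne_zero.2 hy)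
  rw [pow_add, ← mul_assoc, ← mul_pow, mul_inv_cancel₀ hr, one_pow, one_mul]

theorem sub_isBigO (c : Space) (l : Filter Space) :
    (fun y : Space => y - c) =O[l] fun y => ‖y - c‖ :=
  (Asymptotics.isBigO_refl _ l).norm_right

theorem pow_add_mul_inv_pow_eventuallyEq (c : Space) (k m : ℕ) :
    (fun y => ‖y - c‖ ^ (k + m) * ‖y - c‖⁻¹ ^ k) =ᶠ[𝓝[≠] c] fun y => ‖y - c‖ ^ m := by
  filter_upwards [self_mem_nhdsWithin] with y hy
  have hr : ‖y - c‖ ≠ 0 := norm_ne_zero_iff.2 (sub_ne_zero.2 hy)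
  rw [pow_add, mul_right_comm, ← mul_pow, mul_inv_cancel₀ hr, one_pow, one_mul]

/-- The leading singularities of two Coulomb fields at a common charge are parallel, so that their
vector product is less singular than the product of their norms. -/
theorem cross_coulombField_isBigO (hx : Function.Injective x) (q g : Fin n → ℝ) (i : Fin n) :
    (fun y => cross (coulombField x g y) (coulombField x q y)) =O[𝓝[≠] (x i)]
      fun y => ‖y - x i‖⁻¹ ^ 2 := by
  have hk : (fun y => coulombKernel (y - x i)) =O[𝓝[≠] (x i)] fun y => ‖y - x i‖⁻¹ ^ 2 :=
    Asymptotics.IsBigO.of_bound 1 (Eventually.of_forall fun y => by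
      simpa using norm_coulombKernel_le (y - x i))
  have h1 := cross_isBigO (coulombField_isBigO (q := g) hx i) (coulombField_sub_isBigO (q := q) hx i)
  have h2 := (cross_isBigO (coulombField_sub_isBigO (q := g) hx i) hk).const_smul_left
    (q i / (4 * Real.pi))
  simp only [mul_one, one_mul] at h1 h2
  refine (h1.add h2).congr_left fun y => ?_
  set k := coulombKernel (y - x i)
  ext m
  fin_cases m <;> simp [cross, crossProduct] <;> ring

theorem cross_sub_coulombField_isBigO (hx : Function.Injective x) (q : Fin n → ℝ) (i : Fin n) :
    (fun y => cross (y - x i) (coulombField x q y)) =O[𝓝[≠] (x i)] fun y => ‖y - x i‖ := by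
  have h1 := cross_isBigO (sub_isBigO (x i) (𝓝[≠] (x i))) (coulombField_sub_isBigO (q := q) hx i)
  simp only [mul_one] at h1
  refine h1.congr_left fun y => ?_
  rw [coulombKernel]
  ext m
  fin_cases m <;> simp [cross, crossProduct] <;> ring

theorem inner_sub_coulombField_isBigO (hx : Function.Injective x) (q : Fin n → ℝ) (i : Fin n) :
    (fun y => inner ℝ (y - x i) (coulombField x q y)) =O[𝓝[≠] (x i)] fun y => ‖y - x i‖⁻¹ := by
  have h1 := inner_isBigO (sub_isBigO (x i) (𝓝[≠] (x i))) (coulombField_isBigO (q := q) hx i)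
  have h2 := pow_mul_inv_pow_eventuallyEq (x i) 1 1
  simp only [pow_one] at h2
  exact h1.trans h2.isBigO

theorem coulombField_isBigO_coulombField (hx : Function.Injective x) (i : Fin n) (hg : g i ≠ 0) :
    coulombField x q =O[𝓝[≠] (x i)] coulombField x g :=
  (coulombField_isBigO hx i).trans (inv_sq_isBigO_coulombField hx i hg)

theorem dyonDet_div_isBigO (hκ : κ ≠ 0) (hx : Function.Injective x) (i : Fin n)
    (hg : g i ≠ 0) :
    (fun y => dyonDet β κ (coulombField x q y) (coulombField x g y) /
      (1 + κ ^ 2 * ‖coulombField x g y‖ ^ 2)) =O[𝓝[≠] (x i)] fun _ => (1 : ℝ) := by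
  have h1 := (inv_sqrt_isBigO (by positivity : 0 < κ ^ 2) hx hg).pow 2
  have h2 := (coulombField_isBigO (q := q) hx i).norm_left.pow 2
  have h3 := ((cross_coulombField_isBigO hx q g i).norm_left.pow 2).const_mul_left (κ ^ 2)
  have h4 := (h1.mul (h2.add h3)).const_mul_left β
  have h5 : (fun y => (‖y - x i‖ ^ 2) ^ 2 * (‖y - x i‖⁻¹ ^ 2) ^ 2) =ᶠ[𝓝[≠] (x i)]
      fun _ => (1 : ℝ) := by
    simpa [← pow_mul] using pow_mul_inv_pow_eventuallyEq (x i) 4 0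
  refine ((Asymptotics.isBigO_refl (fun _ => (1 : ℝ)) _).add (h4.trans h5.isBigO)).congr_left
    fun y => ?_
  have h6 := one_add_sq_mul_norm_sq_pos κ (coulombField x g y)
  rw [div_pow, Real.sq_sqrt h6.le, dyonDet]
  field_simp
  ring

theorem norm_add_const_isBigO (hx : Function.Injective x) (q : Fin n → ℝ) (i : Fin n) (c : ℝ) :
    (fun y => c + ‖coulombField x q y‖) =O[𝓝[≠] (x i)] fun y => ‖y - x i‖⁻¹ ^ 2 := by
  have h := ((one_isBigO_inv_pow (x i) 2).const_mul_left c).add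
    (coulombField_isBigO (q := q) hx i).norm_left
  simpa using h

theorem dyonE_isBigO (hβ : 0 < β) (hx : Function.Injective x) (q g : Fin n → ℝ) (i : Fin n) :
    (fun y => dyonE β κ (coulombField x q y) (coulombField x g y)) =O[𝓝[≠] (x i)]
      fun y => ‖y - x i‖⁻¹ ^ 2 := by
  refine Asymptotics.IsBigO.trans ?_ (norm_add_const_isBigO hx g i (1 / √β))
  exact Asymptotics.IsBigO.of_bound 1 (Eventually.of_forall fun y => by
    rw [one_mul]
    exact (norm_dyonE_le hβ κ _ _).trans (le_abs_self _))

theorem inner_div_isBigO (hx : Function.Injective x) (q : Fin n → ℝ) (i : Fin n) (hg : g i ≠ 0) :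
    (fun y => κ ^ 2 * inner ℝ (coulombField x g y) (coulombField x q y) /
      (1 + κ ^ 2 * ‖coulombField x g y‖ ^ 2)) =O[𝓝[≠] (x i)] fun _ => (1 : ℝ) := by
  obtain ⟨C, hC⟩ := (coulombField_isBigO_coulombField (q := q) hx i hg).bound
  refine Asymptotics.IsBigO.of_bound |C| ?_
  filter_upwards [hC] with y hy
  rw [norm_one, mul_one]
  exact abs_inner_div_le κ hy

theorem dyonFactor_smul_isBigO (hβ : 0 < β) (hx : Function.Injective x) (q g : Fin n → ℝ)
    (i : Fin n) :
    (fun y => dyonFactor β κ (coulombField x q y) (coulombField x g y) • coulombField x g y)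
      =O[𝓝[≠] (x i)] fun y => ‖y - x i‖⁻¹ ^ 2 := by
  refine Asymptotics.IsBigO.trans ?_ (norm_add_const_isBigO hx q i (1 / √β))
  refine Asymptotics.IsBigO.of_bound 1 (Eventually.of_forall fun y => ?_)
  rw [one_mul, norm_smul, Real.norm_of_nonneg (by rw [dyonFactor]; positivity)]
  exact (dyonFactor_mul_norm_le hβ κ _ _).trans (le_abs_self _)

theorem dyonH_isBigO (hβ : 0 < β) (hx : Function.Injective x) (q : Fin n → ℝ) (i : Fin n)
    (hg : g i ≠ 0) :
    (fun y => dyonH β κ (coulombField x q y) (coulombField x g y)) =O[𝓝[≠] (x i)]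
      fun y => ‖y - x i‖⁻¹ ^ 2 := by
  have h1 := dyonFactor_smul_isBigO (κ := κ) hβ hx q g i
  have h2 := (inner_div_isBigO (κ := κ) hx q i hg).smul (dyonE_isBigO (κ := κ) hβ hx q g i)
  simp only [smul_eq_mul, one_mul] at h2
  exact (h1.sub h2).congr_left fun y => (dyonH_eq hβ κ _ _).symm

theorem contDiffOn_prod_coulombField (x : Fin n → Space) (q g : Fin n → ℝ) :
    ContDiffOn ℝ ∞ (fun y => (coulombField x q y, coulombField x g y)) (Set.range x)ᶜ :=
  (contDiffOn_coulombField x q).prodMk (contDiffOn_coulombField x g)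

theorem contDiffOn_dyonE (hβ : 0 < β) (κ : ℝ) (x : Fin n → Space) (q g : Fin n → ℝ) :
    ContDiffOn ℝ ∞ (fun y => dyonE β κ (coulombField x q y) (coulombField x g y))
      (Set.range x)ᶜ :=
  ContDiff.comp_contDiffOn (g := fun z : Space × Space => dyonE β κ z.1 z.2)
    (f := fun y => (coulombField x q y, coulombField x g y)) (contDiff_dyonE hβ κ)
    (contDiffOn_prod_coulombField x q g)

theorem contDiffOn_dyonH (hβ : 0 < β) (κ : ℝ) (x : Fin n → Space) (q g : Fin n → ℝ) :
    ContDiffOn ℝ ∞ (fun y => dyonH β κ (coulombField x q y) (coulombField x g y))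
      (Set.range x)ᶜ :=
  ContDiff.comp_contDiffOn (g := fun z : Space × Space => dyonH β κ z.1 z.2)
    (f := fun y => (coulombField x q y, coulombField x g y)) (contDiff_dyonH hβ κ)
    (contDiffOn_prod_coulombField x q g)

theorem locallyIntegrable_dyonE (hβ : 0 < β) (hx : Function.Injective x) (q g : Fin n → ℝ) :
    LocallyIntegrable fun y => dyonE β κ (coulombField x q y) (coulombField x g y) :=
  locallyIntegrable_of_isBigO (contDiffOn_dyonE hβ κ x q g).continuousOn
    fun i => dyonE_isBigO hβ hx q g i

theorem locallyIntegrable_dyonH (hβ : 0 < β) (hx : Function.Injective x) (q : Fin n → ℝ)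
    (hg : ∀ i, g i ≠ 0) :
    LocallyIntegrable fun y => dyonH β κ (coulombField x q y) (coulombField x g y) :=
  locallyIntegrable_of_isBigO (contDiffOn_dyonH hβ κ x q g).continuousOn
    fun i => dyonH_isBigO hβ hx q i (hg i)

/-- The dyonic fields solve the static equations, with the currents defined by their curls. -/
theorem isStaticSolution_dyon (hβ : 0 < β) (hx : Function.Injective x) (q : Fin n → ℝ)
    (hg : ∀ i, g i ≠ 0) :
    IsStaticSolution β κ (Set.range x) (pointCharges x q) (pointCharges x g)
      (distCurl (toDist fun y => dyonH β κ (coulombField x q y) (coulombField x g y)))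
      (-distCurl (toDist fun y => dyonE β κ (coulombField x q y) (coulombField x g y)))
      (fun y => dyonE β κ (coulombField x q y) (coulombField x g y)) (coulombField x g)
      (coulombField x q) (fun y => dyonH β κ (coulombField x q y) (coulombField x g y)) where
  smooth_E := contDiffOn_dyonE hβ κ x q g
  smooth_B := contDiffOn_coulombField x g
  smooth_D := contDiffOn_coulombField x q
  smooth_H := contDiffOn_dyonH hβ κ x q g
  locInt_E := locallyIntegrable_dyonE hβ hx q g
  locInt_B := locallyIntegrable_coulombField hx g
  locInt_D := locallyIntegrable_coulombField hx q
  locInt_H := locallyIntegrable_dyonH hβ hx q hg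
  constitutive := fun _ _ => constitutive_dyon hβ κ _ _
  faraday := (neg_neg _).symm
  ampere := rfl
  coulomb := distDiv_coulombField hx q
  gauss := distDiv_coulombField hx g

theorem one_le_dyonDet_div (hβ : 0 < β) (κ : ℝ) (D B : Space) :
    1 ≤ dyonDet β κ D B / (1 + κ ^ 2 * ‖B‖ ^ 2) := by
  have h2 := one_add_sq_mul_norm_sq_pos κ B
  rw [le_div_iff₀ h2, dyonDet]
  have h3 : 0 ≤ β * ‖D‖ ^ 2 := by positivity
  have h4 : 0 ≤ β * κ ^ 2 * ‖cross B D‖ ^ 2 := by positivity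
  linarith

/-- For `κ ≠ 0` the factor `Δ / (1 + κ² B²)` stays bounded at the charges, because `B` and `D` are
parallel there to leading order. So the energy density grows only like `|B|`, an integrable
singularity. -/
theorem finiteEnergy_dyon (hβ : 0 < β) (hκ : κ ≠ 0) (hx : Function.Injective x) (q : Fin n → ℝ)
    (hg : ∀ i, g i ≠ 0) :
    FiniteEnergy β κ (fun y => dyonE β κ (coulombField x q y) (coulombField x g y))
      (coulombField x g) := by
  simp only [FiniteEnergy, energyDensity_dyon hβ]
  refine integrable_of_isBigO (x := x) ?_ (fun i => ?_) ?_
  · have hc : Continuous fun z : Space × Space => (√(1 + β * ‖z.2‖ ^ 2) *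
        √(dyonDet β κ z.1 z.2 / (1 + κ ^ 2 * ‖z.2‖ ^ 2)) - 1) / β := by
      have h1 := (contDiff_dyonDet β κ).continuous
      have h2 : Continuous fun z : Space × Space =>
          dyonDet β κ z.1 z.2 / (1 + κ ^ 2 * ‖z.2‖ ^ 2) :=
        h1.div (by fun_prop) fun z => (one_add_sq_mul_norm_sq_pos κ z.2).ne'
      fun_prop
    have hp : ContinuousOn (fun y => (coulombField x q y, coulombField x g y)) (Set.range x)ᶜ :=
      (contDiffOn_prod_coulombField x q g).continuousOn
    have := hc.comp_continuousOn hp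
    simpa only [Function.comp_def] using this
  · have h1 : (fun y => √(1 + β * ‖coulombField x g y‖ ^ 2)) =O[𝓝[≠] (x i)]
        fun y => ‖y - x i‖⁻¹ ^ 2 := by
      have h2 := (sqrt_one_add_sub_one_isBigO (F := coulombField x g) (l := 𝓝[≠] (x i)) hβ).trans
        (coulombField_isBigO hx i)
      have h3 := (h2.const_mul_left β).add (one_isBigO_inv_pow (x i) 2)
      refine h3.congr_left fun y => ?_
      field_simp
      ring
    have h4 : (fun y => √(dyonDet β κ (coulombField x q y) (coulombField x g y) /
        (1 + κ ^ 2 * ‖coulombField x g y‖ ^ 2))) =O[𝓝[≠] (x i)] fun _ => (1 : ℝ) := by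
      obtain ⟨C, hC⟩ := (dyonDet_div_isBigO (β := β) (q := q) hκ hx i (hg i)).bound
      refine Asymptotics.IsBigO.of_bound √C ?_
      filter_upwards [hC] with y hy
      rw [Real.norm_of_nonneg (Real.sqrt_nonneg _)]
      simp only [norm_one, mul_one] at hy ⊢
      exact Real.sqrt_le_sqrt ((le_abs_self _).trans hy)
    have h5 := ((h1.mul h4).sub (by
      simpa using one_isBigO_inv_pow (x i) 2 :
        (fun _ : Space => (1 : ℝ)) =O[𝓝[≠] (x i)] fun y => ‖y - x i‖⁻¹ ^ 2 * 1)).const_mul_left β⁻¹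
    simp only [mul_one] at h5
    exact h5.congr_left fun y => (div_eq_inv_mul _ _).symm
  · have hB := (coulombField_isBigO_cocompact x g).norm_left.pow 2
    have hD := (coulombField_isBigO_cocompact x q).norm_left.pow 2
    have hB0 := (tendsto_coulombField_cocompact x g).norm.pow 2
    have h1 : (fun y => β * ‖coulombField x g y‖ ^ 2 + (1 + β * ‖coulombField x g y‖ ^ 2) *
        (1 + κ ^ 2 * ‖coulombField x g y‖ ^ 2) * (β * ‖coulombField x q y‖ ^ 2))
        =O[cocompact Space] fun y => ‖y‖⁻¹ ^ 4 := by
      have h2 := (((hB0.const_mul β).const_add 1).mul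
        ((hB0.const_mul (κ ^ 2)).const_add 1)).isBigO_one ℝ
      have h3 := (hB.const_mul_left β).add ((h2.mul (hD.const_mul_left β)).congr_right
        fun y => one_mul _)
      simpa [← pow_mul] using h3
    refine Asymptotics.IsBigO.trans ?_ h1
    refine Asymptotics.IsBigO.of_bound β⁻¹ (Eventually.of_forall fun y => ?_)
    set B := coulombField x g y
    set D := coulombField x q y
    have hu := one_add_sq_mul_norm_sq_pos κ B
    have hK1 := one_le_dyonDet_div hβ κ D B
    have hq1 : 1 ≤ 1 + β * ‖B‖ ^ 2 := le_add_of_nonneg_right (by positivity)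
    have hK2 : dyonDet β κ D B / (1 + κ ^ 2 * ‖B‖ ^ 2) ≤
        1 + (1 + κ ^ 2 * ‖B‖ ^ 2) * (β * ‖D‖ ^ 2) := by
      rw [div_le_iff₀ hu]
      refine (dyonDet_le hβ κ D B).trans ?_
      have : 0 ≤ κ ^ 2 * ‖B‖ ^ 2 := by positivity
      have h4 : 0 ≤ β * ‖D‖ ^ 2 := by positivity
      nlinarith [mul_nonneg (mul_nonneg hu.le h4) this]
    set K := dyonDet β κ D B / (1 + κ ^ 2 * ‖B‖ ^ 2)
    have hP : 1 ≤ (1 + β * ‖B‖ ^ 2) * K := one_le_mul_of_one_le_of_one_le hq1 hK1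
    rw [← Real.sqrt_mul (by linarith), Real.norm_of_nonneg (r := _ / β)
      (div_nonneg (by linarith [Real.one_le_sqrt.2 hP]) hβ.le),
      Real.norm_of_nonneg (by positivity), div_eq_inv_mul]
    refine mul_le_mul_of_nonneg_left ?_ (by positivity)
    have h5 : √((1 + β * ‖B‖ ^ 2) * K) ≤ (1 + β * ‖B‖ ^ 2) * K :=
      Real.sqrt_le_iff.2 ⟨by linarith, by nlinarith⟩
    nlinarith [mul_le_mul_of_nonneg_left hK2 (by linarith : (0 : ℝ) ≤ 1 + β * ‖B‖ ^ 2)]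

/-- For `κ = 0` the energy density grows like `|B| |D|` at a charge, that is, like the inverse
fourth power of the distance, which is not integrable. -/
theorem not_finiteEnergy_dyon (hβ : 0 < β) (hx : Function.Injective x) {i : Fin n} (hq : q i ≠ 0)
    (hg : g i ≠ 0) :
    ¬ FiniteEnergy β 0 (fun y => dyonE β 0 (coulombField x q y) (coulombField x g y))
      (coulombField x g) := by
  simp only [FiniteEnergy, energyDensity_dyon hβ]
  intro h
  -- Without the quartic term the energy density is bounded below by `|B| |D|`, up to a constant.
  have h1 := ((inv_sq_isBigO_coulombField hx i hg).norm_right).mul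
    (inv_sq_isBigO_coulombField hx i hq).norm_right
  obtain ⟨C, hC0, hC⟩ := h1.exists_pos
  obtain ⟨ε, hε, hball⟩ := Metric.mem_nhdsWithin_iff.1 hC.bound
  refine not_integrableOn_ball_inv_norm_sub_pow_four (x i) hε ?_
  have hi : IntegrableOn (fun y => C * ((√(1 + β * ‖coulombField x g y‖ ^ 2) *
      √(dyonDet β 0 (coulombField x q y) (coulombField x g y) /
        (1 + 0 ^ 2 * ‖coulombField x g y‖ ^ 2)) - 1) / β + 1 / β)) (Metric.ball (x i) ε) :=
    (h.integrableOn.add (integrableOn_const (measure_ball_lt_top.ne))).const_mul C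
  refine hi.mono' ?_ ?_
  · have : Measurable fun y : Space => ‖y - x i‖⁻¹ ^ 4 := by fun_prop
    exact this.aestronglyMeasurable
  · have h0 : ∀ᵐ y ∂(volume.restrict (Metric.ball (x i) ε)), y ≠ x i :=
      ae_restrict_of_ae (Measure.ae_ne volume (x i))
    filter_upwards [h0, ae_restrict_mem Metric.isOpen_ball.measurableSet] with y hy hyb
    have h2 := hball ⟨hyb, hy⟩
    simp only [Set.mem_ofPred_eq, norm_mul, norm_pow, norm_inv, norm_norm] at h2
    rw [Real.norm_of_nonneg (by positivity)]
    calc ‖y - x i‖⁻¹ ^ 4 = ‖y - x i‖⁻¹ ^ 2 * ‖y - x i‖⁻¹ ^ 2 := by ring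
      _ ≤ _ := h2
      _ ≤ _ := by
        refine mul_le_mul_of_nonneg_left ?_ hC0.le
        set B := coulombField x g y
        set D := coulombField x q y
        have h3 : dyonDet β 0 D B / (1 + 0 ^ 2 * ‖B‖ ^ 2) = 1 + β * ‖D‖ ^ 2 := by
          simp [dyonDet]
        have hle : ∀ v : Space, √β * ‖v‖ ≤ √(1 + β * ‖v‖ ^ 2) := fun v => by
          refine Real.le_sqrt_of_sq_le ?_
          rw [mul_pow, Real.sq_sqrt hβ.le]
          linarith
        rw [h3, ← add_div, sub_add_cancel, le_div_iff₀ hβ]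
        calc ‖B‖ * ‖D‖ * β = (√β * ‖B‖) * (√β * ‖D‖) := by
              rw [mul_mul_mul_comm, Real.mul_self_sqrt hβ.le]; ring
          _ ≤ _ := mul_le_mul (hle B) (hle D) (by positivity) (by positivity)

/-- The field `E` is a positive multiple of `D + κ² (B × D) × B`. The multiple is of the order of
the squared distance to the charge, and the radial part of the second term is small because the
leading part of `B` is radial. So the flux of `E` through small spheres tends to zero. -/
theorem inner_sub_dyonE_isBigO (hβ : 0 < β) (hκ : κ ≠ 0) (hx : Function.Injective x) (i : Fin n)
    (hq : q i ≠ 0) :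
    (fun y => inner ℝ (y - x i) (dyonE β κ (coulombField x q y) (coulombField x g y)))
      =O[𝓝[≠] (x i)] fun y => ‖y - x i‖ := by
  have h1 := inner_isBigO (cross_sub_coulombField_isBigO hx g i) (cross_coulombField_isBigO hx g q i)
  have e1 := pow_mul_inv_pow_eventuallyEq (x i) 1 1
  simp only [pow_one] at e1
  have h2 := (inner_sub_coulombField_isBigO hx q i).add
    ((h1.trans e1.isBigO).const_mul_left (κ ^ 2))
  have h3 : (fun y => dyonCoeff β κ (coulombField x q y) (coulombField x g y)) =O[𝓝[≠] (x i)]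
      fun y => ‖y - x i‖ ^ 2 := by
    refine Asymptotics.IsBigO.trans ?_ (inv_sqrt_isBigO hβ hx hq)
    refine Asymptotics.IsBigO.of_bound √(1 + β / κ ^ 2) (Eventually.of_forall fun y => ?_)
    set B := coulombField x g y
    set D := coulombField x q y
    have p2 := Real.sqrt_pos.2 (one_add_sq_mul_norm_sq_pos κ B)
    have p3 := Real.sqrt_pos.2 (one_add_mul_norm_sq_pos hβ D)
    have hk : 0 < κ ^ 2 := by positivity
    rw [Real.norm_of_nonneg (dyonCoeff_pos hβ κ D B).le, Real.norm_of_nonneg (by positivity),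
      dyonCoeff, ← div_div, div_eq_mul_one_div _ √(dyonDet β κ D B)]
    refine mul_le_mul ?_ ?_ (by positivity) (by positivity)
    · rw [div_le_iff₀ p2, ← Real.sqrt_mul (by positivity)]
      refine Real.sqrt_le_sqrt ?_
      have : (1 + β / κ ^ 2) * (1 + κ ^ 2 * ‖B‖ ^ 2)
        = 1 + β * ‖B‖ ^ 2 + (κ ^ 2 * ‖B‖ ^ 2 + β / κ ^ 2) := by field_simp; ring
      rw [this]
      exact le_add_of_nonneg_right (by positivity)
    · refine one_div_le_one_div_of_le p3 (Real.sqrt_le_sqrt ?_)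
      rw [dyonDet, add_assoc, add_assoc, ← add_assoc 1]
      exact le_add_of_nonneg_right (by positivity)
  have h4 := h3.mul h2
  have e2 := pow_add_mul_inv_pow_eventuallyEq (x i) 1 1
  simp only [pow_one] at e2
  refine (h4.trans e2.isBigO).congr_left fun y => ?_
  rw [dyonE_eq, inner_smul_right, inner_sub_right, inner_smul_right, inner_smul_right,
    inner_cross_cross, real_inner_self_eq_norm_sq]
  ring

theorem inner_sub_dyonH_isBigO (hβ : 0 < β) (hκ : κ ≠ 0) (hx : Function.Injective x) (i : Fin n)
    (hq : q i ≠ 0) (hg : g i ≠ 0) :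
    (fun y => inner ℝ (y - x i) (dyonH β κ (coulombField x q y) (coulombField x g y)))
      =O[𝓝[≠] (x i)] fun y => ‖y - x i‖ := by
  have h1 := (inner_div_isBigO (κ := κ) hx q i hg).mul
    (inner_sub_dyonE_isBigO (g := g) hβ hκ hx i hq)
  simp only [one_mul] at h1
  have h2 : (fun y => dyonFactor β κ (coulombField x q y) (coulombField x g y)) =O[𝓝[≠] (x i)]
      fun y => ‖y - x i‖ ^ 2 := by
    refine Asymptotics.IsBigO.trans ?_ (inv_sqrt_isBigO hβ hx hg)
    obtain ⟨C, hC⟩ := (dyonDet_div_isBigO (β := β) (q := q) hκ hx i hg).bound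
    refine Asymptotics.IsBigO.of_bound √C ?_
    filter_upwards [hC] with y hy
    have p1 := Real.sqrt_pos.2 (one_add_mul_norm_sq_pos hβ (coulombField x g y))
    have p2 := Real.sqrt_pos.2 (one_add_sq_mul_norm_sq_pos κ (coulombField x g y))
    rw [Real.norm_of_nonneg (by rw [dyonFactor]; positivity), Real.norm_of_nonneg (by positivity),
      dyonFactor, mul_comm √(1 + β * _), ← div_div, div_eq_mul_one_div _ √(1 + β * _),
      ← Real.sqrt_div (dyonDet_pos hβ κ _ _).le]
    gcongr
    simpa using (le_abs_self _).trans hy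
  have h3 := h2.mul (inner_sub_coulombField_isBigO hx g i)
  have e2 := pow_add_mul_inv_pow_eventuallyEq (x i) 1 1
  simp only [pow_one] at e2
  refine ((h3.trans e2.isBigO).sub h1).congr_left fun y => ?_
  rw [dyonH_eq hβ, inner_sub_right, inner_smul_right, inner_smul_right]
  rfl

theorem tendsto_comp_coulombField {f : Space × Space → ℝ} (hf : Continuous f) (x : Fin n → Space)
    (q g : Fin n → ℝ) : Tendsto (fun y => f (coulombField x q y, coulombField x g y))
      (cocompact Space) (𝓝 (f (0, 0))) :=
  (hf.tendsto (0, 0)).comp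
    ((tendsto_coulombField_cocompact x q).prodMk_nhds (tendsto_coulombField_cocompact x g))

theorem dyonE_sub_isLittleO (hβ : 0 < β) (κ : ℝ) (x : Fin n → Space) (q g : Fin n → ℝ) :
    (fun y => dyonE β κ (coulombField x q y) (coulombField x g y) - coulombField x q y)
      =o[cocompact Space] fun y => ‖y‖⁻¹ ^ 2 := by
  have hc := (contDiff_dyonCoeff hβ κ).continuous
  have h1 := tendsto_comp_coulombField (f := fun z => dyonCoeff β κ z.1 z.2 *
    (1 + κ ^ 2 * ‖z.2‖ ^ 2) - 1) (by fun_prop) x q g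
  have h2 := tendsto_comp_coulombField (f := fun z => dyonCoeff β κ z.1 z.2 *
    (κ ^ 2 * inner ℝ z.2 z.1)) (by fun_prop) x q g
  have h0 : dyonCoeff β κ 0 0 = 1 := by simp [dyonCoeff, dyonDet_eq]
  simp only [h0] at h1 h2
  norm_num at h1 h2
  have h3 := (((Asymptotics.isLittleO_one_iff ℝ).2 h1).smul_isBigO
      (coulombField_isBigO_cocompact x q)).sub
    (((Asymptotics.isLittleO_one_iff ℝ).2 h2).smul_isBigO (coulombField_isBigO_cocompact x g))
  simp only [smul_eq_mul, one_mul] at h3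
  refine h3.congr_left fun y => ?_
  rw [dyonE_eq]
  module

theorem dyonH_sub_isLittleO (hβ : 0 < β) (κ : ℝ) (x : Fin n → Space) (q g : Fin n → ℝ) :
    (fun y => dyonH β κ (coulombField x q y) (coulombField x g y) - coulombField x g y)
      =o[cocompact Space] fun y => ‖y‖⁻¹ ^ 2 := by
  have hc := (contDiff_dyonFactor hβ κ).continuous
  have h1 := tendsto_comp_coulombField (f := fun z => dyonFactor β κ z.1 z.2 - 1) (by fun_prop) x q g
  have h2 := tendsto_comp_coulombField (contDiff_inner_div κ).continuous x q g
  have h0 : dyonFactor β κ 0 0 = 1 := by simp [dyonFactor, dyonDet_eq]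
  simp only [h0] at h1
  norm_num at h1 h2
  have hE : (fun y => dyonE β κ (coulombField x q y) (coulombField x g y))
      =O[cocompact Space] fun y => ‖y‖⁻¹ ^ 2 := by
    refine ((dyonE_sub_isLittleO hβ κ x q g).isBigO.add
      (coulombField_isBigO_cocompact x q)).congr_left fun y => sub_add_cancel _ _
  have h3 := (((Asymptotics.isLittleO_one_iff ℝ).2 h1).smul_isBigO
      (coulombField_isBigO_cocompact x g)).sub
    (((Asymptotics.isLittleO_one_iff ℝ).2 h2).smul_isBigO hE)
  simp only [smul_eq_mul, one_mul] at h3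
  refine h3.congr_left fun y => ?_
  rw [dyonH_eq hβ, dyonFactor]
  module

theorem hasFreeChargeLim_dyonE (hβ : 0 < β) (hκ : κ ≠ 0) (hx : Function.Injective x)
    (hq : ∀ i, q i ≠ 0) (g : Fin n → ℝ) :
    HasFreeChargeLim x (fun y => dyonE β κ (coulombField x q y) (coulombField x g y))
      (∑ i, q i) :=
  hasFreeChargeLim_of_isBigO hx ((contDiffOn_dyonE hβ κ x q g).of_le (by simp))
    (fun i => inner_sub_dyonE_isBigO hβ hκ hx i (hq i)) (dyonE_sub_isLittleO hβ κ x q g)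

theorem hasFreeChargeLim_dyonH (hβ : 0 < β) (hκ : κ ≠ 0) (hx : Function.Injective x)
    (hq : ∀ i, q i ≠ 0) (hg : ∀ i, g i ≠ 0) :
    HasFreeChargeLim x (fun y => dyonH β κ (coulombField x q y) (coulombField x g y))
      (∑ i, g i) :=
  hasFreeChargeLim_of_isBigO hx ((contDiffOn_dyonH hβ κ x q g).of_le (by simp))
    (fun i => inner_sub_dyonH_isBigO hβ hκ hx i (hq i) (hg i)) (dyonH_sub_isLittleO hβ κ x q g)

end

/-! ### Polynomial identities implied by a vanishing curl -/

/-- The values of `s = B · B`, `w = B · V`, `t = V · V` for two vector fields `B` and `V`, their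
derivatives in two directions, and the components `b`, `v` of `B`, `V` along these directions. The
entries lie in an arbitrary ring, so that the jets of real fields can be complexified. -/
structure FieldJet (K : Type*) where
  s : K
  w : K
  t : K
  s₁ : K
  w₁ : K
  t₁ : K
  s₂ : K
  w₂ : K
  t₂ : K
  b₁ : K
  v₁ : K
  b₂ : K
  v₂ : K

namespace FieldJet

variable {K : Type*} [CommRing K] (β κ l : K) (J : FieldJet K)

/-- The determinant `Δ` of the fields `D = l B + V` and `B`. -/
def det : K := 1 + κ ^ 2 * J.s +
  β * (l ^ 2 * J.s + 2 * l * J.w + J.t + κ ^ 2 * (J.s * J.t - J.w ^ 2))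

/-- The derivative of `det` if those of `s`, `w`, `t` are `s'`, `w'`, `t'`. -/
def detDeriv (s' w' t' : K) : K := κ ^ 2 * s' +
  β * (l ^ 2 * s' + 2 * l * w' + t' + κ ^ 2 * (s' * J.t + J.s * t' - 2 * J.w * w'))

/-- The component of `(1 + κ² B²) D - κ² (B · D) B`, the direction of `dyonE`, along a vector along
which `B` and `V` have the components `b` and `v`. -/
def dirE (b v : K) : K := (l - κ ^ 2 * J.w) * b + (1 + κ ^ 2 * J.s) * v

/-- The exterior derivative of `dirE`. -/
def curlE : K := κ ^ 2 * (J.s₁ * J.v₂ - J.s₂ * J.v₁) - κ ^ 2 * (J.w₁ * J.b₂ - J.w₂ * J.b₁)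

/-- `∇(B²) ∧ B`. -/
def coreObstruction : K := J.s₁ * J.b₂ - J.s₂ * J.b₁

/-- The polynomial whose vanishing expresses that `dyonE` is irrotational. -/
def electricObstruction : K :=
  2 * (1 + β * J.s) * ((1 + κ ^ 2 * J.s) * J.det β κ l) * J.curlE κ
  + (β * J.s₁ * ((1 + κ ^ 2 * J.s) * J.det β κ l) - (1 + β * J.s) *
      (κ ^ 2 * J.s₁ * J.det β κ l + (1 + κ ^ 2 * J.s) * J.detDeriv β κ l J.s₁ J.w₁ J.t₁))
    * J.dirE κ l J.b₂ J.v₂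
  - (β * J.s₂ * ((1 + κ ^ 2 * J.s) * J.det β κ l) - (1 + β * J.s) *
      (κ ^ 2 * J.s₂ * J.det β κ l + (1 + κ ^ 2 * J.s) * J.detDeriv β κ l J.s₂ J.w₂ J.t₂))
    * J.dirE κ l J.b₁ J.v₁

/-- The component of the numerator of `dyonH`. -/
def dirH (b v : K) : K := (1 + κ ^ 2 * J.s) * J.det β κ l * b
  - κ ^ 2 * ((1 + β * J.s) * (l * J.s + J.w)) * J.dirE κ l b v

/-- The derivative of the product `(1 + κ² s) Δ`. -/
def leadDeriv (s' w' t' : K) : K :=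
  κ ^ 2 * s' * J.det β κ l + (1 + κ ^ 2 * J.s) * J.detDeriv β κ l s' w' t'

/-- The derivative of the product `(1 + β s) (B · D)`. -/
def mixDeriv (s' w' : K) : K :=
  β * s' * (l * J.s + J.w) + (1 + β * J.s) * (l * s' + w')

/-- The exterior derivative of `dirH`. -/
def curlH : K :=
  (J.leadDeriv β κ l J.s₁ J.w₁ J.t₁ * J.b₂ - J.leadDeriv β κ l J.s₂ J.w₂ J.t₂ * J.b₁)
  - κ ^ 2 * ((J.mixDeriv β l J.s₁ J.w₁ * J.dirE κ l J.b₂ J.v₂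
      - J.mixDeriv β l J.s₂ J.w₂ * J.dirE κ l J.b₁ J.v₁)
    + (1 + β * J.s) * (l * J.s + J.w) * J.curlE κ)

/-- The square of the denominator of `dyonH`. -/
def denomSq : K := (1 + β * J.s) * (1 + κ ^ 2 * J.s) ^ 3 * J.det β κ l

/-- The derivative of `denomSq`. -/
def denomSqDeriv (s' w' t' : K) : K :=
  β * s' * (1 + κ ^ 2 * J.s) ^ 3 * J.det β κ l
  + (1 + β * J.s) * (3 * (1 + κ ^ 2 * J.s) ^ 2 * (κ ^ 2 * s')) * J.det β κ l
  + (1 + β * J.s) * (1 + κ ^ 2 * J.s) ^ 3 * J.detDeriv β κ l s' w' t'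

/-- The polynomial whose vanishing expresses that `dyonH` is irrotational. -/
def magneticObstruction : K :=
  2 * J.denomSq β κ l * J.curlH β κ l
  - J.denomSqDeriv β κ l J.s₁ J.w₁ J.t₁ * J.dirH β κ l J.b₂ J.v₂
  + J.denomSqDeriv β κ l J.s₂ J.w₂ J.t₂ * J.dirH β κ l J.b₁ J.v₁

end FieldJet

/-- The jet of two vector fields with values `B`, `V` and derivatives `B'`, `V'` in the directions
`h`, `k`. -/
def jetOf (B V : Space) (B' V' : Space →L[ℝ] Space) (h k : Space) : FieldJet ℝ where
  s := inner ℝ B B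
  w := inner ℝ B V
  t := inner ℝ V V
  s₁ := 2 * inner ℝ B (B' h)
  w₁ := inner ℝ B (V' h) + inner ℝ (B' h) V
  t₁ := 2 * inner ℝ V (V' h)
  s₂ := 2 * inner ℝ B (B' k)
  w₂ := inner ℝ B (V' k) + inner ℝ (B' k) V
  t₂ := 2 * inner ℝ V (V' k)
  b₁ := inner ℝ B h
  v₁ := inner ℝ V h
  b₂ := inner ℝ B k
  v₂ := inner ℝ V k

theorem inner_fderiv_comm_of_curl_eq_zero {F : Space → Space} {y : Space}
    (h : curl F y = 0) (u v : Space) :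
    inner ℝ (fderiv ℝ F y u) v = inner ℝ (fderiv ℝ F y v) u := by
  have hp : ∀ j k : Fin 3, partialDeriv F j k y = partialDeriv F k j y := by
    have h0 := congrArg (fun w : Space => w 0) h
    have h1 := congrArg (fun w : Space => w 1) h
    have h2 := congrArg (fun w : Space => w 2) h
    simp [curl] at h0 h1 h2
    intro j k
    fin_cases j <;> fin_cases k <;> simp <;> linarith
  have hs : ∀ u v : Space, inner ℝ (fderiv ℝ F y u) v = ∑ j, ∑ k, u j * v k * partialDeriv F j k y := by
    intro u v
    rw [real_inner_comm, inner_map_eq_sum]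
    refine Finset.sum_congr rfl fun j _ => ?_
    simp only [PiLp.inner_apply, partialDeriv, Fin.sum_univ_three]
    simp
    ring
  rw [hs, hs, Finset.sum_comm]
  refine Finset.sum_congr rfl fun j _ => Finset.sum_congr rfl fun k _ => ?_
  rw [hp]
  ring

theorem hasDerivAt_comp_line {V : Type*} [NormedAddCommGroup V] [NormedSpace ℝ V] {F : Space → V}
    {F' : Space →L[ℝ] V} {y : Space} (h : HasFDerivAt F F' y) (v : Space) :
    HasDerivAt (fun τ : ℝ => F (y + τ • v)) (F' v) 0 :=
  h.hasLineDerivAt v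

/-- If `c • W` is irrotational at `y` and `c² M = N`, then eliminating `c` leaves a polynomial
identity between the values and first derivatives of `M`, `N` and `W`. -/
theorem wedge_eq_zero_of_curl_eq_zero {c M N : Space → ℝ} {W : Space → Space} {y : Space}
    (hc : DifferentiableAt ℝ c y) (hW : DifferentiableAt ℝ W y) (hcN : ∀ z, c z ^ 2 * M z = N z)
    (hcurl : curl (fun z => c z • W z) y = 0)
    {h k : Space} {M₁ M₂ N₁ N₂ W₁₂ W₂₁ : ℝ}
    (hM₁ : HasDerivAt (fun τ : ℝ => M (y + τ • h)) M₁ 0)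
    (hM₂ : HasDerivAt (fun τ : ℝ => M (y + τ • k)) M₂ 0)
    (hN₁ : HasDerivAt (fun τ : ℝ => N (y + τ • h)) N₁ 0)
    (hN₂ : HasDerivAt (fun τ : ℝ => N (y + τ • k)) N₂ 0)
    (hW₁₂ : HasDerivAt (fun τ : ℝ => (inner ℝ (W (y + τ • h)) k : ℝ)) W₁₂ 0)
    (hW₂₁ : HasDerivAt (fun τ : ℝ => (inner ℝ (W (y + τ • k)) h : ℝ)) W₂₁ 0) :
    2 * N y * M y * (W₁₂ - W₂₁) + (N₁ * M y - N y * M₁) * inner ℝ (W y) k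
      - (N₂ * M y - N y * M₂) * inner ℝ (W y) h = 0 := by
  have hF := (hc.smul hW).hasFDerivAt
  have hsym := inner_fderiv_comm_of_curl_eq_zero hcurl h k
  have e0 : ∀ v : Space, y + (0 : ℝ) • v = y := fun v => by simp
  have key : ∀ (a b : Space) (Mₐ Nₐ Wₐ : ℝ),
      HasDerivAt (fun τ : ℝ => M (y + τ • a)) Mₐ 0 →
      HasDerivAt (fun τ : ℝ => N (y + τ • a)) Nₐ 0 →
      HasDerivAt (fun τ : ℝ => (inner ℝ (W (y + τ • a)) b : ℝ)) Wₐ 0 →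
      2 * c y * M y ^ 2 * inner ℝ (fderiv ℝ (fun z => c z • W z) y a) b =
        2 * N y * M y * Wₐ + (Nₐ * M y - N y * Mₐ) * inner ℝ (W y) b := by
    intro a b Mₐ Nₐ Wₐ hMa hNa hWa
    have hca := hasDerivAt_comp_line hc.hasFDerivAt a
    set c' := fderiv ℝ c y a
    have h1 := ((hca.pow 2).mul hMa).unique (hNa.congr_of_eventuallyEq
      (Eventually.of_forall fun τ => hcN _))
    have h2 := (hasDerivAt_comp_line hF a).inner ℝ (hasDerivAt_const (0 : ℝ) b)
    have h3 := h2.unique ((hca.mul hWa).congr_of_eventuallyEq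
      (Eventually.of_forall fun τ => by simp [inner_smul_left]))
    simp only [e0, inner_zero_right, zero_add] at h1 h3
    have h4 : fderiv ℝ (c • W) y = fderiv ℝ (fun z => c z • W z) y := rfl
    rw [h4] at h3
    have h5 := hcN y
    rw [h3, ← h5]
    norm_num at h1
    rw [← h1]
    ring
  have k1 := key h k _ _ _ hM₁ hN₁ hW₁₂
  have k2 := key k h _ _ _ hM₂ hN₂ hW₂₁
  rw [hsym] at k1
  linear_combination k2 - k1

section

variable {β κ l : ℝ} {B V : Space → Space} {y : Space} {B' V' : Space →L[ℝ] Space}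

theorem hasDerivAt_inner_line {F G : Space → Space} {F' G' : Space →L[ℝ] Space}
    (hF : HasFDerivAt F F' y) (hG : HasFDerivAt G G' y) (h : Space) :
    HasDerivAt (fun τ : ℝ => (inner ℝ (F (y + τ • h)) (G (y + τ • h)) : ℝ))
      (inner ℝ (F y) (G' h) + inner ℝ (F' h) (G y)) 0 := by
  have := (hasDerivAt_comp_line hF h).inner ℝ (hasDerivAt_comp_line hG h)
  simpa using this

theorem hasDerivAt_inner_const_line {F : Space → Space} {F' : Space →L[ℝ] Space}
    (hF : HasFDerivAt F F' y) (h k : Space) :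
    HasDerivAt (fun τ : ℝ => (inner ℝ (F (y + τ • h)) k : ℝ)) (inner ℝ (F' h) k) 0 := by
  have := (hasDerivAt_comp_line hF h).inner ℝ (hasDerivAt_const (0 : ℝ) k)
  simpa using this

/-- The relation for an irrotational saturated field. It does not involve the second field of the
jet, which is arbitrary. -/
theorem coreObstruction_eq_zero (hβ : 0 < β) (hB : HasFDerivAt B B' y)
    (hsB : ∀ h k, (inner ℝ (B' h) k : ℝ) = inner ℝ (B' k) h)
    (hcurl : curl (fun z => saturate β (B z)) y = 0) (V' : Space →L[ℝ] Space) (v h k : Space) :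
    (jetOf (B y) v B' V' h k).coreObstruction = 0 := by
  have hc : ContDiff ℝ ∞ fun w : Space => 1 / √(1 + β * ‖w‖ ^ 2) :=
    contDiff_const.div (ContDiff.sqrt (contDiff_const.add (contDiff_const.mul (contDiff_norm_sq ℝ)))
      fun w => (one_add_mul_norm_sq_pos hβ w).ne') fun w =>
      (Real.sqrt_pos.2 (one_add_mul_norm_sq_pos hβ w)).ne'
  have hM : ∀ h, HasDerivAt (fun τ : ℝ =>
      1 + β * (inner ℝ (B (y + τ • h)) (B (y + τ • h)) : ℝ)) _ 0 := fun h =>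
    ((hasDerivAt_inner_line hB hB h).const_mul β).const_add 1
  have h1 := wedge_eq_zero_of_curl_eq_zero (c := fun z => 1 / √(1 + β * ‖B z‖ ^ 2))
    (M := fun z => 1 + β * (inner ℝ (B z) (B z) : ℝ)) (N := fun _ => 1) (W := B)
    ((hc.differentiable (by simp)).differentiableAt.comp y hB.differentiableAt)
    hB.differentiableAt (fun z => by
      have h0 := one_add_mul_norm_sq_pos hβ (B z)
      rw [div_pow, Real.sq_sqrt h0.le, real_inner_self_eq_norm_sq]
      field_simp) hcurl (hM h) (hM k) (hasDerivAt_const _ _) (hasDerivAt_const _ _)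
    (hasDerivAt_inner_const_line hB h k) (hasDerivAt_inner_const_line hB k h)
  rw [hsB h k, real_inner_comm (B y) (B' h), real_inner_comm (B y) (B' k)] at h1
  have h2 : β * (jetOf (B y) v B' V' h k).coreObstruction = 0 := by
    simp only [FieldJet.coreObstruction, jetOf]
    linear_combination -h1
  exact (mul_eq_zero.1 h2).resolve_left hβ.ne'

/-- `Δ` along a line through `y`. -/
theorem hasDerivAt_det_line (β κ l : ℝ) (hB : HasFDerivAt B B' y) (hV : HasFDerivAt V V' y)
    (h : Space) :
    HasDerivAt (fun τ : ℝ => (jetOf (B (y + τ • h)) (V (y + τ • h)) 0 0 0 0).det β κ l)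
      ((jetOf (B y) (V y) B' V' h h).detDeriv β κ l (2 * inner ℝ (B y) (B' h))
        (inner ℝ (B y) (V' h) + inner ℝ (B' h) (V y)) (2 * inner ℝ (V y) (V' h))) 0 := by
  have hs := hasDerivAt_inner_line hB hB h
  have hw := hasDerivAt_inner_line hB hV h
  have ht := hasDerivAt_inner_line hV hV h
  have h1 := ((hs.const_mul (κ ^ 2)).const_add 1).add
    (((((hs.const_mul (l ^ 2)).add (hw.const_mul (2 * l))).add ht).add
      (((hs.mul ht).sub (hw.pow 2)).const_mul (κ ^ 2))).const_mul β)
  refine h1.congr_deriv ?_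
  rw [real_inner_comm (B y) (B' h), real_inner_comm (V y) (V' h)]
  simp [FieldJet.detDeriv, jetOf]
  ring

theorem dyonDet_eq_det (β κ l : ℝ) (b v : Space) (B' V' : Space →L[ℝ] Space) (h k : Space) :
    dyonDet β κ (l • b + v) b = (jetOf b v B' V' h k).det β κ l := by
  rw [dyonDet_eq, norm_add_sq_real, norm_smul, mul_pow, Real.norm_eq_abs, sq_abs, inner_add_right,
    inner_smul_left, inner_smul_right, real_inner_self_eq_norm_sq]
  simp only [FieldJet.det, jetOf, real_inner_self_eq_norm_sq]
  simp
  left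
  ring

/-- The vector field `(1 + κ² B²) D - κ² (B · D) B` for `D = l B + V`. -/
def dirEField (κ l : ℝ) (b v : Space) : Space :=
  (l - κ ^ 2 * inner ℝ b v) • b + (1 + κ ^ 2 * inner ℝ b b) • v

theorem dyonE_eq_dirEField (β κ l : ℝ) (b v : Space) :
    dyonE β κ (l • b + v) b = dyonCoeff β κ (l • b + v) b • dirEField κ l b v := by
  rw [dyonE_eq, dirEField, inner_add_right, inner_smul_right, real_inner_self_eq_norm_sq]
  module

theorem inner_dirEField (κ l : ℝ) (b v : Space) (B' V' : Space →L[ℝ] Space) (h k m : Space) :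
    inner ℝ (dirEField κ l b v) m =
      (jetOf b v B' V' h k).dirE κ l (inner ℝ b m) (inner ℝ v m) := by
  simp [dirEField, FieldJet.dirE, jetOf, inner_add_left, inner_smul_left]

theorem hasDerivAt_dirEField_line (κ l : ℝ) (hB : HasFDerivAt B B' y) (hV : HasFDerivAt V V' y)
    (h k : Space) :
    HasDerivAt (fun τ : ℝ => (inner ℝ (dirEField κ l (B (y + τ • h)) (V (y + τ • h))) k : ℝ))
      ((l - κ ^ 2 * inner ℝ (B y) (V y)) * inner ℝ (B' h) k
        - κ ^ 2 * (inner ℝ (B y) (V' h) + inner ℝ (B' h) (V y)) * inner ℝ (B y) k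
        + (1 + κ ^ 2 * inner ℝ (B y) (B y)) * inner ℝ (V' h) k
        + κ ^ 2 * (2 * inner ℝ (B y) (B' h)) * inner ℝ (V y) k) 0 := by
  have hs := hasDerivAt_inner_line hB hB h
  have hw := hasDerivAt_inner_line hB hV h
  have hb := hasDerivAt_inner_const_line hB h k
  have hv := hasDerivAt_inner_const_line hV h k
  have h1 := (((hw.const_mul (κ ^ 2)).const_sub l).mul hb).add
    (((hs.const_mul (κ ^ 2)).const_add 1).mul hv)
  have h2 : (fun τ : ℝ => (inner ℝ (dirEField κ l (B (y + τ • h)) (V (y + τ • h))) k : ℝ)) =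
      fun τ => (l - κ ^ 2 * inner ℝ (B (y + τ • h)) (V (y + τ • h))) * inner ℝ (B (y + τ • h)) k
        + (1 + κ ^ 2 * inner ℝ (B (y + τ • h)) (B (y + τ • h))) * inner ℝ (V (y + τ • h)) k := by
    ext τ
    simp [dirEField, inner_add_left, inner_smul_left]
  rw [h2]
  refine h1.congr_deriv ?_
  rw [real_inner_comm (B y) (B' h)]
  simp
  ring

theorem contDiff_dirEField (κ l : ℝ) :
    ContDiff ℝ ∞ fun z : Space × Space => dirEField κ l z.1 z.2 := by
  unfold dirEField
  have h1 : ContDiff ℝ ∞ fun z : Space × Space => (inner ℝ z.1 z.2 : ℝ) :=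
    contDiff_fst.inner ℝ contDiff_snd
  have h2 : ContDiff ℝ ∞ fun z : Space × Space => (inner ℝ z.1 z.1 : ℝ) :=
    contDiff_fst.inner ℝ contDiff_fst
  exact ((contDiff_const.sub (contDiff_const.mul h1)).smul contDiff_fst).add
    ((contDiff_const.add (contDiff_const.mul h2)).smul contDiff_snd)

/-- If `E` is irrotational, then the values and first derivatives of `B` and `V`, where
`D = l B + V`, satisfy a polynomial relation. The square roots drop out because
the coefficient of `E` has a rational square. -/
theorem electricObstruction_eq_zero (hβ : 0 < β) (hB : HasFDerivAt B B' y)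
    (hV : HasFDerivAt V V' y) (hsB : ∀ h k, (inner ℝ (B' h) k : ℝ) = inner ℝ (B' k) h)
    (hsV : ∀ h k, (inner ℝ (V' h) k : ℝ) = inner ℝ (V' k) h)
    (hcurl : curl (fun z => dyonE β κ (l • B z + V z) (B z)) y = 0) (h k : Space) :
    (jetOf (B y) (V y) B' V' h k).electricObstruction β κ l = 0 := by
  simp only [dyonE_eq_dirEField] at hcurl
  have hBV : DifferentiableAt ℝ (fun z => (l • B z + V z, B z)) y :=
    ((hB.differentiableAt.const_smul l).add hV.differentiableAt).prodMk hB.differentiableAt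
  have hcd : DifferentiableAt ℝ (fun z => dyonCoeff β κ (l • B z + V z) (B z)) y :=
    DifferentiableAt.comp (g := fun z : Space × Space => dyonCoeff β κ z.1 z.2)
      (f := fun z => (l • B z + V z, B z)) y
      (((contDiff_dyonCoeff hβ κ).differentiable (by simp)) _) hBV
  have hWd : DifferentiableAt ℝ (fun z => dirEField κ l (B z) (V z)) y :=
    DifferentiableAt.comp (g := fun z : Space × Space => dirEField κ l z.1 z.2)
      (f := fun z => (B z, V z)) y
      (((contDiff_dirEField κ l).differentiable (by simp)) _)
      (hB.differentiableAt.prodMk hV.differentiableAt)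
  have hN : ∀ h, HasDerivAt (fun τ : ℝ =>
      1 + β * (inner ℝ (B (y + τ • h)) (B (y + τ • h)) : ℝ)) _ 0 := fun h =>
    ((hasDerivAt_inner_line hB hB h).const_mul β).const_add 1
  have hM : ∀ h, HasDerivAt (fun τ : ℝ =>
      (1 + κ ^ 2 * (inner ℝ (B (y + τ • h)) (B (y + τ • h)) : ℝ)) *
        (jetOf (B (y + τ • h)) (V (y + τ • h)) 0 0 0 0).det β κ l) _ 0 := fun h =>
    (((hasDerivAt_inner_line hB hB h).const_mul (κ ^ 2)).const_add 1).mul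
      (hasDerivAt_det_line β κ l hB hV h)
  have h1 := wedge_eq_zero_of_curl_eq_zero (c := fun z => dyonCoeff β κ (l • B z + V z) (B z))
    (M := fun z => (1 + κ ^ 2 * (inner ℝ (B z) (B z) : ℝ)) * (jetOf (B z) (V z) 0 0 0 0).det β κ l)
    (N := fun z => 1 + β * (inner ℝ (B z) (B z) : ℝ)) (W := fun z => dirEField κ l (B z) (V z))
    hcd hWd
    (fun z => by
      have h0 := one_add_sq_mul_norm_sq_pos κ (B z)
      have h2 := dyonDet_pos hβ κ (l • B z + V z) (B z)
      rw [dyonCoeff_sq hβ, ← dyonDet_eq_det, real_inner_self_eq_norm_sq]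
      field_simp) hcurl (hM h) (hM k) (hN h) (hN k)
    (hasDerivAt_dirEField_line κ l hB hV h k) (hasDerivAt_dirEField_line κ l hB hV k h)
  rw [inner_dirEField κ l (B y) (V y) B' V' h k, inner_dirEField κ l (B y) (V y) B' V' h k, hsB h k,
    hsV h k, real_inner_comm (B y) (B' h), real_inner_comm (B y) (B' k)] at h1
  simp only [zero_smul, add_zero] at h1
  simp only [FieldJet.electricObstruction, FieldJet.curlE, jetOf, FieldJet.detDeriv,
    FieldJet.det, FieldJet.dirE] at h1 ⊢
  linear_combination h1

/-- The numerator of `dyonH` for `D = l B + V`. -/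
def dirHField (β κ l : ℝ) (b v : Space) : Space :=
  ((1 + κ ^ 2 * inner ℝ b b) * dyonDet β κ (l • b + v) b) • b
    - (κ ^ 2 * ((1 + β * inner ℝ b b) * (l * inner ℝ b b + inner ℝ b v))) • dirEField κ l b v

theorem dyonH_eq_dirHField (β κ l : ℝ) (b v : Space) :
    dyonH β κ (l • b + v) b = (1 / dyonDenom β κ (l • b + v) b) • dirHField β κ l b v := by
  have hE : dirEField κ l b v = (1 + κ ^ 2 * ‖b‖ ^ 2) • (l • b + v)
      - (κ ^ 2 * inner ℝ b (l • b + v)) • b := by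
    rw [dirEField, inner_add_right, inner_smul_right, real_inner_self_eq_norm_sq]
    module
  have hp : l * inner ℝ b b + inner ℝ b v = inner ℝ b (l • b + v) := by
    rw [inner_add_right, inner_smul_right]
  rw [dirHField, hE, hp, real_inner_self_eq_norm_sq, dyonDet_eq, dyonH, norm_cross_sq]
  set D := l • b + v
  set p : ℝ := inner ℝ b D
  have hb : ∀ a c e f : ℝ, ∀ m : ℝ, (1 / m) • (a • b - c • (e • D - f • b)) =
      ((a + c * f) / m) • b - (c * e / m) • D := by
    intro a c e f m
    simp only [div_eq_mul_inv, one_mul]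
    module
  rw [hb]
  congr 3 <;> ring

theorem contDiff_dirHField (β κ l : ℝ) :
    ContDiff ℝ ∞ fun z : Space × Space => dirHField β κ l z.1 z.2 := by
  unfold dirHField
  have h1 : ContDiff ℝ ∞ fun z : Space × Space => (inner ℝ z.1 z.2 : ℝ) :=
    contDiff_fst.inner ℝ contDiff_snd
  have h2 : ContDiff ℝ ∞ fun z : Space × Space => (inner ℝ z.1 z.1 : ℝ) :=
    contDiff_fst.inner ℝ contDiff_fst
  have h3 : ContDiff ℝ ∞ fun z : Space × Space => dyonDet β κ (l • z.1 + z.2) z.1 :=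
    ContDiff.comp (g := fun z : Space × Space => dyonDet β κ z.1 z.2)
      (f := fun z : Space × Space => (l • z.1 + z.2, z.1)) (contDiff_dyonDet β κ)
      (by fun_prop)
  exact (((contDiff_const.add (contDiff_const.mul h2)).mul h3).smul contDiff_fst).sub
    ((contDiff_const.mul ((contDiff_const.add (contDiff_const.mul h2)).mul
      ((contDiff_const.mul h2).add h1))).smul (contDiff_dirEField κ l))

theorem dyonDenom_pos (hβ : 0 < β) (κ : ℝ) (D B : Space) : 0 < dyonDenom β κ D B := by
  have p1 := Real.sqrt_pos.2 (one_add_mul_norm_sq_pos hβ B)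
  have p2 := Real.sqrt_pos.2 (one_add_sq_mul_norm_sq_pos κ B)
  have p3 := Real.sqrt_pos.2 (dyonDet_pos hβ κ D B)
  rw [dyonDenom]
  positivity

theorem contDiff_one_div_dyonDenom (hβ : 0 < β) (κ : ℝ) :
    ContDiff ℝ ∞ fun z : Space × Space => 1 / dyonDenom β κ z.1 z.2 := by
  refine contDiff_const.div ?_ fun z => (dyonDenom_pos hβ κ _ _).ne'
  unfold dyonDenom
  exact (((contDiff_norm_sq_add contDiff_snd β).sqrt fun z =>
    (one_add_mul_norm_sq_pos hβ _).ne').mul (((contDiff_norm_sq_add contDiff_snd _).sqrt fun z =>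
    (one_add_sq_mul_norm_sq_pos κ _).ne').pow 3)).mul ((contDiff_dyonDet β κ).sqrt fun z =>
    (dyonDet_pos hβ κ _ _).ne')

theorem inner_dirHField (β κ l : ℝ) (b v : Space) (B' V' : Space →L[ℝ] Space) (h k m : Space) :
    inner ℝ (dirHField β κ l b v) m =
      (jetOf b v B' V' h k).dirH β κ l (inner ℝ b m) (inner ℝ v m) := by
  rw [dirHField, inner_sub_left, inner_smul_left, inner_smul_left,
    inner_dirEField κ l b v B' V' h k, dyonDet_eq_det β κ l b v B' V' h k]
  simp [FieldJet.dirH, jetOf]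

/-- The relation for an irrotational field `H`, analogous to `electricObstruction_eq_zero`. -/
theorem magneticObstruction_eq_zero (hβ : 0 < β) (hB : HasFDerivAt B B' y)
    (hV : HasFDerivAt V V' y) (hsB : ∀ h k, (inner ℝ (B' h) k : ℝ) = inner ℝ (B' k) h)
    (hsV : ∀ h k, (inner ℝ (V' h) k : ℝ) = inner ℝ (V' k) h)
    (hcurl : curl (fun z => dyonH β κ (l • B z + V z) (B z)) y = 0) (h k : Space) :
    (jetOf (B y) (V y) B' V' h k).magneticObstruction β κ l = 0 := by
  simp only [dyonH_eq_dirHField] at hcurl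
  have hBV : DifferentiableAt ℝ (fun z => (l • B z + V z, B z)) y :=
    ((hB.differentiableAt.const_smul l).add hV.differentiableAt).prodMk hB.differentiableAt
  have hcd : DifferentiableAt ℝ (fun z => 1 / dyonDenom β κ (l • B z + V z) (B z)) y :=
    DifferentiableAt.comp (g := fun z : Space × Space => 1 / dyonDenom β κ z.1 z.2)
      (f := fun z => (l • B z + V z, B z)) y
      (((contDiff_one_div_dyonDenom hβ κ).differentiable (by simp)) _) hBV
  have hWd : DifferentiableAt ℝ (fun z => dirHField β κ l (B z) (V z)) y :=
    DifferentiableAt.comp (g := fun z : Space × Space => dirHField β κ l z.1 z.2)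
      (f := fun z => (B z, V z)) y
      (((contDiff_dirHField β κ l).differentiable (by simp)) _)
      (hB.differentiableAt.prodMk hV.differentiableAt)
  have hq : ∀ h, HasDerivAt (fun τ : ℝ =>
      1 + β * (inner ℝ (B (y + τ • h)) (B (y + τ • h)) : ℝ)) _ 0 := fun h =>
    ((hasDerivAt_inner_line hB hB h).const_mul β).const_add 1
  have hu : ∀ h, HasDerivAt (fun τ : ℝ =>
      1 + κ ^ 2 * (inner ℝ (B (y + τ • h)) (B (y + τ • h)) : ℝ)) _ 0 := fun h =>
    ((hasDerivAt_inner_line hB hB h).const_mul (κ ^ 2)).const_add 1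
  have hp : ∀ h, HasDerivAt (fun τ : ℝ => l * (inner ℝ (B (y + τ • h)) (B (y + τ • h)) : ℝ)
      + inner ℝ (B (y + τ • h)) (V (y + τ • h))) _ 0 := fun h =>
    ((hasDerivAt_inner_line hB hB h).const_mul l).add (hasDerivAt_inner_line hB hV h)
  have hM : ∀ h, HasDerivAt (fun τ : ℝ =>
      (1 + β * (inner ℝ (B (y + τ • h)) (B (y + τ • h)) : ℝ)) *
      (1 + κ ^ 2 * (inner ℝ (B (y + τ • h)) (B (y + τ • h)) : ℝ)) ^ 3 *
        (jetOf (B (y + τ • h)) (V (y + τ • h)) 0 0 0 0).det β κ l) _ 0 := fun h =>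
    ((hq h).mul ((hu h).pow 3)).mul (hasDerivAt_det_line β κ l hB hV h)
  have hW : ∀ h k, HasDerivAt (fun τ : ℝ =>
      (inner ℝ (dirHField β κ l (B (y + τ • h)) (V (y + τ • h))) k : ℝ)) _ 0 := fun h k =>
    ((((hu h).mul (hasDerivAt_det_line β κ l hB hV h)).mul
      (hasDerivAt_inner_const_line hB h k)).sub ((((hq h).mul (hp h)).const_mul (κ ^ 2)).mul
        (hasDerivAt_dirEField_line κ l hB hV h k))).congr_of_eventuallyEq
      (Eventually.of_forall fun τ => by
        simp only [dirHField, inner_sub_left, inner_smul_left,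
          dyonDet_eq_det β κ l _ _ 0 0 0 0]
        simp)
  have h1 := wedge_eq_zero_of_curl_eq_zero (c := fun z => 1 / dyonDenom β κ (l • B z + V z) (B z))
    (M := fun z => (1 + β * (inner ℝ (B z) (B z) : ℝ)) *
      (1 + κ ^ 2 * (inner ℝ (B z) (B z) : ℝ)) ^ 3 * (jetOf (B z) (V z) 0 0 0 0).det β κ l)
    (N := fun _ => 1) (W := fun z => dirHField β κ l (B z) (V z))
    hcd hWd
    (fun z => by
      have h0 := one_add_sq_mul_norm_sq_pos κ (B z)
      have h1 := one_add_mul_norm_sq_pos hβ (B z)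
      have h2 := dyonDet_pos hβ κ (l • B z + V z) (B z)
      have p2 := Real.sq_sqrt h0.le
      rw [← dyonDet_eq_det, real_inner_self_eq_norm_sq, dyonDenom, div_pow, mul_pow, mul_pow,
        ← pow_mul, mul_comm 3 2, pow_mul, Real.sq_sqrt h1.le, Real.sq_sqrt h0.le,
        Real.sq_sqrt h2.le]
      field_simp) hcurl (hM h) (hM k) (hasDerivAt_const _ _) (hasDerivAt_const _ _)
    (hW h k) (hW k h)
  rw [inner_dirHField β κ l (B y) (V y) B' V' h k, inner_dirHField β κ l (B y) (V y) B' V' h k,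
    hsB h k, hsV h k, real_inner_comm (B y) (B' h), real_inner_comm (B y) (B' k)] at h1
  have e1 : (jetOf (B y) (V y) 0 0 0 0).det β κ l = (jetOf (B y) (V y) B' V' h k).det β κ l := rfl
  have e2 : ∀ m, (jetOf (B y) (V y) B' V' m m).detDeriv β κ l =
    (jetOf (B y) (V y) B' V' h k).detDeriv β κ l := fun m => rfl
  simp only [zero_smul, add_zero, Pi.mul_apply, Pi.pow_apply, e1, e2,
    inner_dirEField κ l (B y) (V y) B' V' h k] at h1
  simp only [FieldJet.magneticObstruction, FieldJet.denomSq, FieldJet.denomSqDeriv,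
    FieldJet.curlH, FieldJet.leadDeriv, FieldJet.mixDeriv, FieldJet.dirH] at h1 ⊢
  generalize (jetOf (B y) (V y) B' V' h k).det β κ l = d at h1 ⊢
  generalize (jetOf (B y) (V y) B' V' h k).detDeriv β κ l = d' at h1 ⊢
  simp only [jetOf, FieldJet.curlE, FieldJet.dirE] at h1 ⊢
  simp only [Nat.cast_ofNat, Nat.reduceSub] at h1
  linear_combination h1

end

/-! ### Complexification of Coulomb fields -/

section

variable {K : Type*} [Field K] {n : ℕ}

/-- The superposition of Coulomb kernels with strengths `a`, positions `z` relative to the charges,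
and inverse distances `R`. -/
def kernelSum (a : Fin n → K) (z : Fin n → Fin 3 → K) (R : Fin n → K) : Fin 3 → K :=
  ∑ j, (a j * R j ^ 3) • z j

/-- The derivative of `kernelSum` in the direction `h`. -/
def kernelSumDeriv (a : Fin n → K) (z : Fin n → Fin 3 → K) (R : Fin n → K) (h : Fin 3 → K) :
    Fin 3 → K :=
  ∑ j, a j • (R j ^ 3 • h - (3 * R j ^ 5 * (z j ⬝ᵥ h)) • z j)

/-- The jet of two fields with values `B`, `V` and derivatives `Bh`, `Vh` and `Bk`, `Vk` in the
directions `h` and `k`. -/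
def vecJet (B V Bh Vh Bk Vk h k : Fin 3 → K) : FieldJet K where
  s := B ⬝ᵥ B
  w := B ⬝ᵥ V
  t := V ⬝ᵥ V
  s₁ := 2 * (B ⬝ᵥ Bh)
  w₁ := B ⬝ᵥ Vh + Bh ⬝ᵥ V
  t₁ := 2 * (V ⬝ᵥ Vh)
  s₂ := 2 * (B ⬝ᵥ Bk)
  w₂ := B ⬝ᵥ Vk + Bk ⬝ᵥ V
  t₂ := 2 * (V ⬝ᵥ Vk)
  b₁ := B ⬝ᵥ h
  v₁ := V ⬝ᵥ h
  b₂ := B ⬝ᵥ k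
  v₂ := V ⬝ᵥ k

/-- The jet of two superpositions of Coulomb kernels. -/
def kernelJet (b c : Fin n → K) (z : Fin n → Fin 3 → K) (R : Fin n → K) (h k : Fin 3 → K) :
    FieldJet K :=
  vecJet (kernelSum b z R) (kernelSum c z R) (kernelSumDeriv b z R h) (kernelSumDeriv c z R h)
    (kernelSumDeriv b z R k) (kernelSumDeriv c z R k) h k

end

/-- The image of a jet under a map of the scalars. -/
def FieldJet.map {K L : Type*} (f : K → L) (J : FieldJet K) : FieldJet L where
  s := f J.s
  w := f J.w
  t := f J.t
  s₁ := f J.s₁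
  w₁ := f J.w₁
  t₁ := f J.t₁
  s₂ := f J.s₂
  w₂ := f J.w₂
  t₂ := f J.t₂
  b₁ := f J.b₁
  v₁ := f J.v₁
  b₂ := f J.b₂
  v₂ := f J.v₂

theorem kernelJet_map {n : ℕ} (b c : Fin n → ℝ) (z : Fin n → Fin 3 → ℝ) (R : Fin n → ℝ)
    (h k : Fin 3 → ℝ) :
    (kernelJet b c z R h k).map Complex.ofReal =
      kernelJet (fun j => (b j : ℂ)) (fun j => (c j : ℂ)) (fun j i => (z j i : ℂ))
        (fun j => (R j : ℂ)) (fun i => (h i : ℂ)) (fun i => (k i : ℂ)) := by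
  have h1 : ∀ a : Fin n → ℝ, kernelSum (fun j => (a j : ℂ)) (fun j i => (z j i : ℂ))
      (fun j => (R j : ℂ)) = fun i => ((kernelSum a z R i : ℝ) : ℂ) := by
    intro a
    ext i
    simp [kernelSum]
  have h2 : ∀ (a : Fin n → ℝ) (m : Fin 3 → ℝ), kernelSumDeriv (fun j => (a j : ℂ))
      (fun j i => (z j i : ℂ)) (fun j => (R j : ℂ)) (fun i => (m i : ℂ)) =
      fun i => ((kernelSumDeriv a z R m i : ℝ) : ℂ) := by
    intro a m
    ext i
    simp [kernelSumDeriv, dotProduct]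
  simp only [kernelJet, h1, h2]
  simp [vecJet, FieldJet.map, dotProduct]

theorem inner_eq_dotProduct (a b : Space) : (inner ℝ a b : ℝ) = a.ofLp ⬝ᵥ b.ofLp := by
  simp [PiLp.inner_apply, dotProduct, mul_comm]

theorem ofLp_coulombField {n : ℕ} (x : Fin n → Space) (q : Fin n → ℝ) (y : Space) :
    (coulombField x q y).ofLp = kernelSum (fun j => q j / (4 * Real.pi))
      (fun j => (y - x j).ofLp) (fun j => ‖y - x j‖⁻¹) := by
  rw [coulombField_eq]
  ext i
  simp [kernelSum, coulombKernel, mul_assoc]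

theorem ofLp_coulombDeriv {n : ℕ} (x : Fin n → Space) (q : Fin n → ℝ) (y h : Space) :
    (coulombDeriv x q y h).ofLp = kernelSumDeriv (fun j => q j / (4 * Real.pi))
      (fun j => (y - x j).ofLp) (fun j => ‖y - x j‖⁻¹) h.ofLp := by
  ext i
  simp [coulombDeriv, kernelSumDeriv, coulombKernelDeriv, inner_eq_dotProduct, sum_apply,
    mul_assoc]

theorem jetOf_coulombField {n : ℕ} (x : Fin n → Space) (g c : Fin n → ℝ) (y h k : Space) :
    jetOf (coulombField x g y) (coulombField x c y) (coulombDeriv x g y) (coulombDeriv x c y) h k =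
      kernelJet (fun j => g j / (4 * Real.pi)) (fun j => c j / (4 * Real.pi))
        (fun j => (y - x j).ofLp) (fun j => ‖y - x j‖⁻¹) h.ofLp k.ofLp := by
  simp only [jetOf, kernelJet, vecJet, inner_eq_dotProduct, ofLp_coulombField, ofLp_coulombDeriv]

/-- The point `X m + Y e` relative to the charge at distance `-d` from the origin, for a complex
coordinate `Y`. -/
def complexPoint (d m e : Space) (X : ℝ) (Y : ℂ) : Fin 3 → ℂ :=
  fun i => ((d i + X * m i : ℝ) : ℂ) + Y * (e i : ℂ)

/-- The inverse distance, continued analytically. -/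
def complexInvDist (d m e : Space) (X : ℝ) (Y : ℂ) : ℂ :=
  (complexPoint d m e X Y ⬝ᵥ complexPoint d m e X Y) ^ (-(1 / 2) : ℂ)

theorem complexPoint_dotProduct_self {d m e : Space} (hm : ‖m‖ = 1) (he : ‖e‖ = 1)
    (hme : (inner ℝ m e : ℝ) = 0) (X : ℝ) (Y : ℂ) :
    complexPoint d m e X Y ⬝ᵥ complexPoint d m e X Y =
      ((‖d‖ ^ 2 + 2 * X * inner ℝ d m + X ^ 2 : ℝ) : ℂ) + 2 * Y * ((inner ℝ d e : ℝ) : ℂ)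
        + Y ^ 2 := by
  have h1 : ((inner ℝ m m : ℝ) : ℂ) = 1 := by rw [real_inner_self_eq_norm_sq, hm]; norm_num
  have h2 : ((inner ℝ e e : ℝ) : ℂ) = 1 := by rw [real_inner_self_eq_norm_sq, he]; norm_num
  have h3 : ((inner ℝ m e : ℝ) : ℂ) = 0 := by rw [hme]; norm_num
  rw [← real_inner_self_eq_norm_sq]
  simp only [inner_eq_dotProduct, dotProduct, Fin.sum_univ_three, complexPoint] at h1 h2 h3 ⊢
  push_cast at h1 h2 h3 ⊢
  linear_combination (X : ℂ) ^ 2 * h1 + Y ^ 2 * h2 + 2 * X * Y * h3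

theorem re_complexPoint_pos {d m e : Space} (hm : ‖m‖ = 1) (he : ‖e‖ = 1)
    (hme : (inner ℝ m e : ℝ) = 0) {X : ℝ} (hX : 0 < X) (hd : d = 0 ∨ 8 * X < ‖d‖) {Y : ℂ}
    (hY : ‖Y‖ < X) : 0 < (complexPoint d m e X Y ⬝ᵥ complexPoint d m e X Y).re := by
  rw [complexPoint_dotProduct_self hm he hme]
  have hY2 : |(Y ^ 2).re| ≤ ‖Y‖ ^ 2 := (Complex.abs_re_le_norm _).trans (norm_pow Y 2).le
  have hY2' := (abs_le.1 hY2).1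
  have h0 := norm_nonneg Y
  rcases hd with rfl | hd
  · simp
    rw [← Complex.ofReal_pow, Complex.ofReal_re]
    nlinarith
  · have h1 := abs_le.1 (abs_real_inner_le_norm d m)
    have h2 : |(2 * Y * ((inner ℝ d e : ℝ) : ℂ)).re| ≤ 2 * ‖Y‖ * ‖d‖ := by
      refine (Complex.abs_re_le_norm _).trans ?_
      rw [norm_mul, norm_mul, Complex.norm_real, Complex.norm_ofNat]
      have := abs_real_inner_le_norm d e
      rw [he, mul_one] at this
      exact mul_le_mul_of_nonneg_left this (by positivity)
    have h2' := (abs_le.1 h2).1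
    rw [hm, mul_one] at h1
    rw [Complex.add_re, Complex.add_re, Complex.ofReal_re]
    have h3 : ‖Y‖ * ‖d‖ ≤ X * ‖d‖ := by gcongr
    have h4 : X * -‖d‖ ≤ X * inner ℝ d m := mul_le_mul_of_nonneg_left h1.1 hX.le
    nlinarith

theorem complexInvDist_ofReal {d m e : Space} (X Y : ℝ) :
    complexInvDist d m e X Y = ((‖d + X • m + Y • e‖⁻¹ : ℝ) : ℂ) := by
  have h1 : complexPoint d m e X Y ⬝ᵥ complexPoint d m e X Y =
      ((‖d + X • m + Y • e‖ ^ 2 : ℝ) : ℂ) := by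
    rw [← real_inner_self_eq_norm_sq, inner_eq_dotProduct]
    simp [dotProduct, complexPoint]
  rw [complexInvDist, h1]
  have h2 : (-(1 / 2) : ℂ) = ((-(1 / 2) : ℝ) : ℂ) := by push_cast; ring
  rw [h2, ← Complex.ofReal_cpow (by positivity)]
  congr 1
  rw [Real.rpow_neg (by positivity), ← Real.sqrt_eq_rpow, Real.sqrt_sq (norm_nonneg _)]

/-- All entries of a family of jets are holomorphic on `U`. -/
structure FieldJet.HolomorphicOn (J : ℂ → FieldJet ℂ) (U : Set ℂ) : Prop where
  s : DifferentiableOn ℂ (fun Y => (J Y).s) U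
  w : DifferentiableOn ℂ (fun Y => (J Y).w) U
  t : DifferentiableOn ℂ (fun Y => (J Y).t) U
  s₁ : DifferentiableOn ℂ (fun Y => (J Y).s₁) U
  w₁ : DifferentiableOn ℂ (fun Y => (J Y).w₁) U
  t₁ : DifferentiableOn ℂ (fun Y => (J Y).t₁) U
  s₂ : DifferentiableOn ℂ (fun Y => (J Y).s₂) U
  w₂ : DifferentiableOn ℂ (fun Y => (J Y).w₂) U
  t₂ : DifferentiableOn ℂ (fun Y => (J Y).t₂) U
  b₁ : DifferentiableOn ℂ (fun Y => (J Y).b₁) U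
  v₁ : DifferentiableOn ℂ (fun Y => (J Y).v₁) U
  b₂ : DifferentiableOn ℂ (fun Y => (J Y).b₂) U
  v₂ : DifferentiableOn ℂ (fun Y => (J Y).v₂) U

theorem differentiableOn_dotProduct {f g : ℂ → Fin 3 → ℂ} {U : Set ℂ}
    (hf : DifferentiableOn ℂ f U) (hg : DifferentiableOn ℂ g U) :
    DifferentiableOn ℂ (fun Y => f Y ⬝ᵥ g Y) U := by
  have hf' := differentiableOn_pi.1 hf
  have hg' := differentiableOn_pi.1 hg
  simp only [dotProduct]
  exact DifferentiableOn.fun_sum fun i _ => (hf' i).mul (hg' i)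

theorem holomorphicOn_kernelJet {n : ℕ} (b c : Fin n → ℂ) {z : ℂ → Fin n → Fin 3 → ℂ}
    {R : ℂ → Fin n → ℂ} {U : Set ℂ} (hz : ∀ j, DifferentiableOn ℂ (fun Y => z Y j) U)
    (hR : ∀ j, DifferentiableOn ℂ (fun Y => R Y j) U) (h k : Fin 3 → ℂ) :
    FieldJet.HolomorphicOn (fun Y => kernelJet b c (z Y) (R Y) h k) U := by
  have h1 : ∀ a : Fin n → ℂ, DifferentiableOn ℂ (fun Y => kernelSum a (z Y) (R Y)) U := fun a =>
    DifferentiableOn.fun_sum fun j _ => (((hR j).pow 3).const_mul (a j)).smul (hz j)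
  have h2 : ∀ (a : Fin n → ℂ) (m : Fin 3 → ℂ),
      DifferentiableOn ℂ (fun Y => kernelSumDeriv a (z Y) (R Y) m) U := fun a m =>
    DifferentiableOn.fun_sum fun j _ => ((((hR j).pow 3).smul (differentiableOn_const m)).sub
      (((((hR j).pow 5).const_mul 3).mul (differentiableOn_dotProduct (hz j)
        (differentiableOn_const m))).smul (hz j))).const_smul (a j)
  constructor
  · exact differentiableOn_dotProduct (h1 b) (h1 b)
  · exact differentiableOn_dotProduct (h1 b) (h1 c)
  · exact differentiableOn_dotProduct (h1 c) (h1 c)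
  · exact (differentiableOn_dotProduct (h1 b) (h2 b h)).const_mul 2
  · exact (differentiableOn_dotProduct (h1 b) (h2 c h)).add
      (differentiableOn_dotProduct (h2 b h) (h1 c))
  · exact (differentiableOn_dotProduct (h1 c) (h2 c h)).const_mul 2
  · exact (differentiableOn_dotProduct (h1 b) (h2 b k)).const_mul 2
  · exact (differentiableOn_dotProduct (h1 b) (h2 c k)).add
      (differentiableOn_dotProduct (h2 b k) (h1 c))
  · exact (differentiableOn_dotProduct (h1 c) (h2 c k)).const_mul 2
  · exact differentiableOn_dotProduct (h1 b) (differentiableOn_const h)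
  · exact differentiableOn_dotProduct (h1 c) (differentiableOn_const h)
  · exact differentiableOn_dotProduct (h1 b) (differentiableOn_const k)
  · exact differentiableOn_dotProduct (h1 c) (differentiableOn_const k)

/-- A holomorphic identity between the jets of Coulomb fields that holds at the real points near
the charge `x i` holds at complex points of a plane through `x i`. -/
theorem eq_zero_on_complexPoint {n : ℕ} {x : Fin n → Space} {g c : Fin n → ℝ} {i : Fin n}
    {m e : Space} (hm : ‖m‖ = 1) (he : ‖e‖ = 1) (hme : (inner ℝ m e : ℝ) = 0)
    {Φ : FieldJet ℂ → ℂ}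
    (hΦ : ∀ (J : ℂ → FieldJet ℂ) (U : Set ℂ), FieldJet.HolomorphicOn J U →
      DifferentiableOn ℂ (fun Y => Φ (J Y)) U)
    {δ : ℝ} (hδ : ∀ y : Space, y ≠ x i → ‖y - x i‖ < δ →
      Φ ((jetOf (coulombField x g y) (coulombField x c y) (coulombDeriv x g y)
        (coulombDeriv x c y) m e).map Complex.ofReal) = 0)
    {X : ℝ} (hX : 0 < X) (hXδ : 2 * X < δ) (hd : ∀ j, x i - x j = 0 ∨ 8 * X < ‖x i - x j‖)
    {Y : ℂ} (hY : ‖Y‖ < X) :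
    Φ (kernelJet (fun j => ((g j / (4 * Real.pi) : ℝ) : ℂ))
      (fun j => ((c j / (4 * Real.pi) : ℝ) : ℂ))
      (fun j => complexPoint (x i - x j) m e X Y) (fun j => complexInvDist (x i - x j) m e X Y)
      (fun l => (m l : ℂ)) (fun l => (e l : ℂ))) = 0 := by
  set U : Set ℂ := Metric.ball 0 X with hU
  set f : ℂ → ℂ := fun Y => Φ (kernelJet (fun j => ((g j / (4 * Real.pi) : ℝ) : ℂ))
      (fun j => ((c j / (4 * Real.pi) : ℝ) : ℂ))
      (fun j => complexPoint (x i - x j) m e X Y) (fun j => complexInvDist (x i - x j) m e X Y)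
      (fun l => (m l : ℂ)) (fun l => (e l : ℂ))) with hf
  have hzd : ∀ j, Differentiable ℂ fun Y => complexPoint (x i - x j) m e X Y := fun j =>
    differentiable_pi.2 fun l => by
      unfold complexPoint
      fun_prop
  have hRd : ∀ j, DifferentiableOn ℂ (fun Y => complexInvDist (x i - x j) m e X Y) U := by
    intro j
    refine DifferentiableOn.cpow (differentiableOn_dotProduct (hzd j).differentiableOn
      (hzd j).differentiableOn) (differentiableOn_const _) fun Y hY => Or.inl ?_
    exact re_complexPoint_pos hm he hme hX (hd j) (mem_ball_zero_iff.1 hY)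
  have hfd : DifferentiableOn ℂ f U :=
    hΦ _ _ (holomorphicOn_kernelJet _ _ (fun j => (hzd j).differentiableOn) hRd _ _)
  -- `f` is holomorphic on the disc `‖Y‖ < X`, where no distance to a charge vanishes. It is zero on
  -- the real diameter, hence everywhere.
  have hreal : ∀ Y : ℝ, |Y| < X → f Y = 0 := by
    intro Y hY
    set y : Space := x i + X • m + Y • e with hy
    have hyx : ∀ j, y - x j = (x i - x j) + X • m + Y • e := fun j => by rw [hy]; abel
    have hn2 : ‖y - x i‖ ^ 2 = X ^ 2 + Y ^ 2 := by
      rw [hyx, sub_self, zero_add, norm_add_sq_real, inner_smul_left, inner_smul_right, hme,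
        norm_smul, norm_smul, hm, he]
      simp
    have hne : y ≠ x i := by
      intro h0
      rw [h0, sub_self, norm_zero] at hn2
      nlinarith [sq_nonneg Y]
    have hlt : ‖y - x i‖ < δ := by
      have h1 := abs_lt.1 hY
      refine lt_of_pow_lt_pow_left₀ 2 (by linarith) ?_
      rw [hn2]
      nlinarith
    have h1 := hδ y hne hlt
    rw [jetOf_coulombField, kernelJet_map] at h1
    rw [hf, ← h1]
    simp only [complexInvDist_ofReal, ← hyx]
    congr 2
    ext j l
    rw [hyx]
    simp [complexPoint]
  have han : AnalyticOnNhd ℂ f U := hfd.analyticOnNhd Metric.isOpen_ball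
  have hfreq : ∃ᶠ Y in 𝓝[≠] (0 : ℂ), f Y = 0 := by
    have h1 : Tendsto (fun k : ℕ => (((1 : ℝ) / ((k : ℝ) + 1) : ℝ) : ℂ)) atTop (𝓝[≠] 0) := by
      refine tendsto_nhdsWithin_iff.2 ⟨?_, Eventually.of_forall fun k => ?_⟩
      · have : Tendsto (fun k : ℕ => (((1 : ℝ) / ((k : ℝ) + 1) : ℝ) : ℂ)) atTop
            (𝓝 ((0 : ℝ) : ℂ)) :=
          (Complex.continuous_ofReal.tendsto 0).comp tendsto_one_div_add_atTop_nhds_zero_nat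
        simpa only [Complex.ofReal_zero] using this
      · have : (1 : ℝ) / ((k : ℝ) + 1) ≠ 0 := by positivity
        simpa using Complex.ofReal_ne_zero.2 this
    refine h1.frequently (Eventually.frequently ?_)
    have h2 := tendsto_one_div_add_atTop_nhds_zero_nat (𝕜 := ℝ)
    filter_upwards [h2.eventually (gt_mem_nhds hX)] with k hk
    refine hreal _ ?_
    rwa [abs_of_pos (by positivity)]
  exact han.eqOn_zero_of_preconnected_of_frequently_eq_zero (convex_ball 0 X).isPreconnected
    (Metric.mem_ball_self hX) hfreq (mem_ball_zero_iff.2 hY)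

/-! ### Asymptotics of the polynomial identities at the null cone of a charge -/

/-- The jet in the null directions `(e₁ - i e₂)/2` and `(e₁ + i e₂)/2` of the jet in the directions
`e₁`, `e₂`. -/
def FieldJet.rotate (J : FieldJet ℂ) : FieldJet ℂ where
  s := J.s
  w := J.w
  t := J.t
  s₁ := (J.s₁ - Complex.I * J.s₂) / 2
  w₁ := (J.w₁ - Complex.I * J.w₂) / 2
  t₁ := (J.t₁ - Complex.I * J.t₂) / 2
  s₂ := (J.s₁ + Complex.I * J.s₂) / 2
  w₂ := (J.w₁ + Complex.I * J.w₂) / 2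
  t₂ := (J.t₁ + Complex.I * J.t₂) / 2
  b₁ := (J.b₁ - Complex.I * J.b₂) / 2
  v₁ := (J.v₁ - Complex.I * J.v₂) / 2
  b₂ := (J.b₁ + Complex.I * J.b₂) / 2
  v₂ := (J.v₁ + Complex.I * J.v₂) / 2

theorem coreObstruction_rotate (J : FieldJet ℂ) :
    J.rotate.coreObstruction = Complex.I / 2 * J.coreObstruction := by
  simp only [FieldJet.coreObstruction, FieldJet.rotate]
  ring

theorem electricObstruction_rotate (β κ l : ℂ) (J : FieldJet ℂ) :
    J.rotate.electricObstruction β κ l = Complex.I / 2 * J.electricObstruction β κ l := by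
  have e1 : J.rotate.det β κ l = J.det β κ l := rfl
  simp only [FieldJet.electricObstruction, e1]
  generalize J.det β κ l = d
  simp only [FieldJet.curlE, FieldJet.detDeriv, FieldJet.dirE, FieldJet.rotate]
  ring

theorem magneticObstruction_rotate (β κ l : ℂ) (J : FieldJet ℂ) :
    J.rotate.magneticObstruction β κ l = Complex.I / 2 * J.magneticObstruction β κ l := by
  have e1 : J.rotate.det β κ l = J.det β κ l := rfl
  simp only [FieldJet.magneticObstruction, FieldJet.denomSq, FieldJet.denomSqDeriv, FieldJet.curlH,
    FieldJet.leadDeriv, FieldJet.mixDeriv, FieldJet.dirH, e1]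
  generalize J.det β κ l = d
  simp only [FieldJet.curlE, FieldJet.detDeriv, FieldJet.dirE, FieldJet.rotate]
  ring

theorem tendsto_of_eq {ι : Type*} {f g : ι → ℂ} {F : Filter ι} {a b : ℂ} (h : Tendsto f F (𝓝 a))
    (hf : ∀ i, f i = g i) (ha : a = b) : Tendsto g F (𝓝 b) := by
  rw [← ha]
  exact h.congr hf

/-- The growth of a jet of fields in the null directions, as the null cone `e = 0` of a charge of
strength `b` is approached while the coordinate `ξ` along the cone is fixed; `S` is the component of
the regular field `V` along the cone and `v'` the derivative of `ξ S`. -/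
structure FieldJet.ConeAsymptotics {ι : Type*} (F : Filter ι) (e : ι → ℂ) (J : ι → FieldJet ℂ)
    (b ξ S v' t₀ t₁ t₂ T : ℂ) : Prop where
  small : Tendsto e F (𝓝 0)
  s : Tendsto (fun i => e i ^ 4 * (J i).s) F (𝓝 (b ^ 2))
  w : Tendsto (fun i => e i ^ 3 * (J i).w) F (𝓝 (b * (ξ * S)))
  t : Tendsto (fun i => (J i).t) F (𝓝 t₀)
  s₁ : Tendsto (fun i => e i ^ 4 * (J i).s₁) F (𝓝 (-2 * b ^ 2 / ξ))
  w₁ : Tendsto (fun i => e i ^ 3 * (J i).w₁) F (𝓝 (b * (v' - 3 / 2 * S)))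
  t₁ : Tendsto (fun i => (J i).t₁) F (𝓝 t₁)
  s₂ : Tendsto (fun i => e i ^ 6 * (J i).s₂) F (𝓝 (-2 * b ^ 2 * ξ))
  w₂ : Tendsto (fun i => e i ^ 5 * (J i).w₂) F (𝓝 (-(3 / 2) * b * ξ * (ξ * S)))
  t₂ : Tendsto (fun i => (J i).t₂) F (𝓝 t₂)
  b₁ : Tendsto (fun i => e i * (J i).b₁) F (𝓝 (b / (2 * ξ)))
  v₁ : Tendsto (fun i => (J i).v₁) F (𝓝 S)
  b₂ : Tendsto (fun i => e i ^ 3 * (J i).b₂) F (𝓝 (b * ξ / 2))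
  v₂ : Tendsto (fun i => (J i).v₂) F (𝓝 T)

namespace FieldJet.ConeAsymptotics

variable {ι : Type*} {F : Filter ι} {e : ι → ℂ} {J : ι → FieldJet ℂ}
  {b ξ S v' t₀ t₁ t₂ T : ℂ}

theorem tendsto_one_add (h : FieldJet.ConeAsymptotics F e J b ξ S v' t₀ t₁ t₂ T)
    (c : ℂ) :
    Tendsto (fun i => e i ^ 4 * (1 + c * (J i).s)) F (𝓝 (c * b ^ 2)) :=
  tendsto_of_eq ((h.small.pow 4).add (h.s.const_mul c)) (fun i => by ring) (by ring)

theorem tendsto_det (h : FieldJet.ConeAsymptotics F e J b ξ S v' t₀ t₁ t₂ T)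
    (β κ l : ℂ) :
    Tendsto (fun i => e i ^ 6 * (J i).det β κ l) F (𝓝 (-β * κ ^ 2 * b ^ 2 * (ξ * S) ^ 2)) :=
  tendsto_of_eq (((h.small.pow 2).mul (h.tendsto_one_add (κ ^ 2))).add
    ((((((h.small.pow 2).mul h.s).const_mul (l ^ 2)).add
      (((h.small.pow 3).mul h.w).const_mul (2 * l))).add ((h.small.pow 6).mul h.t)).add
      ((((h.small.pow 2).mul (h.s.mul h.t)).sub (h.w.pow 2)).const_mul (κ ^ 2)) |>.const_mul β))
    (fun i => by simp only [FieldJet.det]; ring) (by ring)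

theorem tendsto_detDeriv₁ (h : FieldJet.ConeAsymptotics F e J b ξ S v' t₀ t₁ t₂ T)
    (β κ l : ℂ) (hξ : ξ ≠ 0) :
    Tendsto (fun i => e i ^ 6 * (J i).detDeriv β κ l (J i).s₁ (J i).w₁ (J i).t₁) F
      (𝓝 (β * κ ^ 2 * b ^ 2 * (3 * ξ * S ^ 2 - 2 * ξ * S * v'))) :=
  tendsto_of_eq ((((h.small.pow 2).mul h.s₁).const_mul (κ ^ 2)).add
    ((((((h.small.pow 2).mul h.s₁).const_mul (l ^ 2)).add
      (((h.small.pow 3).mul h.w₁).const_mul (2 * l))).add ((h.small.pow 6).mul h.t₁)).add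
      (((((h.small.pow 2).mul (h.s₁.mul h.t))).add ((h.small.pow 2).mul (h.s.mul h.t₁))).sub
        ((h.w.mul h.w₁).const_mul 2) |>.const_mul (κ ^ 2)) |>.const_mul β))
    (fun i => by simp only [FieldJet.detDeriv]; ring) (by field_simp; ring)

theorem tendsto_detDeriv₂ (h : FieldJet.ConeAsymptotics F e J b ξ S v' t₀ t₁ t₂ T)
    (β κ l : ℂ) :
    Tendsto (fun i => e i ^ 8 * (J i).detDeriv β κ l (J i).s₂ (J i).w₂ (J i).t₂) F
      (𝓝 (3 * β * κ ^ 2 * b ^ 2 * ξ * (ξ * S) ^ 2)) :=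
  tendsto_of_eq ((((h.small.pow 2).mul h.s₂).const_mul (κ ^ 2)).add
    ((((((h.small.pow 2).mul h.s₂).const_mul (l ^ 2)).add
      (((h.small.pow 3).mul h.w₂).const_mul (2 * l))).add ((h.small.pow 8).mul h.t₂)).add
      (((((h.small.pow 2).mul (h.s₂.mul h.t))).add ((h.small.pow 4).mul (h.s.mul h.t₂))).sub
        ((h.w.mul h.w₂).const_mul 2) |>.const_mul (κ ^ 2)) |>.const_mul β))
    (fun i => by simp only [FieldJet.detDeriv]; ring) (by ring)

theorem tendsto_dirE₁ (h : FieldJet.ConeAsymptotics F e J b ξ S v' t₀ t₁ t₂ T)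
    (κ l : ℂ) (hξ : ξ ≠ 0) :
    Tendsto (fun i => e i ^ 4 * (J i).dirE κ l (J i).b₁ (J i).v₁) F
      (𝓝 (κ ^ 2 * b ^ 2 * S / 2)) :=
  tendsto_of_eq (((((h.small.pow 3).mul h.b₁).const_mul l).sub
    ((h.w.mul h.b₁).const_mul (κ ^ 2))).add ((h.tendsto_one_add (κ ^ 2)).mul h.v₁))
    (fun i => by simp only [FieldJet.dirE]; ring) (by field_simp; ring)

theorem tendsto_dirE₂ (h : FieldJet.ConeAsymptotics F e J b ξ S v' t₀ t₁ t₂ T)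
    (κ l : ℂ) :
    Tendsto (fun i => e i ^ 6 * (J i).dirE κ l (J i).b₂ (J i).v₂) F
      (𝓝 (-κ ^ 2 * b ^ 2 * (ξ * S) * ξ / 2)) :=
  tendsto_of_eq (((((h.small.pow 3).mul h.b₂).const_mul l).sub
    ((h.w.mul h.b₂).const_mul (κ ^ 2))).add
    ((h.small.pow 2).mul ((h.tendsto_one_add (κ ^ 2)).mul h.v₂)))
    (fun i => by simp only [FieldJet.dirE]; ring) (by ring)

theorem tendsto_curlE (h : FieldJet.ConeAsymptotics F e J b ξ S v' t₀ t₁ t₂ T)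
    (κ : ℂ) (hξ : ξ ≠ 0) :
    Tendsto (fun i => e i ^ 6 * (J i).curlE κ) F
      (𝓝 (κ ^ 2 * b ^ 2 * (2 * (ξ * S) - ξ * v' / 2))) :=
  tendsto_of_eq (((((h.small.pow 2).mul (h.s₁.mul h.v₂)).sub (h.s₂.mul h.v₁)).const_mul (κ ^ 2)).sub
    (((h.w₁.mul h.b₂).sub (h.w₂.mul h.b₁)).const_mul (κ ^ 2)))
    (fun i => by simp only [FieldJet.curlE]; ring) (by field_simp; ring)

/-- The leading term of the polynomial identity of `dyonE` is the cube of the component of `V`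
along the null cone. -/
theorem tendsto_electricObstruction (h : FieldJet.ConeAsymptotics F e J b ξ S v' t₀ t₁ t₂ T)
    (β κ l : ℂ) (hξ : ξ ≠ 0) :
    Tendsto (fun i => e i ^ 20 * (J i).electricObstruction β κ l) F
      (𝓝 (-β ^ 2 * κ ^ 6 * b ^ 8 * (ξ * S) ^ 3)) := by
  have hq := h.tendsto_one_add β
  have hu := h.tendsto_one_add (κ ^ 2)
  have hd := h.tendsto_det β κ l
  have hM := hu.mul hd
  have hM₁ := ((((h.small.pow 0).mul h.s₁).const_mul (κ ^ 2)).mul hd).add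
    (hu.mul (h.tendsto_detDeriv₁ β κ l hξ))
  have hM₂ := ((h.s₂.const_mul (κ ^ 2)).mul hd).add (hu.mul (h.tendsto_detDeriv₂ β κ l))
  refine tendsto_of_eq ((((hq.mul hM).mul (h.tendsto_curlE κ hξ)).const_mul 2).add
    (((((h.s₁.const_mul β).mul hM).sub (hq.mul hM₁)).mul (h.tendsto_dirE₂ κ l)).sub
    ((((h.s₂.const_mul β).mul hM).sub (hq.mul hM₂)).mul (h.tendsto_dirE₁ κ l hξ)))) (fun i => ?_) ?_
  · simp only [FieldJet.electricObstruction]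
    ring
  · field_simp
    ring

theorem tendsto_leadDeriv₁ (h : FieldJet.ConeAsymptotics F e J b ξ S v' t₀ t₁ t₂ T)
    (β κ l : ℂ) (hξ : ξ ≠ 0) :
    Tendsto (fun i => e i ^ 10 * (J i).leadDeriv β κ l (J i).s₁ (J i).w₁ (J i).t₁) F
      (𝓝 (β * κ ^ 4 * b ^ 4 * (5 * ξ * S ^ 2 - 2 * ξ * S * v'))) :=
  tendsto_of_eq (((h.s₁.const_mul (κ ^ 2)).mul (h.tendsto_det β κ l)).add
    ((h.tendsto_one_add (κ ^ 2)).mul (h.tendsto_detDeriv₁ β κ l hξ)))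
    (fun i => by simp only [FieldJet.leadDeriv]; ring) (by field_simp; ring)

theorem tendsto_leadDeriv₂ (h : FieldJet.ConeAsymptotics F e J b ξ S v' t₀ t₁ t₂ T)
    (β κ l : ℂ) :
    Tendsto (fun i => e i ^ 12 * (J i).leadDeriv β κ l (J i).s₂ (J i).w₂ (J i).t₂) F
      (𝓝 (5 * β * κ ^ 4 * b ^ 4 * ξ * (ξ * S) ^ 2)) :=
  tendsto_of_eq (((h.s₂.const_mul (κ ^ 2)).mul (h.tendsto_det β κ l)).add
    ((h.tendsto_one_add (κ ^ 2)).mul (h.tendsto_detDeriv₂ β κ l)))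
    (fun i => by simp only [FieldJet.leadDeriv]; ring) (by ring)

theorem tendsto_mix (h : FieldJet.ConeAsymptotics F e J b ξ S v' t₀ t₁ t₂ T)
    (l : ℂ) : Tendsto (fun i => e i ^ 4 * (l * (J i).s + (J i).w)) F (𝓝 (l * b ^ 2)) :=
  tendsto_of_eq ((h.s.const_mul l).add (h.small.mul h.w)) (fun i => by ring) (by ring)

theorem tendsto_mixDeriv₁ (h : FieldJet.ConeAsymptotics F e J b ξ S v' t₀ t₁ t₂ T)
    (β l : ℂ) (hξ : ξ ≠ 0) :
    Tendsto (fun i => e i ^ 8 * (J i).mixDeriv β l (J i).s₁ (J i).w₁) F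
      (𝓝 (-4 * β * l * b ^ 4 / ξ)) :=
  tendsto_of_eq (((h.s₁.const_mul β).mul (h.tendsto_mix l)).add
    ((h.tendsto_one_add β).mul ((h.s₁.const_mul l).add (h.small.mul h.w₁))))
    (fun i => by simp only [FieldJet.mixDeriv]; ring) (by field_simp; ring)

theorem tendsto_mixDeriv₂ (h : FieldJet.ConeAsymptotics F e J b ξ S v' t₀ t₁ t₂ T)
    (β l : ℂ) :
    Tendsto (fun i => e i ^ 10 * (J i).mixDeriv β l (J i).s₂ (J i).w₂) F
      (𝓝 (-4 * β * l * b ^ 4 * ξ)) :=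
  tendsto_of_eq (((h.s₂.const_mul β).mul (h.tendsto_mix l)).add
    ((h.tendsto_one_add β).mul ((h.s₂.const_mul l).add (h.small.mul h.w₂))))
    (fun i => by simp only [FieldJet.mixDeriv]; ring) (by ring)

theorem tendsto_curlH (h : FieldJet.ConeAsymptotics F e J b ξ S v' t₀ t₁ t₂ T)
    (β κ l : ℂ) (hξ : ξ ≠ 0) :
    Tendsto (fun i => e i ^ 14 * (J i).curlH β κ l) F
      (𝓝 (-κ ^ 4 * β * l * b ^ 6 * (6 * (ξ * S) - ξ * v' / 2))) := by
  refine tendsto_of_eq ((h.small.mul (((h.tendsto_leadDeriv₁ β κ l hξ).mul h.b₂).sub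
    ((h.tendsto_leadDeriv₂ β κ l).mul h.b₁))).sub
    (((((h.tendsto_mixDeriv₁ β l hξ).mul (h.tendsto_dirE₂ κ l)).sub
      ((h.tendsto_mixDeriv₂ β l).mul (h.tendsto_dirE₁ κ l hξ))).add
      (((h.tendsto_one_add β).mul (h.tendsto_mix l)).mul (h.tendsto_curlE κ hξ))).const_mul
        (κ ^ 2))) (fun i => ?_) ?_
  · simp only [FieldJet.curlH]
    ring
  · field_simp
    ring

theorem tendsto_dirH₁ (h : FieldJet.ConeAsymptotics F e J b ξ S v' t₀ t₁ t₂ T)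
    (β κ l : ℂ) (hξ : ξ ≠ 0) :
    Tendsto (fun i => e i ^ 12 * (J i).dirH β κ l (J i).b₁ (J i).v₁) F
      (𝓝 (-κ ^ 4 * β * l * b ^ 6 * S / 2)) :=
  tendsto_of_eq ((h.small.mul (((h.tendsto_one_add (κ ^ 2)).mul (h.tendsto_det β κ l)).mul h.b₁)).sub
    ((((h.tendsto_one_add β).mul (h.tendsto_mix l)).const_mul (κ ^ 2)).mul
      (h.tendsto_dirE₁ κ l hξ)))
    (fun i => by simp only [FieldJet.dirH]; ring) (by ring)

theorem tendsto_dirH₂ (h : FieldJet.ConeAsymptotics F e J b ξ S v' t₀ t₁ t₂ T)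
    (β κ l : ℂ) :
    Tendsto (fun i => e i ^ 14 * (J i).dirH β κ l (J i).b₂ (J i).v₂) F
      (𝓝 (κ ^ 4 * β * l * b ^ 6 * (ξ * S) * ξ / 2)) :=
  tendsto_of_eq ((h.small.mul (((h.tendsto_one_add (κ ^ 2)).mul (h.tendsto_det β κ l)).mul h.b₂)).sub
    ((((h.tendsto_one_add β).mul (h.tendsto_mix l)).const_mul (κ ^ 2)).mul
      (h.tendsto_dirE₂ κ l)))
    (fun i => by simp only [FieldJet.dirH]; ring) (by ring)

theorem tendsto_denomSq (h : FieldJet.ConeAsymptotics F e J b ξ S v' t₀ t₁ t₂ T)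
    (β κ l : ℂ) :
    Tendsto (fun i => e i ^ 22 * (J i).denomSq β κ l) F
      (𝓝 (-β ^ 2 * κ ^ 8 * b ^ 10 * (ξ * S) ^ 2)) :=
  tendsto_of_eq (((h.tendsto_one_add β).mul ((h.tendsto_one_add (κ ^ 2)).pow 3)).mul
    (h.tendsto_det β κ l)) (fun i => by simp only [FieldJet.denomSq]; ring) (by ring)

theorem tendsto_denomSqDeriv₁ (h : FieldJet.ConeAsymptotics F e J b ξ S v' t₀ t₁ t₂ T)
    (β κ l : ℂ) (hξ : ξ ≠ 0) :
    Tendsto (fun i => e i ^ 22 * (J i).denomSqDeriv β κ l (J i).s₁ (J i).w₁ (J i).t₁) F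
      (𝓝 (β ^ 2 * κ ^ 8 * b ^ 10 * (11 * ξ * S ^ 2 - 2 * ξ * S * v'))) :=
  tendsto_of_eq (((((h.s₁.const_mul β).mul ((h.tendsto_one_add (κ ^ 2)).pow 3)).mul
    (h.tendsto_det β κ l)).add (((h.tendsto_one_add β).mul
      ((((h.tendsto_one_add (κ ^ 2)).pow 2).const_mul 3).mul (h.s₁.const_mul (κ ^ 2)))).mul
        (h.tendsto_det β κ l))).add
    (((h.tendsto_one_add β).mul ((h.tendsto_one_add (κ ^ 2)).pow 3)).mul
      (h.tendsto_detDeriv₁ β κ l hξ)))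
    (fun i => by simp only [FieldJet.denomSqDeriv]; ring) (by field_simp; ring)

theorem tendsto_denomSqDeriv₂ (h : FieldJet.ConeAsymptotics F e J b ξ S v' t₀ t₁ t₂ T)
    (β κ l : ℂ) :
    Tendsto (fun i => e i ^ 24 * (J i).denomSqDeriv β κ l (J i).s₂ (J i).w₂ (J i).t₂) F
      (𝓝 (11 * β ^ 2 * κ ^ 8 * b ^ 10 * ξ * (ξ * S) ^ 2)) :=
  tendsto_of_eq (((((h.s₂.const_mul β).mul ((h.tendsto_one_add (κ ^ 2)).pow 3)).mul
    (h.tendsto_det β κ l)).add (((h.tendsto_one_add β).mul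
      ((((h.tendsto_one_add (κ ^ 2)).pow 2).const_mul 3).mul (h.s₂.const_mul (κ ^ 2)))).mul
        (h.tendsto_det β κ l))).add
    (((h.tendsto_one_add β).mul ((h.tendsto_one_add (κ ^ 2)).pow 3)).mul
      (h.tendsto_detDeriv₂ β κ l)))
    (fun i => by simp only [FieldJet.denomSqDeriv]; ring) (by ring)

/-- The leading term of the polynomial identity of `dyonH` is the cube of the component of `V`
along the null cone. -/
theorem tendsto_magneticObstruction (h : FieldJet.ConeAsymptotics F e J b ξ S v' t₀ t₁ t₂ T)
    (β κ l : ℂ) (hξ : ξ ≠ 0) :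
    Tendsto (fun i => e i ^ 36 * (J i).magneticObstruction β κ l) F
      (𝓝 (β ^ 3 * κ ^ 12 * l * b ^ 16 * (ξ * S) ^ 3)) := by
  refine tendsto_of_eq (((((h.tendsto_denomSq β κ l).mul (h.tendsto_curlH β κ l hξ)).const_mul 2).sub
    ((h.tendsto_denomSqDeriv₁ β κ l hξ).mul (h.tendsto_dirH₂ β κ l))).add
    ((h.tendsto_denomSqDeriv₂ β κ l).mul (h.tendsto_dirH₁ β κ l hξ))) (fun i => ?_) ?_
  · simp only [FieldJet.magneticObstruction]
    ring
  · field_simp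
    ring

end FieldJet.ConeAsymptotics

/-! ### Coulomb fields near the null cone of a charge -/

section

theorem tendsto_dotProduct {ι : Type*} {F : Filter ι} {f g : ι → Fin 3 → ℂ} {a b : Fin 3 → ℂ}
    (hf : Tendsto f F (𝓝 a)) (hg : Tendsto g F (𝓝 b)) :
    Tendsto (fun i => f i ⬝ᵥ g i) F (𝓝 (a ⬝ᵥ b)) := by
  have hf' := tendsto_pi_nhds.1 hf
  have hg' := tendsto_pi_nhds.1 hg
  simp only [dotProduct]
  exact tendsto_finsetSum _ fun i _ => (hf' i).mul (hg' i)

variable {ι : Type*} {F : Filter ι} {e : ι → ℂ} {N N' : Fin 3 → ℂ} {ξ b : ℂ}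
  {z G V G₁ V₁ G₂ V₂ : ι → Fin 3 → ℂ} {g v g₁ v₁ g₂ v₂ : Fin 3 → ℂ}

/-- A Coulomb singularity plus a regular field. -/
def singularField (b e : ℂ) (z G : Fin 3 → ℂ) : Fin 3 → ℂ := (b * e⁻¹ ^ 3) • z + G

/-- The derivative of `singularField` in the direction `h`. -/
def singularFieldDeriv (b e : ℂ) (z h G' : Fin 3 → ℂ) : Fin 3 → ℂ :=
  b • (e⁻¹ ^ 3 • h - (3 * e⁻¹ ^ 5 * (z ⬝ᵥ h)) • z) + G'

theorem singularField_dotProduct (b e : ℂ) (z G w : Fin 3 → ℂ) :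
    singularField b e z G ⬝ᵥ w = b * e⁻¹ ^ 3 * (z ⬝ᵥ w) + G ⬝ᵥ w := by
  simp [singularField, add_dotProduct, smul_dotProduct]

theorem singularFieldDeriv_dotProduct (b e : ℂ) (z h G' w : Fin 3 → ℂ) :
    singularFieldDeriv b e z h G' ⬝ᵥ w =
      b * (e⁻¹ ^ 3 * (h ⬝ᵥ w) - 3 * e⁻¹ ^ 5 * (z ⬝ᵥ h) * (z ⬝ᵥ w)) + G' ⬝ᵥ w := by
  simp [singularFieldDeriv, add_dotProduct, smul_dotProduct, sub_dotProduct]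

theorem singularField_dotProduct_self {b e : ℂ} {z : Fin 3 → ℂ} (he : e ≠ 0) (hz : z ⬝ᵥ z = e ^ 2)
    (G : Fin 3 → ℂ) : e ^ 4 * (singularField b e z G ⬝ᵥ singularField b e z G) =
      b ^ 2 + 2 * b * e * (z ⬝ᵥ G) + e ^ 4 * (G ⬝ᵥ G) := by
  rw [singularField_dotProduct, dotProduct_comm z, dotProduct_comm G, singularField_dotProduct,
    singularField_dotProduct, hz, dotProduct_comm G z]
  field_simp
  ring

theorem singularField_dotProduct_deriv {b e : ℂ} {z : Fin 3 → ℂ} (he : e ≠ 0)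
    (hz : z ⬝ᵥ z = e ^ 2) (h G G' : Fin 3 → ℂ) :
    e ^ 6 * (singularField b e z G ⬝ᵥ singularFieldDeriv b e z h G') =
      -2 * b ^ 2 * (z ⬝ᵥ h) + b * e ^ 3 * (z ⬝ᵥ G' + h ⬝ᵥ G)
        - 3 * b * e * (z ⬝ᵥ h) * (z ⬝ᵥ G) + e ^ 6 * (G ⬝ᵥ G') := by
  rw [dotProduct_comm, singularFieldDeriv_dotProduct, dotProduct_comm h (singularField b e z G),
    dotProduct_comm z (singularField b e z G), dotProduct_comm G' (singularField b e z G),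
    singularField_dotProduct, singularField_dotProduct, singularField_dotProduct, hz,
    dotProduct_comm G z, dotProduct_comm G h]
  field_simp
  ring

theorem singularField_dotProduct_add {b e : ℂ} {z : Fin 3 → ℂ} (he : e ≠ 0)
    (h G G' V V' : Fin 3 → ℂ) :
    e ^ 5 * (singularField b e z G ⬝ᵥ V' + singularFieldDeriv b e z h G' ⬝ᵥ V) =
      b * e ^ 2 * (z ⬝ᵥ V' + h ⬝ᵥ V) - 3 * b * (z ⬝ᵥ h) * (z ⬝ᵥ V)
        + e ^ 5 * (G ⬝ᵥ V' + G' ⬝ᵥ V) := by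
  rw [singularFieldDeriv_dotProduct, singularField_dotProduct]
  field_simp
  ring

/-- Two Coulomb fields of which only the first is singular at a charge, along a path on which the
complex position `z` relative to the charge tends to the null vector `ξ N`. -/
structure ConePath {ι : Type*} (F : Filter ι) (e : ι → ℂ) (N N' : Fin 3 → ℂ) (ξ : ℂ)
    (z G V G₁ V₁ G₂ V₂ : ι → Fin 3 → ℂ) (g v g₁ v₁ g₂ v₂ : Fin 3 → ℂ) : Prop where
  ξ_ne : ξ ≠ 0
  null : N ⬝ᵥ N = 0
  null' : N' ⬝ᵥ N' = 0
  pair : N ⬝ᵥ N' = 1 / 2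
  small : Tendsto e F (𝓝 0)
  ne : ∀ i, e i ≠ 0
  z_eq : ∀ i, z i = ξ • N + (e i ^ 2 / ξ) • N'
  G : Tendsto G F (𝓝 g)
  V : Tendsto V F (𝓝 v)
  G₁ : Tendsto G₁ F (𝓝 g₁)
  V₁ : Tendsto V₁ F (𝓝 v₁)
  G₂ : Tendsto G₂ F (𝓝 g₂)
  V₂ : Tendsto V₂ F (𝓝 v₂)

namespace ConePath

theorem sq (h : ConePath F e N N' ξ z G V G₁ V₁ G₂ V₂ g v g₁ v₁ g₂ v₂) (i : ι) :
    z i ⬝ᵥ z i = e i ^ 2 := by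
  have := h.ξ_ne
  rw [h.z_eq]
  simp only [add_dotProduct, dotProduct_add, smul_dotProduct, dotProduct_smul, smul_eq_mul, h.null,
    h.null', h.pair, dotProduct_comm N' N]
  field_simp
  ring

theorem dot (h : ConePath F e N N' ξ z G V G₁ V₁ G₂ V₂ g v g₁ v₁ g₂ v₂) (i : ι) :
    z i ⬝ᵥ N = e i ^ 2 / (2 * ξ) := by
  have := h.ξ_ne
  rw [h.z_eq]
  simp only [add_dotProduct, smul_dotProduct, smul_eq_mul, h.null, h.pair, dotProduct_comm N' N]
  field_simp
  ring

theorem dot' (h : ConePath F e N N' ξ z G V G₁ V₁ G₂ V₂ g v g₁ v₁ g₂ v₂) (i : ι) :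
    z i ⬝ᵥ N' = ξ / 2 := by
  rw [h.z_eq]
  simp only [add_dotProduct, smul_dotProduct, smul_eq_mul, h.null', h.pair]
  ring

theorem tendsto_z (h : ConePath F e N N' ξ z G V G₁ V₁ G₂ V₂ g v g₁ v₁ g₂ v₂) :
    Tendsto z F (𝓝 (ξ • N)) := by
  have h1 : Tendsto (fun i => ξ • N + (e i ^ 2 / ξ) • N') F (𝓝 (ξ • N + ((0 : ℂ) ^ 2 / ξ) • N')) :=
    ((h.small.pow 2).div_const ξ).smul_const N' |>.const_add (ξ • N)
  simpa [funext h.z_eq] using h1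

theorem tendsto_dot (h : ConePath F e N N' ξ z G V G₁ V₁ G₂ V₂ g v g₁ v₁ g₂ v₂)
    {f : ι → Fin 3 → ℂ} {a : Fin 3 → ℂ} (hf : Tendsto f F (𝓝 a)) :
    Tendsto (fun i => z i ⬝ᵥ f i) F (𝓝 (ξ * (N ⬝ᵥ a))) := by
  simpa [smul_dotProduct] using tendsto_dotProduct h.tendsto_z hf

/-- The jet of the two fields. -/
def jet (b : ℂ) (e : ι → ℂ) (N N' : Fin 3 → ℂ) (z G V G₁ V₁ G₂ V₂ : ι → Fin 3 → ℂ) (i : ι) :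
    FieldJet ℂ :=
  vecJet (singularField b (e i) (z i) (G i)) (V i) (singularFieldDeriv b (e i) (z i) N (G₁ i)) (V₁ i)
    (singularFieldDeriv b (e i) (z i) N' (G₂ i)) (V₂ i) N N'

/-- The leading terms of the invariants of the jet as a point approaches the complex light cone of
a charge, where the other fields stay regular. -/
theorem coneAsymptotics (h : ConePath F e N N' ξ z G V G₁ V₁ G₂ V₂ g v g₁ v₁ g₂ v₂) (b : ℂ) :
    FieldJet.ConeAsymptotics F e (jet b e N N' z G V G₁ V₁ G₂ V₂) b ξ (v ⬝ᵥ N)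
      (ξ * (N ⬝ᵥ v₁) + v ⬝ᵥ N) (v ⬝ᵥ v) (2 * (v ⬝ᵥ v₁)) (2 * (v ⬝ᵥ v₂)) (v ⬝ᵥ N') := by
  have hξ := h.ξ_ne
  have cN : ∀ {f : ι → Fin 3 → ℂ} {a : Fin 3 → ℂ} (m : Fin 3 → ℂ), Tendsto f F (𝓝 a) →
      Tendsto (fun i => m ⬝ᵥ f i) F (𝓝 (m ⬝ᵥ a)) := fun m hf =>
    tendsto_dotProduct tendsto_const_nhds hf
  constructor
  · exact h.small
  · refine tendsto_of_eq ((((h.small.mul (h.tendsto_dot h.G)).const_mul (2 * b)).const_add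
      (b ^ 2)).add ((h.small.pow 4).mul (tendsto_dotProduct h.G h.G))) (fun i => ?_) (by ring)
    rw [jet, vecJet, singularField_dotProduct_self (h.ne i) (h.sq i)]
    ring
  · refine tendsto_of_eq (((h.tendsto_dot h.V).const_mul b).add
      ((h.small.pow 3).mul (tendsto_dotProduct h.G h.V))) (fun i => ?_)
      (by rw [dotProduct_comm N]; ring)
    have := h.ne i
    simp only [jet, vecJet]
    rw [singularField_dotProduct]
    field_simp
  · exact tendsto_dotProduct h.V h.V
  · refine tendsto_of_eq ((((h.small.mul ((h.tendsto_dot h.G₁).add (cN N h.G))).const_mul (2 * b)).add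
      ((h.small.mul (h.tendsto_dot h.G)).const_mul (-3 * b / ξ))).add
      ((h.small.pow 4).mul (tendsto_dotProduct h.G h.G₁) |>.const_mul 2) |>.add_const
        (-2 * b ^ 2 / ξ)) (fun i => ?_) (by ring)
    have h1 := singularField_dotProduct_deriv (b := b) (h.ne i) (h.sq i) N (G i) (G₁ i)
    have := h.ne i
    rw [h.dot] at h1
    simp only [jet, vecJet]
    refine mul_left_cancel₀ (pow_ne_zero 2 this) ?_
    have h2 : e i ^ 2 * (e i ^ 4 * (2 * (singularField b (e i) (z i) (G i) ⬝ᵥ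
        singularFieldDeriv b (e i) (z i) N (G₁ i)))) = 2 * (e i ^ 6 *
        (singularField b (e i) (z i) (G i) ⬝ᵥ singularFieldDeriv b (e i) (z i) N (G₁ i))) := by ring
    rw [h2, h1]
    field_simp
    ring
  · refine tendsto_of_eq (((((h.tendsto_dot h.V₁).add (cN N h.V)).const_mul b).add
      ((h.tendsto_dot h.V).const_mul (-(3 / 2) * b / ξ))).add
      ((h.small.pow 3).mul ((tendsto_dotProduct h.G h.V₁).add (tendsto_dotProduct h.G₁ h.V))))
      (fun i => ?_) (by rw [dotProduct_comm N v]; field_simp; ring)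
    have h1 := singularField_dotProduct_add (b := b) (z := z i) (h.ne i) N (G i) (G₁ i) (V i) (V₁ i)
    have := h.ne i
    rw [h.dot] at h1
    simp only [jet, vecJet]
    refine mul_left_cancel₀ (pow_ne_zero 2 this) ?_
    rw [← mul_assoc, ← pow_add, h1]
    field_simp
    ring
  · exact (tendsto_dotProduct h.V h.V₁).const_mul 2
  · refine tendsto_of_eq (((((h.small.pow 3).mul ((h.tendsto_dot h.G₂).add (cN N' h.G))).const_mul
      (2 * b)).add ((h.small.mul (h.tendsto_dot h.G)).const_mul (-3 * b * ξ))).add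
      ((h.small.pow 6).mul (tendsto_dotProduct h.G h.G₂) |>.const_mul 2) |>.add_const
        (-2 * b ^ 2 * ξ)) (fun i => ?_) (by ring)
    have h1 := singularField_dotProduct_deriv (b := b) (h.ne i) (h.sq i) N' (G i) (G₂ i)
    rw [h.dot'] at h1
    simp only [jet, vecJet]
    linear_combination (-2) * h1
  · refine tendsto_of_eq ((((h.small.pow 2).mul ((h.tendsto_dot h.V₂).add (cN N' h.V))).const_mul
      b).add ((h.tendsto_dot h.V).const_mul (-(3 / 2) * b * ξ)) |>.add
      ((h.small.pow 5).mul ((tendsto_dotProduct h.G h.V₂).add (tendsto_dotProduct h.G₂ h.V))))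
      (fun i => ?_) (by rw [dotProduct_comm N v]; ring)
    have h1 := singularField_dotProduct_add (b := b) (z := z i) (h.ne i) N' (G i) (G₂ i) (V i) (V₂ i)
    rw [h.dot'] at h1
    simp only [jet, vecJet]
    linear_combination -h1
  · exact (tendsto_dotProduct h.V h.V₂).const_mul 2
  · refine tendsto_of_eq ((h.small.mul (tendsto_dotProduct h.G (tendsto_const_nhds (x := N)))).add_const
      (b / (2 * ξ))) (fun i => ?_) (by ring)
    have := h.ne i
    simp only [jet, vecJet]
    rw [singularField_dotProduct, h.dot]
    field_simp
    ring
  · exact tendsto_dotProduct h.V tendsto_const_nhds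
  · refine tendsto_of_eq (((h.small.pow 3).mul
      (tendsto_dotProduct h.G (tendsto_const_nhds (x := N')))).add_const (b * ξ / 2)) (fun i => ?_)
      (by ring)
    have := h.ne i
    simp only [jet, vecJet]
    rw [singularField_dotProduct, h.dot']
    field_simp
    ring
  · exact tendsto_dotProduct h.V tendsto_const_nhds

/-- The leading term of `∇(B²) ∧ B` at the null cone. The contribution of the Coulomb singularity
alone vanishes, being radial. -/
theorem tendsto_coreObstruction (h : ConePath F e N N' ξ z G V G₁ V₁ G₂ V₂ g v g₁ v₁ g₂ v₂) (b : ℂ) :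
    Tendsto (fun i => e i ^ 6 * (jet b e N N' z G V G₁ V₁ G₂ V₂ i).coreObstruction) F
      (𝓝 (b ^ 2 * ξ * (3 * (g ⬝ᵥ N) + ξ * (N ⬝ᵥ g₁)))) := by
  have hξ := h.ξ_ne
  have cN : ∀ {f : ι → Fin 3 → ℂ} {a : Fin 3 → ℂ} (m : Fin 3 → ℂ), Tendsto f F (𝓝 a) →
      Tendsto (fun i => m ⬝ᵥ f i) F (𝓝 (m ⬝ᵥ a)) := fun m hf =>
    tendsto_dotProduct tendsto_const_nhds hf
  have s₁ := (((h.tendsto_dot h.G₁).add (cN N h.G)).const_mul (2 * b)).add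
      ((h.tendsto_dot h.G).const_mul (-3 * b / ξ)) |>.add
      ((h.small.pow 3).mul (tendsto_dotProduct h.G h.G₁) |>.const_mul 2)
  have s₂ := (((h.small.pow 2).mul ((h.tendsto_dot h.G₂).add (cN N' h.G))).const_mul
      (2 * b)).add ((h.tendsto_dot h.G).const_mul (-3 * b * ξ)) |>.add
      ((h.small.pow 5).mul (tendsto_dotProduct h.G h.G₂) |>.const_mul 2)
  have n₁ := cN N h.G
  have n₂ := cN N' h.G
  refine tendsto_of_eq ((((s₁.const_mul (b * ξ / 2)).sub
    (((h.small.pow 2).mul n₂).const_mul (2 * b ^ 2 / ξ))).add ((h.small.pow 3).mul (s₁.mul n₂))).sub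
    (((s₂.const_mul (b / (2 * ξ))).sub (n₁.const_mul (2 * b ^ 2 * ξ))).add (h.small.mul (s₂.mul n₁))))
    (fun i => ?_) (by rw [dotProduct_comm N g]; field_simp; ring)
  have h1 := singularField_dotProduct_deriv (b := b) (h.ne i) (h.sq i) N (G i) (G₁ i)
  have h2 := singularField_dotProduct_deriv (b := b) (h.ne i) (h.sq i) N' (G i) (G₂ i)
  rw [h.dot] at h1
  rw [h.dot'] at h2
  have := h.ne i
  simp only [FieldJet.coreObstruction, jet, vecJet]
  rw [← mul_right_inj' (pow_ne_zero 6 this)]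
  have e1 : e i ^ 6 * (e i ^ 6 * (2 * (singularField b (e i) (z i) (G i) ⬝ᵥ
      singularFieldDeriv b (e i) (z i) N (G₁ i)) * (singularField b (e i) (z i) (G i) ⬝ᵥ N') -
      2 * (singularField b (e i) (z i) (G i) ⬝ᵥ singularFieldDeriv b (e i) (z i) N' (G₂ i)) *
      (singularField b (e i) (z i) (G i) ⬝ᵥ N))) =
      2 * e i ^ 6 * ((e i ^ 6 * (singularField b (e i) (z i) (G i) ⬝ᵥ
      singularFieldDeriv b (e i) (z i) N (G₁ i))) * (singularField b (e i) (z i) (G i) ⬝ᵥ N') -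
      (e i ^ 6 * (singularField b (e i) (z i) (G i) ⬝ᵥ singularFieldDeriv b (e i) (z i) N' (G₂ i))) *
      (singularField b (e i) (z i) (G i) ⬝ᵥ N)) := by ring
  rw [e1, h1, h2, singularField_dotProduct, singularField_dotProduct, h.dot, h.dot',
    dotProduct_comm N (G i), dotProduct_comm N' (G i)]
  field_simp
  ring

end ConePath

end

/-! ### Approach to the null cone of a charge -/

section

variable {n : ℕ}

/-- The null vector `(m - i e) / 2` for orthonormal `m` and `e`. -/
def nullDir (m e : Space) : Fin 3 → ℂ :=
  (1 / 2 : ℂ) • (fun l => (m l : ℂ)) + (-Complex.I / 2) • (fun l => (e l : ℂ))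

theorem nullDir_neg (m e : Space) : nullDir m (-e) =
    (1 / 2 : ℂ) • (fun l => (m l : ℂ)) + (Complex.I / 2) • (fun l => (e l : ℂ)) := by
  ext l
  simp [nullDir]
  ring

theorem dotProduct_nullDir (d m e : Space) :
    (fun l => (d l : ℂ)) ⬝ᵥ nullDir m e =
      (((inner ℝ d m : ℝ) : ℂ) - Complex.I * ((inner ℝ d e : ℝ) : ℂ)) / 2 := by
  simp [nullDir, inner_eq_dotProduct, dotProduct, Fin.sum_univ_three]
  ring

theorem nullDir_dotProduct_self {m e : Space} (hm : ‖m‖ = 1) (he : ‖e‖ = 1)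
    (hme : (inner ℝ m e : ℝ) = 0) : nullDir m e ⬝ᵥ nullDir m e = 0 := by
  have h1 := dotProduct_nullDir m m e
  have h2 := dotProduct_nullDir e m e
  rw [real_inner_comm, hme] at h2
  rw [hme] at h1
  rw [real_inner_self_eq_norm_sq, hm] at h1
  rw [real_inner_self_eq_norm_sq, he] at h2
  nth_rewrite 1 [nullDir]
  rw [add_dotProduct, smul_dotProduct, smul_dotProduct, h1, h2]
  simp
  linear_combination (1 / 4 : ℂ) * Complex.I_mul_I

theorem nullDir_dotProduct_neg {m e : Space} (hm : ‖m‖ = 1) (he : ‖e‖ = 1)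
    (hme : (inner ℝ m e : ℝ) = 0) : nullDir m e ⬝ᵥ nullDir m (-e) = 1 / 2 := by
  have h1 := dotProduct_nullDir m m (-e)
  have h2 := dotProduct_nullDir e m (-e)
  rw [real_inner_comm, hme] at h2
  rw [inner_neg_right, hme] at h1
  rw [real_inner_self_eq_norm_sq, hm] at h1
  rw [inner_neg_right, real_inner_self_eq_norm_sq, he] at h2
  nth_rewrite 1 [nullDir]
  rw [add_dotProduct, smul_dotProduct, smul_dotProduct, h1, h2]
  simp
  linear_combination (-1 / 4 : ℂ) * Complex.I_mul_I

theorem kernelSum_eq_singularField {b : Fin n → ℂ} {z : Fin n → Fin 3 → ℂ} {R : Fin n → ℂ}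
    {i : Fin n} {ε : ℂ} (hR : R i = ε⁻¹) :
    kernelSum b z R = singularField (b i) ε (z i) (kernelSum (Function.update b i 0) z R) := by
  rw [kernelSum, kernelSum, singularField, ← Finset.add_sum_erase _ _ (Finset.mem_univ i),
    ← Finset.add_sum_erase Finset.univ (fun j => (Function.update b i 0 j * R j ^ 3) • z j)
      (Finset.mem_univ i), hR]
  simp only [Function.update_self, zero_mul, zero_smul, zero_add]
  congr 1
  refine Finset.sum_congr rfl fun j hj => ?_
  rw [Function.update_of_ne (Finset.ne_of_mem_erase hj)]

theorem kernelSumDeriv_eq_singularFieldDeriv {b : Fin n → ℂ} {z : Fin n → Fin 3 → ℂ}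
    {R : Fin n → ℂ} {i : Fin n} {ε : ℂ} (hR : R i = ε⁻¹) (h : Fin 3 → ℂ) :
    kernelSumDeriv b z R h =
      singularFieldDeriv (b i) ε (z i) h (kernelSumDeriv (Function.update b i 0) z R h) := by
  rw [kernelSumDeriv, kernelSumDeriv, singularFieldDeriv,
    ← Finset.add_sum_erase _ _ (Finset.mem_univ i),
    ← Finset.add_sum_erase Finset.univ (fun j => Function.update b i 0 j •
      (R j ^ 3 • h - (3 * R j ^ 5 * (z j ⬝ᵥ h)) • z j)) (Finset.mem_univ i), hR]
  simp only [Function.update_self, zero_smul, zero_add]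
  congr 1
  refine Finset.sum_congr rfl fun j hj => ?_
  rw [Function.update_of_ne (Finset.ne_of_mem_erase hj)]

theorem kernelSumDeriv_add_smul (a : Fin n → ℂ) (z : Fin n → Fin 3 → ℂ) (R : Fin n → ℂ)
    (p r : ℂ) (h k : Fin 3 → ℂ) :
    kernelSumDeriv a z R (p • h + r • k) = p • kernelSumDeriv a z R h + r • kernelSumDeriv a z R k := by
  simp only [kernelSumDeriv, Finset.smul_sum, ← Finset.sum_add_distrib]
  refine Finset.sum_congr rfl fun j _ => ?_
  ext l
  simp only [dotProduct_add, dotProduct_smul, Pi.smul_apply, Pi.sub_apply, Pi.add_apply, smul_eq_mul]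
  ring

theorem kernelJet_rotate (b c : Fin n → ℂ) (z : Fin n → Fin 3 → ℂ) (R : Fin n → ℂ) (m e : Space) :
    (kernelJet b c z R (fun l => (m l : ℂ)) (fun l => (e l : ℂ))).rotate =
      kernelJet b c z R (nullDir m e) (nullDir m (-e)) := by
  simp only [kernelJet, vecJet, FieldJet.rotate, nullDir_neg]
  simp only [nullDir, kernelSumDeriv_add_smul, dotProduct_add, dotProduct_smul, add_dotProduct, smul_dotProduct, smul_eq_mul]
  congr 1 <;> ring

theorem kernelJet_eq_conePath_jet {ι : Type*} {b c : Fin n → ℂ} {z : ι → Fin n → Fin 3 → ℂ}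
    {R : ι → Fin n → ℂ} {i : Fin n} {ε : ι → ℂ} (hR : ∀ k, R k i = (ε k)⁻¹) (N N' : Fin 3 → ℂ)
    (k : ι) : kernelJet b c (z k) (R k) N N' =
      ConePath.jet (b i) ε N N' (fun k => z k i)
        (fun k => kernelSum (Function.update b i 0) (z k) (R k)) (fun k => kernelSum c (z k) (R k))
        (fun k => kernelSumDeriv (Function.update b i 0) (z k) (R k) N)
        (fun k => kernelSumDeriv c (z k) (R k) N)
        (fun k => kernelSumDeriv (Function.update b i 0) (z k) (R k) N')
        (fun k => kernelSumDeriv c (z k) (R k) N') k := by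
  simp only [kernelJet, ConePath.jet]
  rw [← kernelSum_eq_singularField (hR k), ← kernelSumDeriv_eq_singularFieldDeriv (hR k),
    ← kernelSumDeriv_eq_singularFieldDeriv (hR k)]

variable {ι : Type*} {F : Filter ι} {a : Fin n → ℂ} {z : ι → Fin n → Fin 3 → ℂ}
  {R : ι → Fin n → ℂ} {z₀ : Fin n → Fin 3 → ℂ} {R₀ : Fin n → ℂ}

theorem tendsto_kernelSum (hz : ∀ j, Tendsto (fun k => z k j) F (𝓝 (z₀ j)))
    (hR : ∀ j, a j ≠ 0 → Tendsto (fun k => R k j) F (𝓝 (R₀ j))) :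
    Tendsto (fun k => kernelSum a (z k) (R k)) F (𝓝 (kernelSum a z₀ R₀)) := by
  refine tendsto_finsetSum _ fun j _ => ?_
  rcases eq_or_ne (a j) 0 with h | h
  · simpa [h] using tendsto_const_nhds
  · exact (((hR j h).pow 3).const_mul (a j)).smul (hz j)

theorem tendsto_kernelSumDeriv (hz : ∀ j, Tendsto (fun k => z k j) F (𝓝 (z₀ j)))
    (hR : ∀ j, a j ≠ 0 → Tendsto (fun k => R k j) F (𝓝 (R₀ j))) (h : Fin 3 → ℂ) :
    Tendsto (fun k => kernelSumDeriv a (z k) (R k) h) F (𝓝 (kernelSumDeriv a z₀ R₀ h)) := by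
  refine tendsto_finsetSum _ fun j _ => ?_
  rcases eq_or_ne (a j) 0 with ha | ha
  · simpa [ha] using tendsto_const_nhds
  · exact (((((hR j ha).pow 3).smul_const _).sub ((((hR j ha).pow 5).const_mul 3).mul
      (tendsto_dotProduct (hz j) tendsto_const_nhds) |>.smul (hz j)))).const_smul (a j)

end

/-- The square of the complex distance of the point `ξ N` on the null cone of a charge, `N` being
the null vector `nullDir m e`, from a charge at `-d`. -/
def coneDistSq (d m e : Space) (ξ : ℝ) : ℂ :=
  ((‖d‖ ^ 2 : ℝ) : ℂ) + 2 * ξ * ((fun l => (d l : ℂ)) ⬝ᵥ nullDir m e)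

/-- The inverse distance on the null cone. -/
def coneInvDist (d m e : Space) (ξ : ℝ) : ℂ := coneDistSq d m e ξ ^ (-(1 / 2) : ℂ)

theorem re_coneDistSq_pos {d m e : Space} (hm : ‖m‖ = 1) {ξ : ℝ} (hξ : 0 ≤ ξ) (hd : ξ < ‖d‖) :
    0 < (coneDistSq d m e ξ).re := by
  have h1 := (abs_le.1 (abs_real_inner_le_norm d m)).1
  rw [hm, mul_one] at h1
  have h2 : (coneDistSq d m e ξ).re = ‖d‖ ^ 2 + ξ * inner ℝ d m := by
    rw [coneDistSq, dotProduct_nullDir, Complex.add_re, Complex.ofReal_re]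
    simp [Complex.mul_re]
    ring
  rw [h2]
  nlinarith

section

variable {n : ℕ} (x : Fin n → Space) (i : Fin n) (m e : Space) (ξ : ℝ)

/-- The distance to the null cone along the path to `ξ N`. -/
def conePathDist (k : ℕ) : ℝ := 1 / ((k : ℝ) + 1)

/-- The coordinate of the path along `N'`. -/
def conePathEta (k : ℕ) : ℝ := conePathDist k ^ 2 / ξ

/-- The complex position relative to the `j`-th charge on the path to `ξ N`. -/
def conePathPoint (k : ℕ) (j : Fin n) : Fin 3 → ℂ :=
  complexPoint (x i - x j) m e ((ξ + conePathEta ξ k) / 2)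
    (-Complex.I * (((ξ - conePathEta ξ k) / 2 : ℝ) : ℂ))

/-- The inverse distance from the `j`-th charge on the path to `ξ N`. -/
def conePathInvDist (k : ℕ) (j : Fin n) : ℂ :=
  complexInvDist (x i - x j) m e ((ξ + conePathEta ξ k) / 2)
    (-Complex.I * (((ξ - conePathEta ξ k) / 2 : ℝ) : ℂ))

theorem conePathDist_pos (k : ℕ) : 0 < conePathDist k := by
  unfold conePathDist
  positivity

theorem tendsto_conePathDist : Tendsto conePathDist atTop (𝓝 0) :=
  tendsto_one_div_add_atTop_nhds_zero_nat

theorem tendsto_conePathEta : Tendsto (conePathEta ξ) atTop (𝓝 0) := by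
  have := (tendsto_conePathDist.pow 2).div_const ξ
  rwa [zero_pow two_ne_zero, zero_div] at this

theorem conePathPoint_eq (k : ℕ) (j : Fin n) : conePathPoint x i m e ξ k j =
    (fun l => ((x i - x j) l : ℂ)) + ((ξ : ℂ) • nullDir m e +
      (conePathEta ξ k : ℂ) • nullDir m (-e)) := by
  ext l
  rw [nullDir_neg]
  simp [conePathPoint, complexPoint, nullDir]
  ring

variable {x i m e ξ}

theorem tendsto_conePathPoint (j : Fin n) :
    Tendsto (fun k => conePathPoint x i m e ξ k j) atTop
      (𝓝 ((fun l => ((x i - x j) l : ℂ)) + (ξ : ℂ) • nullDir m e)) := by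
  have h1 : Tendsto (fun k => (conePathEta ξ k : ℂ)) atTop (𝓝 ((0 : ℝ) : ℂ)) :=
    (Complex.continuous_ofReal.tendsto 0).comp (tendsto_conePathEta ξ)
  have h2 := ((h1.smul_const (nullDir m (-e))).const_add ((ξ : ℂ) • nullDir m e)).const_add
    (fun l => ((x i - x j) l : ℂ))
  simpa [conePathPoint_eq] using h2

theorem cone_dotProduct_self (hm : ‖m‖ = 1) (he : ‖e‖ = 1) (hme : (inner ℝ m e : ℝ) = 0)
    (d : Space) : ((fun l => (d l : ℂ)) + (ξ : ℂ) • nullDir m e) ⬝ᵥ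
      ((fun l => (d l : ℂ)) + (ξ : ℂ) • nullDir m e) = coneDistSq d m e ξ := by
  have h1 : (fun l => (d l : ℂ)) ⬝ᵥ (fun l => (d l : ℂ)) = ((‖d‖ ^ 2 : ℝ) : ℂ) := by
    rw [← real_inner_self_eq_norm_sq, inner_eq_dotProduct]
    simp [dotProduct]
  rw [add_dotProduct, dotProduct_add, dotProduct_add, h1, smul_dotProduct, dotProduct_smul,
    smul_dotProduct, dotProduct_smul, nullDir_dotProduct_self hm he hme, coneDistSq,
    dotProduct_comm (nullDir m e)]
  simp
  ring

theorem tendsto_conePathInvDist (hm : ‖m‖ = 1) (he : ‖e‖ = 1) (hme : (inner ℝ m e : ℝ) = 0)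
    (hξ : 0 ≤ ξ) {j : Fin n} (hd : ξ < ‖x i - x j‖) :
    Tendsto (fun k => conePathInvDist x i m e ξ k j) atTop (𝓝 (coneInvDist (x i - x j) m e ξ)) := by
  have h1 := tendsto_dotProduct (tendsto_conePathPoint (x := x) (i := i) (m := m) (e := e) (ξ := ξ) j)
    (tendsto_conePathPoint (x := x) (i := i) (m := m) (e := e) (ξ := ξ) j)
  rw [cone_dotProduct_self hm he hme] at h1
  exact h1.cpow tendsto_const_nhds (Or.inl (re_coneDistSq_pos hm hξ hd))

theorem conePathInvDist_self (hm : ‖m‖ = 1) (he : ‖e‖ = 1) (hme : (inner ℝ m e : ℝ) = 0)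
    (hξ : 0 < ξ) (k : ℕ) : conePathInvDist x i m e ξ k i = (conePathDist k : ℂ)⁻¹ := by
  have h0 := conePathDist_pos k
  have h1 : conePathPoint x i m e ξ k i ⬝ᵥ conePathPoint x i m e ξ k i =
      ((conePathDist k ^ 2 : ℝ) : ℂ) := by
    have hz : (fun l => ((x i - x i) l : ℂ)) = 0 := by ext l; simp
    have n1 := nullDir_dotProduct_self hm he hme
    have n2 := nullDir_dotProduct_neg hm he hme
    have n3 : nullDir m (-e) ⬝ᵥ nullDir m (-e) = 0 :=
      nullDir_dotProduct_self hm (by rwa [norm_neg]) (by rw [inner_neg_right, hme, neg_zero])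
    rw [conePathPoint_eq, hz, zero_add]
    simp only [add_dotProduct, dotProduct_add, smul_dotProduct, dotProduct_smul, smul_eq_mul, n1,
      n2, n3, dotProduct_comm (nullDir m (-e)) (nullDir m e), conePathEta]
    have : (ξ : ℂ) ≠ 0 := by exact_mod_cast hξ.ne'
    push_cast
    field_simp
    ring
  have h2 : (-(1 / 2) : ℂ) = ((-(1 / 2) : ℝ) : ℂ) := by push_cast; ring
  rw [conePathInvDist, complexInvDist]
  rw [conePathPoint] at h1
  rw [h1, h2, ← Complex.ofReal_cpow (by positivity), Real.rpow_neg (by positivity),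
    ← Real.sqrt_eq_rpow, Real.sqrt_sq h0.le]
  push_cast
  rfl

/-- Superpositions of Coulomb kernels along the path, one of them regular at the charge `x i`. -/
theorem conePath (hm : ‖m‖ = 1) (he : ‖e‖ = 1) (hme : (inner ℝ m e : ℝ) = 0) (hξ : 0 < ξ)
    (hd : ∀ j ≠ i, ξ < ‖x i - x j‖) (b : Fin n → ℂ) {c : Fin n → ℂ} (hc : c i = 0) :
    ConePath atTop (fun k => (conePathDist k : ℂ)) (nullDir m e) (nullDir m (-e)) ξ
      (fun k => conePathPoint x i m e ξ k i)
      (fun k => kernelSum (Function.update b i 0) (conePathPoint x i m e ξ k)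
        (conePathInvDist x i m e ξ k))
      (fun k => kernelSum c (conePathPoint x i m e ξ k) (conePathInvDist x i m e ξ k))
      (fun k => kernelSumDeriv (Function.update b i 0) (conePathPoint x i m e ξ k)
        (conePathInvDist x i m e ξ k) (nullDir m e))
      (fun k => kernelSumDeriv c (conePathPoint x i m e ξ k) (conePathInvDist x i m e ξ k)
        (nullDir m e))
      (fun k => kernelSumDeriv (Function.update b i 0) (conePathPoint x i m e ξ k)
        (conePathInvDist x i m e ξ k) (nullDir m (-e)))
      (fun k => kernelSumDeriv c (conePathPoint x i m e ξ k) (conePathInvDist x i m e ξ k)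
        (nullDir m (-e)))
      (kernelSum (Function.update b i 0)
        (fun j => (fun l => ((x i - x j) l : ℂ)) + (ξ : ℂ) • nullDir m e)
        (fun j => coneInvDist (x i - x j) m e ξ))
      (kernelSum c (fun j => (fun l => ((x i - x j) l : ℂ)) + (ξ : ℂ) • nullDir m e)
        (fun j => coneInvDist (x i - x j) m e ξ))
      (kernelSumDeriv (Function.update b i 0)
        (fun j => (fun l => ((x i - x j) l : ℂ)) + (ξ : ℂ) • nullDir m e)
        (fun j => coneInvDist (x i - x j) m e ξ) (nullDir m e))
      (kernelSumDeriv c (fun j => (fun l => ((x i - x j) l : ℂ)) + (ξ : ℂ) • nullDir m e)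
        (fun j => coneInvDist (x i - x j) m e ξ) (nullDir m e))
      (kernelSumDeriv (Function.update b i 0)
        (fun j => (fun l => ((x i - x j) l : ℂ)) + (ξ : ℂ) • nullDir m e)
        (fun j => coneInvDist (x i - x j) m e ξ) (nullDir m (-e)))
      (kernelSumDeriv c (fun j => (fun l => ((x i - x j) l : ℂ)) + (ξ : ℂ) • nullDir m e)
        (fun j => coneInvDist (x i - x j) m e ξ) (nullDir m (-e))) := by
  have hz : ∀ j, Tendsto (fun k => conePathPoint x i m e ξ k j) atTop
      (𝓝 ((fun l => ((x i - x j) l : ℂ)) + (ξ : ℂ) • nullDir m e)) := tendsto_conePathPoint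
  have hR : ∀ a : Fin n → ℂ, a i = 0 → ∀ j, a j ≠ 0 →
      Tendsto (fun k => conePathInvDist x i m e ξ k j) atTop (𝓝 (coneInvDist (x i - x j) m e ξ)) :=
    fun a ha j hj => tendsto_conePathInvDist hm he hme hξ.le (hd j fun h => hj (h ▸ ha))
  have hu : Function.update b i 0 i = 0 := Function.update_self ..
  constructor
  · exact_mod_cast hξ.ne'
  · exact nullDir_dotProduct_self hm he hme
  · exact nullDir_dotProduct_self hm (by rwa [norm_neg]) (by rw [inner_neg_right, hme, neg_zero])
  · exact nullDir_dotProduct_neg hm he hme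
  · have := (Complex.continuous_ofReal.tendsto 0).comp tendsto_conePathDist
    simpa [Function.comp_def] using this
  · exact fun k => by exact_mod_cast (conePathDist_pos k).ne'
  · intro k
    rw [conePathPoint_eq]
    ext l
    simp [conePathEta]
  · exact tendsto_kernelSum hz (hR _ hu)
  · exact tendsto_kernelSum hz (hR _ hc)
  · exact tendsto_kernelSumDeriv hz (hR _ hu) _
  · exact tendsto_kernelSumDeriv hz (hR _ hc) _
  · exact tendsto_kernelSumDeriv hz (hR _ hu) _
  · exact tendsto_kernelSumDeriv hz (hR _ hc) _

/-- The component along the null cone of a superposition of Coulomb kernels, and its scaled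
derivatives. -/
def coneMoment (x : Fin n → Space) (i : Fin n) (m e : Space) (a : Fin n → ℂ) (k : ℕ) (ξ : ℝ) : ℂ :=
  ∑ j, a j * ((fun l => ((x i - x j) l : ℂ)) ⬝ᵥ nullDir m e) ^ (k + 1) *
    coneInvDist (x i - x j) m e ξ ^ (3 + 2 * k)

theorem kernelSum_dotProduct_nullDir (hm : ‖m‖ = 1) (he : ‖e‖ = 1) (hme : (inner ℝ m e : ℝ) = 0)
    (a : Fin n → ℂ) :
    kernelSum a (fun j => (fun l => ((x i - x j) l : ℂ)) + (ξ : ℂ) • nullDir m e)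
      (fun j => coneInvDist (x i - x j) m e ξ) ⬝ᵥ nullDir m e = coneMoment x i m e a 0 ξ := by
  simp only [kernelSum, sum_dotProduct, coneMoment]
  refine Finset.sum_congr rfl fun j _ => ?_
  rw [smul_dotProduct, add_dotProduct, smul_dotProduct, nullDir_dotProduct_self hm he hme]
  simp
  ring

theorem nullDir_dotProduct_kernelSumDeriv (hm : ‖m‖ = 1) (he : ‖e‖ = 1)
    (hme : (inner ℝ m e : ℝ) = 0) (a : Fin n → ℂ) :
    nullDir m e ⬝ᵥ kernelSumDeriv a
      (fun j => (fun l => ((x i - x j) l : ℂ)) + (ξ : ℂ) • nullDir m e)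
      (fun j => coneInvDist (x i - x j) m e ξ) (nullDir m e) = -3 * coneMoment x i m e a 1 ξ := by
  simp only [kernelSumDeriv, dotProduct_sum, coneMoment, Finset.mul_sum]
  refine Finset.sum_congr rfl fun j _ => ?_
  rw [dotProduct_smul, dotProduct_sub, dotProduct_smul, dotProduct_smul, dotProduct_add,
    add_dotProduct, smul_dotProduct, dotProduct_smul, nullDir_dotProduct_self hm he hme,
    dotProduct_comm (nullDir m e)]
  simp
  ring

/-- A holomorphic identity between the jets of Coulomb fields near the charge `x i` holds along the
path to `ξ N`. -/
theorem eventually_eq_zero_conePath {g c : Fin n → ℝ} (hm : ‖m‖ = 1) (he : ‖e‖ = 1)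
    (hme : (inner ℝ m e : ℝ) = 0) {Φ : FieldJet ℂ → ℂ}
    (hΦ : ∀ (J : ℂ → FieldJet ℂ) (U : Set ℂ), FieldJet.HolomorphicOn J U →
      DifferentiableOn ℂ (fun Y => Φ (J Y)) U) {A : ℂ} (hrot : ∀ J, Φ J.rotate = A * Φ J)
    {δ : ℝ} (hδ : ∀ y : Space, y ≠ x i → ‖y - x i‖ < δ →
      Φ ((jetOf (coulombField x g y) (coulombField x c y) (coulombDeriv x g y)
        (coulombDeriv x c y) m e).map Complex.ofReal) = 0)
    (hξ : 0 < ξ) (hξδ : 2 * ξ < δ) (hd : ∀ j ≠ i, 8 * ξ < ‖x i - x j‖) :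
    ∀ᶠ k in atTop, Φ (kernelJet (fun j => ((g j / (4 * Real.pi) : ℝ) : ℂ))
      (fun j => ((c j / (4 * Real.pi) : ℝ) : ℂ)) (conePathPoint x i m e ξ k)
      (conePathInvDist x i m e ξ k) (nullDir m e) (nullDir m (-e))) = 0 := by
  filter_upwards [(tendsto_conePathEta ξ).eventually (gt_mem_nhds hξ)] with k hk
  have h0 : 0 < conePathEta ξ k := div_pos (pow_pos (conePathDist_pos k) 2) hξ
  rw [← kernelJet_rotate, hrot]
  refine mul_eq_zero_of_right A (eq_zero_on_complexPoint hm he hme hΦ hδ (by linarith) (by linarith)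
    (fun j => ?_) ?_)
  · rcases eq_or_ne j i with rfl | hj
    · exact Or.inl (sub_self _)
    · exact Or.inr ((by linarith : 8 * ((ξ + conePathEta ξ k) / 2) < 8 * ξ).trans (hd j hj))
  · rw [norm_mul, norm_neg, Complex.norm_I, one_mul, Complex.norm_real, Real.norm_eq_abs, abs_lt]
    constructor <;> linarith

end

/-! ### Coulomb fields are determined along a null cone -/

section

variable {n : ℕ} {x : Fin n → Space} {i : Fin n} {m e : Space} {ξ : ℝ}

theorem hasDerivAt_coneInvDist {d : Space} (hm : ‖m‖ = 1) (hξ : 0 ≤ ξ) (hd : ξ < ‖d‖) :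
    HasDerivAt (coneInvDist d m e)
      (-((fun l => (d l : ℂ)) ⬝ᵥ nullDir m e) * coneInvDist d m e ξ ^ 3) ξ := by
  set p := (fun l => (d l : ℂ)) ⬝ᵥ nullDir m e with hp
  have h1 : HasDerivAt (fun ζ : ℂ => ((‖d‖ ^ 2 : ℝ) : ℂ) + 2 * ζ * p) (2 * p) (ξ : ℂ) := by
    simpa using (((hasDerivAt_id (ξ : ℂ)).const_mul 2).mul_const p).const_add (((‖d‖ ^ 2 : ℝ) : ℂ))
  have h2 := (h1.cpow_const (c := (-(1 / 2) : ℂ))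
    (Or.inl (re_coneDistSq_pos (e := e) hm hξ hd))).comp_ofReal
  have h3 : (-(1 / 2) : ℂ) - 1 = (3 : ℕ) * (-(1 / 2) : ℂ) := by push_cast; ring
  rw [h3, Complex.cpow_nat_mul] at h2
  have h4 : HasDerivAt (coneInvDist d m e) _ ξ := h2
  refine h4.congr_deriv ?_
  simp only [coneInvDist, coneDistSq]
  ring

theorem hasDerivAt_coneMoment {a : Fin n → ℂ} (hm : ‖m‖ = 1) (hξ : 0 ≤ ξ)
    (hd : ∀ j, a j ≠ 0 → ξ < ‖x i - x j‖) (k : ℕ) :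
    HasDerivAt (coneMoment x i m e a k) (-(3 + 2 * k) * coneMoment x i m e a (k + 1) ξ) ξ := by
  rw [coneMoment, Finset.mul_sum]
  refine HasDerivAt.fun_sum fun j _ => ?_
  rcases eq_or_ne (a j) 0 with ha | ha
  · simpa [ha] using hasDerivAt_const ξ (0 : ℂ)
  · have h1 := ((hasDerivAt_coneInvDist (e := e) hm hξ (hd j ha)).pow (3 + 2 * k)).const_mul
      (a j * ((fun l => ((x i - x j) l : ℂ)) ⬝ᵥ nullDir m e) ^ (k + 1))
    refine h1.congr_deriv ?_
    have h2 : 3 + 2 * k - 1 = 2 + 2 * k := by omega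
    rw [h2]
    push_cast
    ring

theorem coneMoment_eq_zero {a : Fin n → ℂ} (hm : ‖m‖ = 1) {r : ℝ}
    (hd : ∀ j, a j ≠ 0 → r ≤ ‖x i - x j‖)
    (h0 : ∀ ξ ∈ Set.Ioo 0 r, coneMoment x i m e a 0 ξ = 0) (k : ℕ) :
    ∀ ξ ∈ Set.Ioo 0 r, coneMoment x i m e a k ξ = 0 := by
  induction k with
  | zero => exact h0
  | succ k ih =>
    intro ξ hξ
    have h1 := hasDerivAt_coneMoment (e := e) hm hξ.1.le
      (fun j hj => hξ.2.trans_le (hd j hj)) k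
    have h2 : HasDerivAt (coneMoment x i m e a k) 0 ξ :=
      (hasDerivAt_const ξ (0 : ℂ)).congr_of_eventuallyEq
        (Filter.eventually_of_mem (isOpen_Ioo.mem_nhds hξ) ih)
    have h3 : (-(3 + 2 * k) : ℂ) ≠ 0 := by
      rw [neg_ne_zero]
      exact_mod_cast (by omega : 3 + 2 * k ≠ 0)
    exact (mul_eq_zero.1 (h1.unique h2)).resolve_left h3

/-- The equation says that `ξ ^ 3` times the component along the cone is constant. -/
theorem coneMoment_eq_zero_of_eq {a : Fin n → ℂ} (hm : ‖m‖ = 1) {r : ℝ}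
    (hd : ∀ j, a j ≠ 0 → r ≤ ‖x i - x j‖)
    (h0 : ∀ ξ ∈ Set.Ioo 0 r, coneMoment x i m e a 0 ξ = ξ * coneMoment x i m e a 1 ξ) :
    ∀ ξ ∈ Set.Ioo 0 r, coneMoment x i m e a 0 ξ = 0 := by
  intro ξ hξ
  have h1 : ∀ ζ ∈ Set.Ico 0 r,
      HasDerivAt (fun ζ : ℝ => (ζ : ℂ) ^ 3 * coneMoment x i m e a 0 ζ) 0 ζ := by
    intro ζ hζ
    have h1 := hasDerivAt_coneMoment (e := e) hm hζ.1 (fun j hj => hζ.2.trans_le (hd j hj)) 0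
    have h2 := ((hasDerivAt_id (ζ : ℂ)).comp_ofReal.pow 3).mul h1
    refine h2.congr_deriv ?_
    rcases hζ.1.eq_or_lt with h | h
    · simp [← h]
    · have := h0 ζ ⟨h, hζ.2⟩
      simp [this]
      ring
  have h2 := constant_of_has_deriv_right_zero
    (fun ζ hζ => (h1 ζ ⟨hζ.1, hζ.2.trans_lt hξ.2⟩).continuousAt.continuousWithinAt)
    (fun ζ hζ => (h1 ζ ⟨hζ.1, hζ.2.trans hξ.2⟩).hasDerivWithinAt) ξ ⟨hξ.1.le, le_rfl⟩
  simp only [Complex.ofReal_zero, zero_pow three_ne_zero, zero_mul] at h2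
  exact (mul_eq_zero.1 h2).resolve_left (pow_ne_zero 3 (by exact_mod_cast hξ.1.ne'))

/-- The moments form a Vandermonde system; the condition on `m` makes its nodes distinct. -/
theorem eq_zero_of_coneMoment_eq_zero {a : Fin n → ℂ} (hm : ‖m‖ = 1) (hx : Function.Injective x)
    (hinj : Function.Injective fun j => (inner ℝ ((‖x i - x j‖ ^ 2)⁻¹ • (x i - x j)) m : ℝ))
    (hξ : 0 ≤ ξ) (hd : ∀ j ≠ i, ξ < ‖x i - x j‖) (h0 : ∀ k, coneMoment x i m e a k ξ = 0)
    {j : Fin n} (hj : j ≠ i) : a j = 0 := by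
  set p : Fin n → ℂ := fun j => (fun l => ((x i - x j) l : ℂ)) ⬝ᵥ nullDir m e with hp
  have hpre : ∀ j, (p j).re = inner ℝ (x i - x j) m / 2 := by
    intro j
    rw [hp]
    simp only
    rw [dotProduct_nullDir]
    simp
  have hpi : p i = 0 := by
    have : (fun l => ((x i - x i) l : ℂ)) = 0 := by ext l; simp
    rw [hp]
    simp only [this, zero_dotProduct]
  have hA : ∀ j ≠ i, ‖x i - x j‖ ^ 2 ≠ 0 := fun j hj =>
    pow_ne_zero 2 (norm_ne_zero_iff.2 (sub_ne_zero.2 (hx.ne hj.symm)))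
  have hpj : ∀ j ≠ i, p j ≠ 0 := by
    intro j hj h
    refine hj (hinj ?_)
    have h1 := hpre j
    rw [h, Complex.zero_re] at h1
    simp only [sub_self, smul_zero, inner_zero_left]
    rw [inner_smul_left, show (inner ℝ (x i - x j) m : ℝ) = 0 by linarith, mul_zero]
  have hQ : ∀ j ≠ i, coneDistSq (x i - x j) m e ξ ≠ 0 := fun j hj h => by
    have := re_coneDistSq_pos (e := e) hm hξ (hd j hj)
    simp [h] at this
  have hR2 : ∀ j, coneInvDist (x i - x j) m e ξ ^ 2 = (coneDistSq (x i - x j) m e ξ)⁻¹ := by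
    intro j
    rw [coneInvDist, ← Complex.cpow_nat_mul, ← Complex.cpow_neg_one]
    congr 1
    push_cast
    ring
  have hR : ∀ j ≠ i, coneInvDist (x i - x j) m e ξ ≠ 0 := fun j hj h => by
    have := hR2 j
    rw [h, zero_pow two_ne_zero] at this
    exact inv_ne_zero (hQ j hj) this.symm
  have hnodes : Function.Injective fun j => p j * coneInvDist (x i - x j) m e ξ ^ 2 := by
    intro j k hjk
    simp only [hR2] at hjk
    by_contra hne
    by_cases hji : j = i
    · have hki : k ≠ i := fun h => hne (hji.trans h.symm)
      rw [hji, hpi, zero_mul] at hjk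
      exact mul_ne_zero (hpj k hki) (inv_ne_zero (hQ k hki)) hjk.symm
    by_cases hki : k = i
    · rw [hki, hpi, zero_mul] at hjk
      exact mul_ne_zero (hpj j hji) (inv_ne_zero (hQ j hji)) hjk
    refine hne (hinj ?_)
    rw [← div_eq_mul_inv, ← div_eq_mul_inv, div_eq_div_iff (hQ j hji) (hQ k hki)] at hjk
    simp only [coneDistSq] at hjk
    have h1 : p j * ((‖x i - x k‖ ^ 2 : ℝ) : ℂ) = p k * ((‖x i - x j‖ ^ 2 : ℝ) : ℂ) := by
      linear_combination hjk
    have h2 := congrArg Complex.re h1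
    rw [Complex.re_mul_ofReal, Complex.re_mul_ofReal, hpre, hpre] at h2
    simp only [inner_smul_left, RCLike.conj_to_real, inv_mul_eq_div]
    exact (div_eq_div_iff (hA j hji) (hA k hki)).2 (by linarith)
  have h1 := Matrix.eq_zero_of_forall_pow_sum_mul_pow_eq_zero hnodes
    (v := fun j => a j * p j * coneInvDist (x i - x j) m e ξ ^ 3) fun k => by
      rw [← h0 k, coneMoment]
      refine Finset.sum_congr rfl fun j _ => ?_
      ring
  have h2 := congrFun h1 j
  simp only [Pi.zero_apply, mul_eq_zero, pow_eq_zero_iff three_ne_zero] at h2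
  rcases h2 with (h2 | h2) | h2
  · exact h2
  · exact absurd h2 (hpj j hj)
  · exact absurd h2 (hR j hj)

/-- The inversion `d ↦ d / |d|²` is injective, so a generic direction separates the images of the
positions of the charges. -/
theorem exists_injective_inner (hx : Function.Injective x) (i : Fin n) : ∃ m : Space, ‖m‖ = 1 ∧
    Function.Injective fun j => (inner ℝ ((‖x i - x j‖ ^ 2)⁻¹ • (x i - x j)) m : ℝ) := by
  set d : Fin n → Space := fun j => (‖x i - x j‖ ^ 2)⁻¹ • (x i - x j) with hd
  have hdn : ∀ j, ‖d j‖ = ‖x i - x j‖⁻¹ := by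
    intro j
    rw [hd]
    simp only [norm_smul, norm_inv, norm_pow, norm_norm]
    rcases eq_or_ne ‖x i - x j‖ 0 with h | h
    · simp [h]
    · field_simp
  have hdi : Function.Injective d := by
    intro j k hjk
    have h1 : ‖x i - x j‖ = ‖x i - x k‖ := by
      rw [← inv_inj, ← hdn, ← hdn, hjk]
    have h2 : x i - x j = x i - x k := by
      rcases eq_or_ne ‖x i - x k‖ 0 with h | h
      · rw [h] at h1
        rw [norm_eq_zero.1 h, norm_eq_zero.1 h1]
      · simp only [hd, h1] at hjk
        exact smul_right_injective Space (inv_ne_zero (pow_ne_zero 2 h)) hjk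
    exact hx (sub_right_injective h2)
  obtain ⟨m₀, hm₀⟩ := Module.Dual.exists_forall_ne_zero_of_forall_exists
    (fun p : Option {p : Fin n × Fin n // p.1 ≠ p.2} => p.elim
      (innerₗ Space (EuclideanSpace.single 0 1)) fun p => innerₗ Space (d p.1.1 - d p.1.2)) (by
      rintro (_ | ⟨p, hp⟩)
      · exact ⟨EuclideanSpace.single 0 1, by simp⟩
      · exact ⟨d p.1 - d p.2, inner_self_ne_zero.2 (sub_ne_zero.2 (hdi.ne hp))⟩)
  have hm₀0 : m₀ ≠ 0 := by
    rintro rfl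
    exact hm₀ none (by simp)
  refine ⟨‖m₀‖⁻¹ • m₀, norm_smul_inv_norm hm₀0, fun j k hjk => ?_⟩
  by_contra hne
  refine hm₀ (some ⟨(j, k), hne⟩) ?_
  simp only [inner_smul_right] at hjk
  have := mul_left_cancel₀ (inv_ne_zero (norm_ne_zero_iff.2 hm₀0)) hjk
  change (inner ℝ (d j - d k) m₀ : ℝ) = 0
  rw [inner_sub_left]
  exact sub_eq_zero.2 this

theorem exists_norm_one_inner_eq_zero (m : Space) :
    ∃ e : Space, ‖e‖ = 1 ∧ (inner ℝ m e : ℝ) = 0 := by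
  obtain ⟨w, hw, hmw⟩ : ∃ w : Space, w ≠ 0 ∧ (inner ℝ m w : ℝ) = 0 := by
    by_cases h : m 0 = 0
    · refine ⟨EuclideanSpace.single 0 1, fun h0 => ?_, ?_⟩
      · simpa using congrArg (fun v : Space => v 0) h0
      · rw [EuclideanSpace.inner_single_right]
        simp [h]
    · refine ⟨!₂[-m 1, m 0, 0], fun h0 => h ?_, ?_⟩
      · simpa using congrArg (fun v : Space => v 1) h0
      · simp [PiLp.inner_apply, Fin.sum_univ_three]
        ring
  exact ⟨‖w‖⁻¹ • w, norm_smul_inv_norm hw, by rw [inner_smul_right, hmw, mul_zero]⟩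

/-- A small radius for which no other charge interferes. -/
theorem exists_pos_forall_lt_norm_sub (hx : Function.Injective x) (i : Fin n) {δ : ℝ} (hδ : 0 < δ) :
    ∃ r > 0, 2 * r ≤ δ ∧ ∀ j ≠ i, 8 * r ≤ ‖x i - x j‖ := by
  have h1 : ∀ᶠ r : ℝ in 𝓝[>] 0, ∀ j, j ≠ i → 8 * r ≤ ‖x i - x j‖ := by
    refine eventually_all.2 fun j => ?_
    by_cases hj : j = i
    · exact Eventually.of_forall fun r h => absurd hj h
    · have h0 : 0 < ‖x i - x j‖ / 8 := by
        have := norm_pos_iff.2 (sub_ne_zero.2 (hx.ne (Ne.symm hj)))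
        positivity
      filter_upwards [Ioo_mem_nhdsGT h0] with r hr _
      linarith [hr.2]
  obtain ⟨r, hr, h2, h3⟩ := (h1.and (Ioo_mem_nhdsGT (show 0 < δ / 2 by positivity))).exists
  exact ⟨r, h2, by linarith [h3], hr⟩

end

/-! ### Irrotational fields have a single charge -/

namespace FieldJet

theorem HolomorphicOn.coreObstruction {J : ℂ → FieldJet ℂ} {U : Set ℂ} (h : HolomorphicOn J U) :
    DifferentiableOn ℂ (fun Y => (J Y).coreObstruction) U :=
  (h.s₁.mul h.b₂).sub (h.s₂.mul h.b₁)

theorem HolomorphicOn.electricObstruction {J : ℂ → FieldJet ℂ} {U : Set ℂ} (h : HolomorphicOn J U)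
    (β κ l : ℂ) : DifferentiableOn ℂ (fun Y => (J Y).electricObstruction β κ l) U := by
  obtain ⟨_, _, _, _, _, _, _, _, _, _, _, _, _⟩ := h
  simp only [FieldJet.electricObstruction, det, detDeriv, dirE, curlE]
  fun_prop

theorem HolomorphicOn.magneticObstruction {J : ℂ → FieldJet ℂ} {U : Set ℂ} (h : HolomorphicOn J U)
    (β κ l : ℂ) : DifferentiableOn ℂ (fun Y => (J Y).magneticObstruction β κ l) U := by
  obtain ⟨_, _, _, _, _, _, _, _, _, _, _, _, _⟩ := h
  simp only [FieldJet.magneticObstruction, denomSq, denomSqDeriv, curlH, leadDeriv, mixDeriv, dirH,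
    det, detDeriv, dirE, curlE]
  fun_prop

theorem coreObstruction_map (J : FieldJet ℝ) :
    (J.map Complex.ofReal).coreObstruction = ((J.coreObstruction : ℝ) : ℂ) := by
  simp [FieldJet.coreObstruction, FieldJet.map]

theorem electricObstruction_map (β κ l : ℝ) (J : FieldJet ℝ) :
    (J.map Complex.ofReal).electricObstruction (β : ℂ) κ l = ((J.electricObstruction β κ l : ℝ) : ℂ) := by
  simp only [FieldJet.electricObstruction, det, detDeriv, dirE, curlE, FieldJet.map]
  push_cast
  rfl

theorem magneticObstruction_map (β κ l : ℝ) (J : FieldJet ℝ) :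
    (J.map Complex.ofReal).magneticObstruction (β : ℂ) κ l = ((J.magneticObstruction β κ l : ℝ) : ℂ) := by
  simp only [FieldJet.magneticObstruction, denomSq, denomSqDeriv, curlH, leadDeriv, mixDeriv, dirH,
    det, detDeriv, dirE, curlE, FieldJet.map]
  push_cast
  rfl


/-- For proportional fields `B` and `D = l B` the obstruction is that of `B` up to a factor. -/
theorem electricObstruction_of_proportional {K : Type*} [CommRing K] (β κ l : K) {J : FieldJet K}
    (hw : J.w = 0) (ht : J.t = 0) (hw₁ : J.w₁ = 0) (ht₁ : J.t₁ = 0) (hw₂ : J.w₂ = 0)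
    (ht₂ : J.t₂ = 0) (hv₁ : J.v₁ = 0) (hv₂ : J.v₂ = 0) :
    J.electricObstruction β κ l = l * (β * (1 + κ ^ 2 * J.s) * (1 + (κ ^ 2 + β * l ^ 2) * J.s)
      - (1 + β * J.s) * (κ ^ 2 * (1 + (κ ^ 2 + β * l ^ 2) * J.s)
        + (κ ^ 2 + β * l ^ 2) * (1 + κ ^ 2 * J.s))) * J.coreObstruction := by
  simp only [FieldJet.electricObstruction, FieldJet.coreObstruction, det, detDeriv, dirE, curlE, hw,
    ht, hw₁, ht₁, hw₂, ht₂, hv₁, hv₂]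
  ring

theorem magneticObstruction_of_proportional {K : Type*} [CommRing K] (β κ l : K) {J : FieldJet K}
    (hw : J.w = 0) (ht : J.t = 0) (hw₁ : J.w₁ = 0) (ht₁ : J.t₁ = 0) (hw₂ : J.w₂ = 0)
    (ht₂ : J.t₂ = 0) (hv₁ : J.v₁ = 0) (hv₂ : J.v₂ = 0) :
    J.magneticObstruction β κ l =
      (2 * ((1 + β * J.s) * (1 + κ ^ 2 * J.s) ^ 3 * (1 + (κ ^ 2 + β * l ^ 2) * J.s)) *
        ((2 * κ ^ 2 + β * l ^ 2 - κ ^ 2 * l ^ 2) + 2 * κ ^ 4 * J.s)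
      - (β * (1 + κ ^ 2 * J.s) ^ 3 * (1 + (κ ^ 2 + β * l ^ 2) * J.s)
        + 3 * κ ^ 2 * (1 + β * J.s) * (1 + κ ^ 2 * J.s) ^ 2 * (1 + (κ ^ 2 + β * l ^ 2) * J.s)
        + (κ ^ 2 + β * l ^ 2) * (1 + β * J.s) * (1 + κ ^ 2 * J.s) ^ 3) *
        (1 + (2 * κ ^ 2 + β * l ^ 2 - κ ^ 2 * l ^ 2) * J.s + κ ^ 4 * J.s ^ 2)) *
      J.coreObstruction := by
  simp only [FieldJet.magneticObstruction, FieldJet.coreObstruction, denomSq, denomSqDeriv, curlH,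
    leadDeriv, mixDeriv, dirH, det, detDeriv, dirE, curlE, hw, ht, hw₁, ht₁, hw₂, ht₂, hv₁, hv₂]
  ring

end FieldJet

/-- The factor is a polynomial of degree two in `s`. -/
theorem eventually_electricFactor_ne_zero {β κ : ℝ} (hβ : 0 < β) (hκ : κ ≠ 0) (l : ℝ) :
    ∀ᶠ s : ℝ in atTop, β * (1 + κ ^ 2 * s) * (1 + (κ ^ 2 + β * l ^ 2) * s)
      - (1 + β * s) * (κ ^ 2 * (1 + (κ ^ 2 + β * l ^ 2) * s)
        + (κ ^ 2 + β * l ^ 2) * (1 + κ ^ 2 * s)) ≠ 0 := by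
  have h1 : Continuous fun a : ℝ => β * (a + κ ^ 2) * (a + (κ ^ 2 + β * l ^ 2))
      - (a + β) * (κ ^ 2 * (a + (κ ^ 2 + β * l ^ 2)) + (κ ^ 2 + β * l ^ 2) * (a + κ ^ 2)) := by
    fun_prop
  have h2 := (h1.tendsto 0).comp tendsto_inv_atTop_zero
  have h3 : -(β * κ ^ 2 * (κ ^ 2 + β * l ^ 2)) ≠ 0 := by
    have : 0 < κ ^ 2 := by positivity
    exact neg_ne_zero.2 (by positivity)
  filter_upwards [h2 (isOpen_ne.mem_nhds (show _ ≠ (0 : ℝ) by ring_nf at h3 ⊢; exact h3)),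
    eventually_gt_atTop 0] with s hs h0 h
  refine hs ?_
  rw [Function.comp_apply, ← mul_right_inj' (pow_ne_zero 2 h0.ne'), mul_zero, ← h]
  field_simp

/-- The factor is a polynomial of degree six in `s`. -/
theorem eventually_magneticFactor_ne_zero {β κ : ℝ} (hβ : 0 < β) (hκ : κ ≠ 0) (l : ℝ) :
    ∀ᶠ s : ℝ in atTop, 2 * ((1 + β * s) * (1 + κ ^ 2 * s) ^ 3 * (1 + (κ ^ 2 + β * l ^ 2) * s)) *
        ((2 * κ ^ 2 + β * l ^ 2 - κ ^ 2 * l ^ 2) + 2 * κ ^ 4 * s)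
      - (β * (1 + κ ^ 2 * s) ^ 3 * (1 + (κ ^ 2 + β * l ^ 2) * s)
        + 3 * κ ^ 2 * (1 + β * s) * (1 + κ ^ 2 * s) ^ 2 * (1 + (κ ^ 2 + β * l ^ 2) * s)
        + (κ ^ 2 + β * l ^ 2) * (1 + β * s) * (1 + κ ^ 2 * s) ^ 3) *
        (1 + (2 * κ ^ 2 + β * l ^ 2 - κ ^ 2 * l ^ 2) * s + κ ^ 4 * s ^ 2) ≠ 0 := by
  have hμ : 0 < κ ^ 2 + β * l ^ 2 := by positivity
  generalize κ ^ 2 + β * l ^ 2 = μ at hμ ⊢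
  generalize 2 * κ ^ 2 + β * l ^ 2 - κ ^ 2 * l ^ 2 = ν
  have h1 : Continuous fun a : ℝ => 2 * ((a + β) * (a + κ ^ 2) ^ 3 * (a + μ)) *
        (ν * a + 2 * κ ^ 4)
      - (β * (a + κ ^ 2) ^ 3 * (a + μ) + 3 * κ ^ 2 * (a + β) * (a + κ ^ 2) ^ 2 * (a + μ)
        + μ * (a + β) * (a + κ ^ 2) ^ 3) * (a ^ 2 + ν * a + κ ^ 4) := by
    fun_prop
  have h2 := (h1.tendsto 0).comp tendsto_inv_atTop_zero
  have h3 : -(β * κ ^ 10 * μ) ≠ 0 := by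
    have : 0 < κ ^ 10 := by positivity
    exact neg_ne_zero.2 (by positivity)
  filter_upwards [h2 (isOpen_ne.mem_nhds (show _ ≠ (0 : ℝ) by ring_nf at h3 ⊢; exact h3)),
    eventually_gt_atTop 0] with s hs h0 h
  refine hs ?_
  rw [Function.comp_apply, ← mul_right_inj' (pow_ne_zero 6 h0.ne'), mul_zero, ← h]
  field_simp

section

variable {n : ℕ} {x : Fin n → Space} {i : Fin n} {g c : Fin n → ℝ}

theorem tendsto_inner_coulombField_self (hx : Function.Injective x) (hi : g i ≠ 0) :
    Tendsto (fun y => (inner ℝ (coulombField x g y) (coulombField x g y) : ℝ)) (𝓝[≠] (x i))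
      atTop := by
  have h1 : Tendsto (fun y => ‖y - x i‖⁻¹ ^ 2) (𝓝[≠] (x i)) atTop :=
    (tendsto_pow_atTop two_ne_zero).comp (tendsto_inv_nhdsGT_zero.comp (tendsto_norm_sub_nhdsNE _))
  obtain ⟨C, hC0, hC⟩ := (inv_sq_isBigO_coulombField hx i hi).exists_pos
  have h2 : Tendsto (fun y => ‖coulombField x g y‖) (𝓝[≠] (x i)) atTop := by
    refine tendsto_atTop_mono' _ ?_ (h1.const_mul_atTop (inv_pos.2 hC0))
    filter_upwards [hC.bound] with y hy
    rw [inv_mul_le_iff₀ hC0]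
    exact (le_abs_self _).trans hy
  simp only [real_inner_self_eq_norm_sq]
  exact (tendsto_pow_atTop two_ne_zero).comp h2

/-- If `∇(B²) ∧ B` vanishes near a charge of the Coulomb field `B`, there is no other charge. -/
theorem eq_zero_of_coreObstruction_eq_zero (hx : Function.Injective x) (hi : g i ≠ 0)
    (h : ∀ᶠ y in 𝓝[≠] (x i), ∀ m e, (jetOf (coulombField x g y) (coulombField x 0 y)
      (coulombDeriv x g y) (coulombDeriv x 0 y) m e).coreObstruction = 0) {j : Fin n} (hj : j ≠ i) :
    g j = 0 := by
  obtain ⟨δ, hδ0, hδ⟩ := Metric.mem_nhdsWithin_iff.1 h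
  obtain ⟨m, hm, hinj⟩ := exists_injective_inner hx i
  obtain ⟨e, he, hme⟩ := exists_norm_one_inner_eq_zero m
  obtain ⟨r, hr0, hrδ, hr⟩ := exists_pos_forall_lt_norm_sub hx i hδ0
  set b : Fin n → ℂ := fun j => ((g j / (4 * Real.pi) : ℝ) : ℂ) with hb
  have hb0 : ∀ j, b j = 0 → g j = 0 := by
    intro j hj
    have := Complex.ofReal_eq_zero.1 hj
    exact (div_eq_zero_iff.1 this).resolve_right (by positivity)
  have key : ∀ ξ ∈ Set.Ioo 0 r, coneMoment x i m e (Function.update b i 0) 0 ξ =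
      ξ * coneMoment x i m e (Function.update b i 0) 1 ξ := by
    intro ξ hξ
    have h1 := conePath hm he hme hξ.1 (fun j hj => by linarith [hξ.2, hr j hj, hξ.1]) b
      (c := fun _ => ((0 / (4 * Real.pi) : ℝ) : ℂ)) (by simp)
    have h2 := h1.tendsto_coreObstruction (b i)
    have h3 := eventually_eq_zero_conePath (g := g) (c := 0) hm he hme
      (fun J U h => h.coreObstruction) coreObstruction_rotate (fun y hy hyδ => by
        rw [FieldJet.coreObstruction_map, Complex.ofReal_eq_zero]
        exact hδ ⟨by rwa [mem_ball_iff_norm], hy⟩ m e) hξ.1 (by linarith [hξ.2])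
      (fun j hj => by linarith [hξ.2, hr j hj])
    have h4 := tendsto_nhds_unique_of_eventuallyEq h2 (tendsto_const_nhds (x := (0 : ℂ))) (by
      filter_upwards [h3] with k hk
      rw [← hb, kernelJet_eq_conePath_jet (i := i) (ε := fun k => (conePathDist k : ℂ))
        (conePathInvDist_self hm he hme hξ.1)] at hk
      exact mul_eq_zero_of_right _ hk)
    rw [kernelSum_dotProduct_nullDir hm he hme, nullDir_dotProduct_kernelSumDeriv hm he hme] at h4
    have h5 := (mul_eq_zero.1 h4).resolve_left (mul_ne_zero (pow_ne_zero 2 fun h => hi (hb0 i h))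
      (by exact_mod_cast hξ.1.ne'))
    linear_combination h5 / 3
  have hd : ∀ j, Function.update b i 0 j ≠ 0 → r ≤ ‖x i - x j‖ := by
    intro j hj
    have : j ≠ i := by
      rintro rfl
      exact hj (Function.update_self ..)
    linarith [hr j this]
  have h1 := coneMoment_eq_zero hm hd (coneMoment_eq_zero_of_eq hm hd key)
  have h2 := eq_zero_of_coneMoment_eq_zero hm hx hinj (half_pos hr0).le
    (fun j hj => by linarith [hr j hj]) (fun k => h1 k _ ⟨half_pos hr0, half_lt_self hr0⟩) hj
  rw [Function.update_of_ne hj] at h2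
  exact hb0 j h2

/-- If an obstruction whose leading coefficient at the null cone is cubic in the component of `V`
along the cone vanishes near a charge of `B` at which `V` is regular, then `V = 0`. -/
theorem eq_zero_of_cubic_asymptotics (hx : Function.Injective x) (hi : g i ≠ 0) (hc : c i = 0)
    {Φ : FieldJet ℂ → ℂ}
    (hΦ : ∀ (J : ℂ → FieldJet ℂ) (U : Set ℂ), FieldJet.HolomorphicOn J U →
      DifferentiableOn ℂ (fun Y => Φ (J Y)) U) {A C : ℂ} (hrot : ∀ J, Φ J.rotate = A * Φ J)
    (hC : C ≠ 0) {p r : ℕ}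
    (hlim : ∀ {e : ℕ → ℂ} {J : ℕ → FieldJet ℂ} {b ξ S v' t₀ t₁ t₂ T : ℂ},
      FieldJet.ConeAsymptotics atTop e J b ξ S v' t₀ t₁ t₂ T → ξ ≠ 0 →
      Tendsto (fun k => e k ^ p * Φ (J k)) atTop (𝓝 (C * b ^ r * (ξ * S) ^ 3)))
    (h : ∀ᶠ y in 𝓝[≠] (x i), ∀ m e, Φ ((jetOf (coulombField x g y) (coulombField x c y)
      (coulombDeriv x g y) (coulombDeriv x c y) m e).map Complex.ofReal) = 0) : c = 0 := by
  obtain ⟨δ, hδ0, hδ⟩ := Metric.mem_nhdsWithin_iff.1 h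
  obtain ⟨m, hm, hinj⟩ := exists_injective_inner hx i
  obtain ⟨e, he, hme⟩ := exists_norm_one_inner_eq_zero m
  obtain ⟨r, hr0, hrδ, hr⟩ := exists_pos_forall_lt_norm_sub hx i hδ0
  set b : Fin n → ℂ := fun j => ((g j / (4 * Real.pi) : ℝ) : ℂ) with hb
  set a : Fin n → ℂ := fun j => ((c j / (4 * Real.pi) : ℝ) : ℂ) with ha
  have hbi : b i ≠ 0 := Complex.ofReal_ne_zero.2 (div_ne_zero hi (by positivity))
  have hai : a i = 0 := by simp [ha, hc]
  have key : ∀ ξ ∈ Set.Ioo 0 r, coneMoment x i m e a 0 ξ = 0 := by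
    intro ξ hξ
    have hξ0 : (ξ : ℂ) ≠ 0 := by exact_mod_cast hξ.1.ne'
    have h1 := conePath hm he hme hξ.1 (fun j hj => by linarith [hξ.2, hr j hj, hξ.1]) b hai
    have h2 := hlim (h1.coneAsymptotics (b i)) hξ0
    have h3 := eventually_eq_zero_conePath (g := g) (c := c) hm he hme hΦ hrot (fun y hy hyδ =>
        hδ ⟨by rwa [mem_ball_iff_norm], hy⟩ m e) hξ.1 (by linarith [hξ.2])
      (fun j hj => by linarith [hξ.2, hr j hj])
    have h4 := tendsto_nhds_unique_of_eventuallyEq h2 (tendsto_const_nhds (x := (0 : ℂ))) (by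
      filter_upwards [h3] with k hk
      rw [kernelJet_eq_conePath_jet (i := i) (ε := fun k => (conePathDist k : ℂ))
        (conePathInvDist_self hm he hme hξ.1)] at hk
      exact mul_eq_zero_of_right _ hk)
    rw [kernelSum_dotProduct_nullDir hm he hme] at h4
    have h5 := (mul_eq_zero.1 h4).resolve_left (mul_ne_zero hC (pow_ne_zero _ hbi))
    exact (mul_eq_zero.1 ((pow_eq_zero_iff three_ne_zero).1 h5)).resolve_left hξ0
  have hd : ∀ j, a j ≠ 0 → r ≤ ‖x i - x j‖ := by
    intro j hj
    have : j ≠ i := by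
      rintro rfl
      exact hj hai
    linarith [hr j this]
  have h1 := coneMoment_eq_zero hm hd key
  ext j
  rcases eq_or_ne j i with rfl | hj
  · exact hc
  · have h2 := eq_zero_of_coneMoment_eq_zero hm hx hinj (half_pos hr0).le
      (fun j hj => by linarith [hr j hj]) (fun k => h1 k _ ⟨half_pos hr0, half_lt_self hr0⟩) hj
    exact (div_eq_zero_iff.1 (Complex.ofReal_eq_zero.1 h2)).resolve_right (by positivity)

theorem exists_curl_saturate_ne_zero {β : ℝ} {q : Fin n → ℝ} (hβ : 0 < β)
    (hx : Function.Injective x) (h2 : 2 ≤ n) (hq : ∀ i, q i ≠ 0) :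
    ∃ y ∉ Set.range x, curl (fun y => saturate β (coulombField x q y)) y ≠ 0 := by
  by_contra! hcurl
  have hne : (⟨1, by omega⟩ : Fin n) ≠ ⟨0, by omega⟩ := by simp
  refine hq _ (eq_zero_of_coreObstruction_eq_zero hx (hq _) ?_ hne)
  filter_upwards [eventually_nhdsWithin_mem_compl hx _] with y hy m e
  exact coreObstruction_eq_zero hβ (hasFDerivAt_coulombField hy) (inner_coulombDeriv_comm y)
    (hcurl y hy) _ _ _ _

theorem coulombField_smul_add (l : ℝ) (g c : Fin n → ℝ) (y : Space) :
    coulombField x (l • g + c) y = l • coulombField x g y + coulombField x c y := by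
  simp only [coulombField, Finset.smul_sum, ← Finset.sum_add_distrib, smul_smul, ← add_smul]
  refine Finset.sum_congr rfl fun j _ => ?_
  congr 1
  simp only [Pi.add_apply, Pi.smul_apply, smul_eq_mul]
  ring

theorem coulombDeriv_zero (y : Space) : coulombDeriv x 0 y = 0 := by
  ext
  simp [coulombDeriv, sum_apply]

/-- The electric and magnetic charges `q = l g + c` are split such that `c` vanishes at the charge
at which the fields are expanded. -/
theorem exists_eq_smul_add (q : Fin n → ℝ) (hq : ∀ i, q i ≠ 0) (hg : g i ≠ 0) :
    ∃ (l : ℝ) (c : Fin n → ℝ), l ≠ 0 ∧ c i = 0 ∧ q = l • g + c :=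
  ⟨q i / g i, q - (q i / g i) • g, div_ne_zero (hq i) hg, by simp [hg], by simp⟩

theorem exists_curl_dyonE_ne_zero {β κ : ℝ} {q g : Fin n → ℝ} (hβ : 0 < β) (hκ : κ ≠ 0)
    (hx : Function.Injective x) (h2 : 2 ≤ n) (hq : ∀ i, q i ≠ 0) (hg : ∀ i, g i ≠ 0) :
    ∃ y ∉ Set.range x, curl (fun y => dyonE β κ (coulombField x q y) (coulombField x g y)) y ≠ 0 := by
  by_contra! hcurl
  have hne : (⟨1, by omega⟩ : Fin n) ≠ ⟨0, by omega⟩ := by simp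
  obtain ⟨l, c, hl, hc, rfl⟩ := exists_eq_smul_add (i := ⟨0, by omega⟩) q hq (hg _)
  simp only [coulombField_smul_add] at hcurl
  have h1 : ∀ y ∈ (Set.range x)ᶜ, ∀ m e, (jetOf (coulombField x g y) (coulombField x c y)
      (coulombDeriv x g y) (coulombDeriv x c y) m e).electricObstruction β κ l = 0 :=
    fun y hy => electricObstruction_eq_zero hβ (hasFDerivAt_coulombField hy)
      (hasFDerivAt_coulombField hy) (inner_coulombDeriv_comm y) (inner_coulombDeriv_comm y)
      (hcurl y hy)
  obtain rfl : c = 0 := by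
    refine eq_zero_of_cubic_asymptotics hx (hg _) hc
      (Φ := fun J => J.electricObstruction (β : ℂ) κ l) (C := -(β : ℂ) ^ 2 * (κ : ℂ) ^ 6)
      (fun J U h => h.electricObstruction _ _ _) (electricObstruction_rotate _ _ _) ?_
      (fun h hξ => h.tendsto_electricObstruction _ _ _ hξ) ?_
    · exact mul_ne_zero (neg_ne_zero.2 (pow_ne_zero 2 (by exact_mod_cast hβ.ne')))
        (pow_ne_zero 6 (by exact_mod_cast hκ))
    · filter_upwards [eventually_nhdsWithin_mem_compl hx _] with y hy m e
      rw [FieldJet.electricObstruction_map, h1 y hy, Complex.ofReal_zero]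
  refine hg _ (eq_zero_of_coreObstruction_eq_zero hx (hg _) ?_ hne)
  filter_upwards [eventually_nhdsWithin_mem_compl hx _,
    (tendsto_inner_coulombField_self hx (hg _)).eventually
      (eventually_electricFactor_ne_zero hβ hκ l)] with y hy hs m e
  have h3 := h1 y hy m e
  rw [FieldJet.electricObstruction_of_proportional] at h3
  · exact (mul_eq_zero.1 h3).resolve_left (mul_ne_zero hl hs)
  all_goals simp [jetOf, coulombField_zero, coulombDeriv_zero]

theorem exists_curl_dyonH_ne_zero {β κ : ℝ} {q g : Fin n → ℝ} (hβ : 0 < β) (hκ : κ ≠ 0)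
    (hx : Function.Injective x) (h2 : 2 ≤ n) (hq : ∀ i, q i ≠ 0) (hg : ∀ i, g i ≠ 0) :
    ∃ y ∉ Set.range x, curl (fun y => dyonH β κ (coulombField x q y) (coulombField x g y)) y ≠ 0 := by
  by_contra! hcurl
  have hne : (⟨1, by omega⟩ : Fin n) ≠ ⟨0, by omega⟩ := by simp
  obtain ⟨l, c, hl, hc, rfl⟩ := exists_eq_smul_add (i := ⟨0, by omega⟩) q hq (hg _)
  simp only [coulombField_smul_add] at hcurl
  have h1 : ∀ y ∈ (Set.range x)ᶜ, ∀ m e, (jetOf (coulombField x g y) (coulombField x c y)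
      (coulombDeriv x g y) (coulombDeriv x c y) m e).magneticObstruction β κ l = 0 :=
    fun y hy => magneticObstruction_eq_zero hβ (hasFDerivAt_coulombField hy)
      (hasFDerivAt_coulombField hy) (inner_coulombDeriv_comm y) (inner_coulombDeriv_comm y)
      (hcurl y hy)
  obtain rfl : c = 0 := by
    refine eq_zero_of_cubic_asymptotics hx (hg _) hc
      (Φ := fun J => J.magneticObstruction (β : ℂ) κ l) (C := (β : ℂ) ^ 3 * (κ : ℂ) ^ 12 * l)
      (fun J U h => h.magneticObstruction _ _ _) (magneticObstruction_rotate _ _ _) ?_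
      (fun h hξ => h.tendsto_magneticObstruction _ _ _ hξ) ?_
    · exact mul_ne_zero (mul_ne_zero (pow_ne_zero 3 (by exact_mod_cast hβ.ne'))
        (pow_ne_zero 12 (by exact_mod_cast hκ))) (by exact_mod_cast hl)
    · filter_upwards [eventually_nhdsWithin_mem_compl hx _] with y hy m e
      rw [FieldJet.magneticObstruction_map, h1 y hy, Complex.ofReal_zero]
  refine hg _ (eq_zero_of_coreObstruction_eq_zero hx (hg _) ?_ hne)
  filter_upwards [eventually_nhdsWithin_mem_compl hx _,
    (tendsto_inner_coulombField_self hx (hg _)).eventually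
      (eventually_magneticFactor_ne_zero hβ hκ l)] with y hy hs m e
  have h3 := h1 y hy m e
  rw [FieldJet.magneticObstruction_of_proportional] at h3
  · exact (mul_eq_zero.1 h3).resolve_left hs
  all_goals simp [jetOf, coulombField_zero, coulombDeriv_zero]

end

end BornInfeld

end

theorem theorem2p1 (n : ℕ) (hn : 1 ≤ n) (x : Fin n → BornInfeld.Space)
    (hx : Function.Injective x) (β κ : ℝ) (hβ : 0 < β) :
    -- (i) electric point charges
    (∀ q : Fin n → ℝ, (∀ i, q i ≠ 0) →
      let D : BornInfeld.Space → BornInfeld.Space := BornInfeld.coulombField x q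
      let E : BornInfeld.Space → BornInfeld.Space := fun y => BornInfeld.saturate β (D y)
      let jm : BornInfeld.VectorDist := BornInfeld.toDist (fun y => -BornInfeld.curl E y)
      BornInfeld.IsStaticSolution β κ (Set.range x) (BornInfeld.pointCharges x q) 0 0 jm E 0 D 0 ∧
      LocallyIntegrable (BornInfeld.curl E) ∧
      BornInfeld.FiniteEnergy β κ E 0 ∧
      BornInfeld.HasFreeCharge E (∑ i, q i) ∧
      (2 ≤ n → (∃ y ∉ Set.range x, BornInfeld.curl E y ≠ 0) ∧ jm ≠ 0)) ∧
    -- (ii) magnetic point charges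
    (∀ g : Fin n → ℝ, (∀ i, g i ≠ 0) →
      let B : BornInfeld.Space → BornInfeld.Space := BornInfeld.coulombField x g
      let H : BornInfeld.Space → BornInfeld.Space := fun y => BornInfeld.saturate β (B y)
      let je : BornInfeld.VectorDist := BornInfeld.toDist (BornInfeld.curl H)
      BornInfeld.IsStaticSolution β κ (Set.range x) 0 (BornInfeld.pointCharges x g) je 0 0 B 0 H ∧
      LocallyIntegrable (BornInfeld.curl H) ∧
      BornInfeld.FiniteEnergy β κ 0 B ∧
      BornInfeld.HasFreeCharge H (∑ i, g i) ∧
      (2 ≤ n → (∃ y ∉ Set.range x, BornInfeld.curl H y ≠ 0) ∧ je ≠ 0)) ∧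
    -- (iii) dyonic point charges
    (∀ q g : Fin n → ℝ, (∀ i, q i ≠ 0) → (∀ i, g i ≠ 0) →
      let D : BornInfeld.Space → BornInfeld.Space := BornInfeld.coulombField x q
      let B : BornInfeld.Space → BornInfeld.Space := BornInfeld.coulombField x g
      let E : BornInfeld.Space → BornInfeld.Space := fun y => BornInfeld.dyonE β κ (D y) (B y)
      let H : BornInfeld.Space → BornInfeld.Space := fun y => BornInfeld.dyonH β κ (D y) (B y)
      ∃ je jm : BornInfeld.VectorDist,
        BornInfeld.IsStaticSolution β κ (Set.range x) (BornInfeld.pointCharges x q)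
          (BornInfeld.pointCharges x g) je jm E B D H ∧
        (BornInfeld.FiniteEnergy β κ E B ↔ κ ≠ 0) ∧
        (κ ≠ 0 →
          BornInfeld.HasFreeChargeLim x E (∑ i, q i) ∧
          BornInfeld.HasFreeChargeLim x H (∑ i, g i) ∧
          (2 ≤ n →
            (∃ y ∉ Set.range x, BornInfeld.curl E y ≠ 0) ∧
            (∃ y ∉ Set.range x, BornInfeld.curl H y ≠ 0) ∧
            jm ≠ 0 ∧ je ≠ 0))) := by
  refine ⟨fun q hq => ?_, fun g hg => ?_, fun q g hq hg => ?_⟩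
  · refine ⟨BornInfeld.isStaticSolution_electric hβ hx hq,
      BornInfeld.locallyIntegrable_curl_saturate hβ hx hq,
      BornInfeld.finiteEnergy_electric hβ hx q, BornInfeld.hasFreeCharge_saturate hβ hx hq,
      fun h2 => ?_⟩
    obtain ⟨y, hy, hc⟩ := BornInfeld.exists_curl_saturate_ne_zero hβ hx h2 hq
    refine ⟨⟨y, hy, hc⟩, ?_⟩
    rw [BornInfeld.toDist_neg (BornInfeld.locallyIntegrable_curl_saturate hβ hx hq), neg_ne_zero,
      ← BornInfeld.distCurl_saturate hβ hx hq]
    exact BornInfeld.distCurl_toDist_ne_zero (BornInfeld.isOpen_compl_range x)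
      ((BornInfeld.contDiffOn_saturate_coulombField hβ q).of_le (by simp))
      (BornInfeld.locallyIntegrable_saturate hβ q) hy hc
  · refine ⟨BornInfeld.isStaticSolution_magnetic hβ hx hg,
      BornInfeld.locallyIntegrable_curl_saturate hβ hx hg,
      BornInfeld.finiteEnergy_magnetic hβ hx g, BornInfeld.hasFreeCharge_saturate hβ hx hg,
      fun h2 => ?_⟩
    obtain ⟨y, hy, hc⟩ := BornInfeld.exists_curl_saturate_ne_zero hβ hx h2 hg
    refine ⟨⟨y, hy, hc⟩, ?_⟩
    rw [← BornInfeld.distCurl_saturate hβ hx hg]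
    exact BornInfeld.distCurl_toDist_ne_zero (BornInfeld.isOpen_compl_range x)
      ((BornInfeld.contDiffOn_saturate_coulombField hβ g).of_le (by simp))
      (BornInfeld.locallyIntegrable_saturate hβ g) hy hc
  · refine ⟨_, _, BornInfeld.isStaticSolution_dyon hβ hx q hg, ⟨?_, fun hκ => ?_⟩, fun hκ => ?_⟩
    · rintro h rfl
      exact BornInfeld.not_finiteEnergy_dyon hβ hx (hq ⟨0, hn⟩) (hg ⟨0, hn⟩) h
    · exact BornInfeld.finiteEnergy_dyon hβ hκ hx q hg
    · refine ⟨BornInfeld.hasFreeChargeLim_dyonE hβ hκ hx hq g,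
        BornInfeld.hasFreeChargeLim_dyonH hβ hκ hx hq hg, fun h2 => ?_⟩
      obtain ⟨y, hy, hc⟩ := BornInfeld.exists_curl_dyonE_ne_zero hβ hκ hx h2 hq hg
      obtain ⟨z, hz, hc'⟩ := BornInfeld.exists_curl_dyonH_ne_zero hβ hκ hx h2 hq hg
      refine ⟨⟨y, hy, hc⟩, ⟨z, hz, hc'⟩, ?_, ?_⟩
      · rw [neg_ne_zero]
        exact BornInfeld.distCurl_toDist_ne_zero (BornInfeld.isOpen_compl_range x)
          ((BornInfeld.contDiffOn_dyonE hβ κ x q g).of_le (by simp))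
          (BornInfeld.locallyIntegrable_dyonE hβ hx q g) hy hc
      · exact BornInfeld.distCurl_toDist_ne_zero (BornInfeld.isOpen_compl_range x)
          ((BornInfeld.contDiffOn_dyonH hβ κ x q g).of_le (by simp))
          (BornInfeld.locallyIntegrable_dyonH hβ hx q hg) hz hc'
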